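/- All alphabets below are finite; for $j\in\{1,2\}$ let $j'$ be the other index. Let $(S_{1,k},S_{2,k})_{k\ge1}$ be i.i.d. pairs with law $P_{S_1,S_2}$ on $\mathcal S_1\times\mathcal S_2$, let $d_j:\mathcal S_j\times\hat{\mathcal S}_j\to\mathbb R_{\ge0}$ be distortion measures, and let $P_{Y_1,Y_2|X_1,X_2}$ be a discrete memoryless two-way channel with input alphabets $\mathcal X_j$ and output alphabets $\mathcal Y_j$. **Codes and achievability.** An $(N,K)$ code consists of encoders $f_{j,n}:\mathcal S_j^K\times\mathcal Y_j^{n-1}\to\mathcal X_j$ ($1\le n\le N$, $j=1,2$) and decoders $g_j:\mathcal S_j^K\times\mathcal Y_j^N\to\hat{\mathcal S}_{j'}^K$. Terminal $j$ sends $X_{j,n}=f_{j,n}(S_j^K,Y_j^{n-1})$ in the $n$th channel use and reconstructs $\hat S_{j'}^K=g_j(S_j^K,Y_j^N)$. The expected distortions of the code are $D_j(K)=\mathbb E\big[K^{-1}\sum_{k=1}^K d_j(S_{j,k},\hat S_{j,k})\big]$. A pair $(D_1,D_2)$ is achievable at rate $R$ if there is a sequence of $(N,K)$ codes, $N$ being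 a function of $K$, with $\lim_{K\to\infty}K/N=R$ and $\limsup_{K\to\infty}D_j(K)\le D_j$ for $j=1,2$. **Wyner–Ziv functions.** Put $$R^{(j)}_{\mathrm{WZ}}(D)=\min\, I(S_j;T_j\,|\,S_{j'}),$$ where the minimum is over all conditional laws $P_{T_j|S_j}$ with $|\mathcal T_j|\le|\mathcal S_j|+1$ and $T_j\to S_j\to S_{j'}$ a Markov chain, and all $h:\mathcal T_j\times\mathcal S_{j'}\to\hat{\mathcal S}_j$ with $\mathbb E[d_j(S_j,h(T_j,S_{j'}))]\le D$ (and $R^{(j)}_{\mathrm{WZ}}(D)=\infty$ if there are none). **Han's distributions.** Let $\mathcal V_1,\mathcal V_2$ be finite sets. A joint distribution of Han's type is the law of random variables $V_j,\tilde V_j\in\mathcal V_j$, $\tilde W_j\in\mathcal X_j\times\mathcal Y_j$, $X_j\in\mathcal X_j$, $Y_j\in\mathcal Y_j$ ($j=1,2$) such that * $V_1$, $V_2$ and $(\tilde V_1,\tilde V_2,\tilde W_1,\tilde W_2)$ are independent; * $X_j=\gamma_j(V_j,\tilde V_j,\tilde W_j)$ for some functions $\gamma_j$, $j=1,2$; *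 given all the other variables, $(Y_1,Y_2)$ has law $P_{Y_1,Y_2|X_1,X_2}(\cdot\,|\,X_1,X_2)$; * $(V_1,V_2,(X_1,Y_1),(X_2,Y_2))$ has the same law as $(\tilde V_1,\tilde V_2,\tilde W_1,\tilde W_2)$. **Corollary 3 (General-rate separate source-channel coding with Wyner–Ziv source coding and Han's adaptive channel coding).** Let $K,N\ge1$ be integers and $D_1,D_2$ real numbers. If $$K\cdot R^{(1)}_{\mathrm{WZ}}(D_1)<N\cdot I(\tilde V_1;X_2,Y_2,\tilde V_2,\tilde W_2),\qquad K\cdot R^{(2)}_{\mathrm{WZ}}(D_2)<N\cdot I(\tilde V_2;X_1,Y_1,\tilde V_1,\tilde W_1)$$ for some joint distribution of Han's type, then $(D_1,D_2)$ is achievable at rate $K/N$. -/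

import Mathlib

open Filter Topology
open scoped NNReal

namespace TwoWayCoding

/-! ### Entropy and mutual information on finite alphabets -/

/-- Shannon entropy of a distribution on a finite alphabet. Natural logarithms are used; another
base multiplies all the information quantities below by the same positive constant. -/
noncomputable def entropy {α : Type*} [Fintype α] (p : PMF α) : ℝ :=
  ∑ a, Real.negMulLog (p a).toReal

/-- Mutual information `I(A; B) = H(A) + H(B) - H(A, B)` of two finite-valued random variables on
a discrete probability space. -/
noncomputable def mutualInfo {Ω α β : Type*} [Fintype α] [Fintype β]
    (p : PMF Ω) (A : Ω → α) (B : Ω → β) : ℝ :=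
  entropy (p.map A) + entropy (p.map B) - entropy (p.map fun ω => (A ω, B ω))

/-- Conditional mutual information `I(A; B | C) = H(A, C) + H(B, C) - H(A, B, C) - H(C)`. -/
noncomputable def condMutualInfo {Ω α β γ : Type*} [Fintype α] [Fintype β] [Fintype γ]
    (p : PMF Ω) (A : Ω → α) (B : Ω → β) (C : Ω → γ) : ℝ :=
  entropy (p.map fun ω => (A ω, C ω)) + entropy (p.map fun ω => (B ω, C ω))
    - entropy (p.map fun ω => (A ω, B ω, C ω)) - entropy (p.map C)

/-! ### The Wyner-Ziv rate-distortion function -/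

/-- Joint law of `(S, S', T)`, where `(S, S')` has law `P` and `T` is drawn from `q S`; thus
`T → S → S'` is a Markov chain. -/
noncomputable def wzLaw {S S' T : Type*} (P : PMF (S × S')) (q : S → PMF T) :
    PMF (S × S' × T) :=
  P.bind fun s => (q s.1).map fun t => (s.1, s.2, t)

/-- Wyner-Ziv rate-distortion function of the source `S` with side information `S'`, where
`(S, S')` has law `P`: the infimum of `I(S; T | S')` over all conditional laws `q = P_{T|S}` on an
alphabet with `|S| + 1` letters (unused letters being allowed) and all `h` such that
`E[d(S, h(T, S'))] ≤ D`. It is `⊤` if no such pair `(q, h)` exists. -/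
noncomputable def wzRate {S S' R : Type*} [Fintype S] [Fintype S']
    (P : PMF (S × S')) (d : S → R → ℝ≥0) (D : ℝ) : EReal :=
  ⨅ (q : S → PMF (Fin (Fintype.card S + 1))) (h : Fin (Fintype.card S + 1) → S' → R)
    (_ : ∑ ω : S × S' × Fin (Fintype.card S + 1),
      (wzLaw P q ω).toReal * (d ω.1 (h ω.2.2 ω.2.1) : ℝ) ≤ D),
    ((condMutualInfo (wzLaw P q) (fun ω => ω.1) (fun ω => ω.2.2) (fun ω => ω.2.1) : ℝ) : EReal)

/-! ### Two-way joint source-channel codes -/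

/-- An `(N, K)` joint source-channel code. In `enc₁ n s y` and `enc₂ n s y` the times `n` are
numbered from `0`, so that `y` collects the `n` channel outputs received before time `n`. -/
structure Code (S₁ S₂ R₁ R₂ X₁ X₂ Y₁ Y₂ : Type*) (N K : ℕ) where
  /-- encoders of terminal 1 -/
  enc₁ : (n : Fin N) → (Fin K → S₁) → (Fin n → Y₁) → X₁
  /-- encoders of terminal 2 -/
  enc₂ : (n : Fin N) → (Fin K → S₂) → (Fin n → Y₂) → X₂
  /-- decoder of terminal 1, which reconstructs the source of terminal 2 -/
  dec₁ : (Fin K → S₁) → (Fin N → Y₁) → (Fin K → R₂)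
  /-- decoder of terminal 2, which reconstructs the source of terminal 1 -/
  dec₂ : (Fin K → S₂) → (Fin N → Y₂) → (Fin K → R₁)

namespace Code

variable {S₁ S₂ R₁ R₂ X₁ X₂ Y₁ Y₂ : Type*} {N K : ℕ}

/-- Channel input of terminal 1 at time `n`, given its source block and its channel outputs. -/
def input₁ (c : Code S₁ S₂ R₁ R₂ X₁ X₂ Y₁ Y₂ N K) (s₁ : Fin K → S₁) (y₁ : Fin N → Y₁)
    (n : Fin N) : X₁ :=
  c.enc₁ n s₁ fun i => y₁ (Fin.castLE n.2.le i)

/-- Channel input of terminal 2 at time `n`, given its source block and its channel outputs. -/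
def input₂ (c : Code S₁ S₂ R₁ R₂ X₁ X₂ Y₁ Y₂ N K) (s₂ : Fin K → S₂) (y₂ : Fin N → Y₂)
    (n : Fin N) : X₂ :=
  c.enc₂ n s₂ fun i => y₂ (Fin.castLE n.2.le i)

/-- Probability that the source blocks are `s₁, s₂` and the channel output blocks are `y₁, y₂`, for
an i.i.d. source with single-letter law `P` and the memoryless two-way channel `W`. -/
noncomputable def prob (c : Code S₁ S₂ R₁ R₂ X₁ X₂ Y₁ Y₂ N K) (P : PMF (S₁ × S₂))
    (W : X₁ → X₂ → PMF (Y₁ × Y₂)) (s₁ : Fin K → S₁) (s₂ : Fin K → S₂)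
    (y₁ : Fin N → Y₁) (y₂ : Fin N → Y₂) : ℝ :=
  (∏ k, (P (s₁ k, s₂ k)).toReal) *
    ∏ n, (W (c.input₁ s₁ y₁ n) (c.input₂ s₂ y₂ n) (y₁ n, y₂ n)).toReal

variable [Fintype S₁] [Fintype S₂] [Fintype Y₁] [Fintype Y₂]

/-- Expected distortion `E[K⁻¹ ∑ₖ d₁(S₁ₖ, Ŝ₁ₖ)]` of the reconstruction of the first source (at
terminal 2). -/
noncomputable def distortion₁ (c : Code S₁ S₂ R₁ R₂ X₁ X₂ Y₁ Y₂ N K) (P : PMF (S₁ × S₂))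
    (W : X₁ → X₂ → PMF (Y₁ × Y₂)) (d₁ : S₁ → R₁ → ℝ≥0) : ℝ :=
  ∑ s₁ : Fin K → S₁, ∑ s₂ : Fin K → S₂, ∑ y₁ : Fin N → Y₁, ∑ y₂ : Fin N → Y₂,
    c.prob P W s₁ s₂ y₁ y₂ * ((K : ℝ)⁻¹ * ∑ k, (d₁ (s₁ k) (c.dec₂ s₂ y₂ k) : ℝ))

/-- Expected distortion `E[K⁻¹ ∑ₖ d₂(S₂ₖ, Ŝ₂ₖ)]` of the reconstruction of the second source (at
terminal 1). -/
noncomputable def distortion₂ (c : Code S₁ S₂ R₁ R₂ X₁ X₂ Y₁ Y₂ N K) (P : PMF (S₁ × S₂))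
    (W : X₁ → X₂ → PMF (Y₁ × Y₂)) (d₂ : S₂ → R₂ → ℝ≥0) : ℝ :=
  ∑ s₁ : Fin K → S₁, ∑ s₂ : Fin K → S₂, ∑ y₁ : Fin N → Y₁, ∑ y₂ : Fin N → Y₂,
    c.prob P W s₁ s₂ y₁ y₂ * ((K : ℝ)⁻¹ * ∑ k, (d₂ (s₂ k) (c.dec₁ s₁ y₁ k) : ℝ))

end Code

/-- The distortion pair `(D₁, D₂)` is achievable at rate `r`: for some `K ↦ N K` there are
`(N K, K)` codes with `K / N K → r` and `limsup` of the expected distortions at most `D₁`, `D₂`.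
The upper limits are taken in the extended reals. -/
def Achievable {S₁ S₂ R₁ R₂ X₁ X₂ Y₁ Y₂ : Type*}
    [Fintype S₁] [Fintype S₂] [Fintype Y₁] [Fintype Y₂]
    (P : PMF (S₁ × S₂)) (W : X₁ → X₂ → PMF (Y₁ × Y₂))
    (d₁ : S₁ → R₁ → ℝ≥0) (d₂ : S₂ → R₂ → ℝ≥0) (r D₁ D₂ : ℝ) : Prop :=
  ∃ (N : ℕ → ℕ) (c : (K : ℕ) → Code S₁ S₂ R₁ R₂ X₁ X₂ Y₁ Y₂ (N K) K),
    Tendsto (fun K : ℕ => (K : ℝ) / (N K : ℝ)) atTop (𝓝 r) ∧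
    limsup (fun K : ℕ => (((c K).distortion₁ P W d₁ : ℝ) : EReal)) atTop ≤ (D₁ : EReal) ∧
    limsup (fun K : ℕ => (((c K).distortion₂ P W d₂ : ℝ) : EReal)) atTop ≤ (D₂ : EReal)

/-! ### The joint distributions of Han's adaptive channel coding scheme -/

/-- Values of the past variables `(Ṽ₁, Ṽ₂, W̃₁, W̃₂)`, where `W̃ⱼ` is a pair (input, output) of
terminal `j`. -/
abbrev HanPast (V₁ V₂ X₁ X₂ Y₁ Y₂ : Type*) : Type _ :=
  V₁ × V₂ × (X₁ × Y₁) × (X₂ × Y₂)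

/-- Values of `((V₁, V₂), (Ṽ₁, Ṽ₂, W̃₁, W̃₂), (X₁, X₂), (Y₁, Y₂))`. -/
abbrev HanSpace (V₁ V₂ X₁ X₂ Y₁ Y₂ : Type*) : Type _ :=
  (V₁ × V₂) × HanPast V₁ V₂ X₁ X₂ Y₁ Y₂ × (X₁ × X₂) × (Y₁ × Y₂)

/-- The law `P_{V₁} P_{V₂} P_{Ṽ₁,Ṽ₂,W̃₁,W̃₂} 1{X₁ = γ₁(V₁,Ṽ₁,W̃₁)} 1{X₂ = γ₂(V₂,Ṽ₂,W̃₂)}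
P_{Y₁,Y₂|X₁,X₂}`. -/
noncomputable def hanLaw {V₁ V₂ X₁ X₂ Y₁ Y₂ : Type*} (W : X₁ → X₂ → PMF (Y₁ × Y₂))
    (p₁ : PMF V₁) (p₂ : PMF V₂) (past : PMF (HanPast V₁ V₂ X₁ X₂ Y₁ Y₂))
    (γ₁ : V₁ → V₁ → X₁ × Y₁ → X₁) (γ₂ : V₂ → V₂ → X₂ × Y₂ → X₂) :
    PMF (HanSpace V₁ V₂ X₁ X₂ Y₁ Y₂) :=
  p₁.bind fun v₁ => p₂.bind fun v₂ => past.bind fun t =>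
    (W (γ₁ v₁ t.1 t.2.2.1) (γ₂ v₂ t.2.1 t.2.2.2)).map fun y =>
      ((v₁, v₂), t, (γ₁ v₁ t.1 t.2.2.1, γ₂ v₂ t.2.1 t.2.2.2), y)

/-- A joint distribution of Han's type for the two-way channel `W`: the auxiliary variables `V₁`,
`V₂` are independent of each other and of the past `(Ṽ₁, Ṽ₂, W̃₁, W̃₂)`, the inputs are
`Xⱼ = γⱼ(Vⱼ, Ṽⱼ, W̃ⱼ)`, and `(V₁, V₂, (X₁, Y₁), (X₂, Y₂))` has the same law as the past. (In
particular `Ṽ₁`, `Ṽ₂` are independent and distributed as `V₁`, `V₂`.) -/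
structure HanDistribution {X₁ X₂ Y₁ Y₂ : Type*} (W : X₁ → X₂ → PMF (Y₁ × Y₂))
    (V₁ V₂ : Type*) where
  /-- law of `V₁` -/
  p₁ : PMF V₁
  /-- law of `V₂` -/
  p₂ : PMF V₂
  /-- law of `(Ṽ₁, Ṽ₂, W̃₁, W̃₂)` -/
  past : PMF (HanPast V₁ V₂ X₁ X₂ Y₁ Y₂)
  /-- encoding function of terminal 1 -/
  γ₁ : V₁ → V₁ → X₁ × Y₁ → X₁
  /-- encoding function of terminal 2 -/
  γ₂ : V₂ → V₂ → X₂ × Y₂ → X₂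
  /-- stationarity -/
  stationary : ((hanLaw W p₁ p₂ past γ₁ γ₂).map fun ω =>
    (ω.1.1, ω.1.2, (ω.2.2.1.1, ω.2.2.2.1), (ω.2.2.1.2, ω.2.2.2.2))) = past

namespace HanDistribution

variable {X₁ X₂ Y₁ Y₂ : Type*} {W : X₁ → X₂ → PMF (Y₁ × Y₂)} {V₁ V₂ : Type*}

/-- Joint law of all the variables. -/
noncomputable def law (H : HanDistribution W V₁ V₂) : PMF (HanSpace V₁ V₂ X₁ X₂ Y₁ Y₂) :=
  hanLaw W H.p₁ H.p₂ H.past H.γ₁ H.γ₂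

variable [Fintype X₁] [Fintype X₂] [Fintype Y₁] [Fintype Y₂] [Fintype V₁] [Fintype V₂]

/-- `I(Ṽ₁; X₂, Y₂, Ṽ₂, W̃₂)`. -/
noncomputable def info₁ (H : HanDistribution W V₁ V₂) : ℝ :=
  mutualInfo H.law (fun ω => ω.2.1.1)
    (fun ω => (ω.2.2.1.2, ω.2.2.2.2, ω.2.1.2.1, ω.2.1.2.2.2))

/-- `I(Ṽ₂; X₁, Y₁, Ṽ₁, W̃₁)`. -/
noncomputable def info₂ (H : HanDistribution W V₁ V₂) : ℝ :=
  mutualInfo H.law (fun ω => ω.2.1.2.1)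
    (fun ω => (ω.2.2.1.1, ω.2.2.2.1, ω.2.1.1, ω.2.1.2.2.1))

end HanDistribution

end TwoWayCoding

namespace TwoWayCoding

/-! Source coding and channel coding are solved separately and joined by a pair of messages.
Terminal `j` compresses `k` source letters at a rate slightly above `I(S_j; T_j | S_{j'})`, and the
channel code carries the two indices at rates slightly below Han's informations; the strict
inequalities of the hypothesis leave room for both. A channel error costs at most `totalCost`, so
the distortion exceeds the Wyner-Ziv distortion by at most `totalCost` times an error bound
(`cost_separateCode_le`).

Source part (`wynerZiv`). By the Markov chain, `I(S; T | S') = I(S; T) - I(T; S')`. Take i.i.d.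
codewords arranged in bins. With more than `exp(n I(S; T))` codewords in all, soft covering
(`soft_covering`) says that the source law is nearly the mixture, over a uniformly chosen codeword,
of the backward laws of the source given that codeword. Under this mixture the chosen codeword, the
source and the side information follow the test channel, and a threshold test identifies the
codeword inside its bin if the bin has fewer than `exp(n I(T; S'))` members. The encoder need not
imitate the mixture: choosing the bin of least expected cost does at least as well.

Channel part (`HanDistribution.exists_code`). The channel uses are grouped into columns of length `B
+ 1`, and each column restarts from a fictitious past known to both terminals. If these pasts are
i.i.d. with the stationary law, the columns are i.i.d. super-letters and, by stationarity, every use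
inside a column follows Han's law. A letter is judged by the observations of the following use, so a
column yields `B` likelihood ratios. Their product has mean logarithm `B` times the information
(`mean_log_metric₁`), but average at most one over an independent codeword (`sum_mul_metric₁_le`).
Threshold decoding thus works at any rate below `B` times the information per column, and the loss
`B / (B + 1)` is absorbed by taking `B` large.

The messages may be dependent, as the sources are. The random coding bound holds for every fixed
message pair, hence on average over any law of the pair; averaging then fixes one choice of pasts
and codebooks that serves both directions. -/

open scoped Classical in
/-- Zero-one indicator of a proposition. -/
noncomputable def ind (G : Prop) : ℝ := if G then 1 else 0

lemma ind_nonneg (G : Prop) : 0 ≤ ind G := by unfold ind; split_ifs <;> norm_num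

lemma ind_le_one (G : Prop) : ind G ≤ 1 := by unfold ind; split_ifs <;> norm_num

lemma ind_true {G : Prop} (h : G) : ind G = 1 := by simp [ind, h]

lemma ind_false {G : Prop} (h : ¬ G) : ind G = 0 := by simp [ind, h]

lemma ind_mono {G G' : Prop} (h : G → G') : ind G ≤ ind G' := by
  by_cases hG : G
  · rw [ind_true hG, ind_true (h hG)]
  · rw [ind_false hG]; exact ind_nonneg _

/-! ### Moments under product distributions. -/

section Product

variable {ι α : Type*} [Fintype ι] [DecidableEq ι] [Fintype α]

lemma sum_pi_prod (f : ι → α → ℝ) : ∑ x : ι → α, ∏ i, f i (x i) = ∏ i, ∑ a, f i a := by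
  rw [Finset.prod_univ_sum, Fintype.piFinset_univ]

lemma pi_mem_stdSimplex {p : α → ℝ} (hp : p ∈ stdSimplex ℝ α) :
    (fun x : ι → α => ∏ i, p (x i)) ∈ stdSimplex ℝ (ι → α) := by
  refine ⟨fun x => Finset.prod_nonneg fun i _ => hp.1 _, ?_⟩
  rw [sum_pi_prod fun _ => p]
  simp [hp.2]

lemma sum_pi_eval {p : α → ℝ} (hp : p ∈ stdSimplex ℝ α) (i : ι) (f : α → ℝ) :
    ∑ x : ι → α, (∏ l, p (x l)) * f (x i) = ∑ a, p a * f a := by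
  have h : ∀ x : ι → α, (∏ l, p (x l)) * f (x i)
      = ∏ l, (p (x l) * if l = i then f (x l) else 1) := by
    intro x
    rw [Finset.prod_mul_distrib]
    simp
  simp_rw [h]
  rw [sum_pi_prod fun l a => p a * if l = i then f a else 1, Fintype.prod_eq_single i]
  · simp
  · intro l hl
    simp [hl, hp.2]

lemma sum_pi_eval_two {p : α → ℝ} (hp : p ∈ stdSimplex ℝ α) {i j : ι} (hij : i ≠ j)
    (f : α → α → ℝ) :
    ∑ x : ι → α, (∏ l, p (x l)) * f (x i) (x j) = ∑ a, ∑ b, p a * p b * f a b := by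
  -- Splitting according to the value of `x i` turns `f (x i) (x j)` into a sum of products of
  -- functions of single coordinates.
  classical
  have h : ∀ a : α, ∑ x : ι → α, (∏ l, p (x l)) * (if x i = a then f a (x j) else 0)
      = ∑ b, p a * p b * f a b := by
    intro a
    have h' : ∀ x : ι → α, (∏ l, p (x l)) * (if x i = a then f a (x j) else 0)
        = ∏ l, (p (x l) * (if l = i then (if x l = a then 1 else 0) else 1)
          * if l = j then f a (x l) else 1) := by
      intro x
      rw [Finset.prod_mul_distrib, Finset.prod_mul_distrib]
      simp
    simp_rw [h']
    rw [sum_pi_prod fun l c => p c * (if l = i then (if c = a then 1 else 0) else 1)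
          * if l = j then f a c else 1, Fintype.prod_eq_mul i j hij]
    · simp [hij, hij.symm, Finset.mul_sum, mul_assoc]
    · rintro l ⟨hl, hl'⟩
      simp [hl, hl', hp.2]
  rw [← Finset.sum_congr rfl fun a _ => h a, Finset.sum_comm]
  refine Finset.sum_congr rfl fun x _ => ?_
  rw [← Finset.mul_sum]
  simp

/-- Additivity of variance for independent centred variables: the off-diagonal terms of the expanded
square vanish. -/
lemma sum_pi_sq {p : α → ℝ} (hp : p ∈ stdSimplex ℝ α) {g : α → ℝ} (hg : ∑ a, p a * g a = 0) :
    ∑ x : ι → α, (∏ l, p (x l)) * (∑ i, g (x i)) ^ 2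
      = Fintype.card ι * ∑ a, p a * g a ^ 2 := by
  have h : ∀ i j : ι, ∑ x : ι → α, (∏ l, p (x l)) * (g (x i) * g (x j))
      = if i = j then ∑ a, p a * g a ^ 2 else 0 := by
    intro i j
    split_ifs with hij
    · subst hij
      rw [sum_pi_eval hp i fun a => g a * g a]
      simp [sq]
    · rw [sum_pi_eval_two hp hij fun a b => g a * g b]
      have : ∀ a b, p a * p b * (g a * g b) = (p a * g a) * (p b * g b) := fun a b => by ring
      simp_rw [this, ← Finset.mul_sum, hg]
      simp
  simp_rw [sq (∑ i, g _), Finset.sum_mul_sum, Finset.mul_sum]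
  rw [Finset.sum_comm]
  simp_rw [Finset.sum_comm (s := (Finset.univ : Finset (ι → α))), h]
  simp [Finset.mul_sum]

end Product

/-! ### Derandomization by averaging. -/

section Selection

lemma exists_le_of_average_le {α : Type*} [Fintype α] {p : α → ℝ} (hp : p ∈ stdSimplex ℝ α)
    {f : α → ℝ} {c : ℝ} (h : ∑ a, p a * f a ≤ c) : ∃ a, f a ≤ c := by
  by_contra! hc
  obtain ⟨a, ha⟩ : ∃ a, 0 < p a := by
    by_contra! hn
    have : ∑ a, p a ≤ 0 := Finset.sum_nonpos fun a _ => hn a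
    rw [hp.2] at this
    linarith
  have : ∑ a, p a * c < ∑ a, p a * f a :=
    Finset.sum_lt_sum (fun a _ => mul_le_mul_of_nonneg_left (hc a).le (hp.1 a))
      ⟨a, Finset.mem_univ _, mul_lt_mul_of_pos_left (hc a) ha⟩
  rw [← Finset.sum_mul, hp.2] at this
  linarith

lemma average_le {α : Type*} [Fintype α] {p : α → ℝ} (hp : p ∈ stdSimplex ℝ α)
    {f : α → ℝ} {c : ℝ} (h : ∀ a, f a ≤ c) : ∑ a, p a * f a ≤ c := by
  calc ∑ a, p a * f a ≤ ∑ a, p a * c :=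
        Finset.sum_le_sum fun a _ => mul_le_mul_of_nonneg_left (h a) (hp.1 a)
    _ = c := by rw [← Finset.sum_mul, hp.2, one_mul]

end Selection

/-! ### Laws of large numbers for sums and for products of likelihood ratios. -/

section Tails

variable {α : Type*} [Fintype α]

/-- Weak law of large numbers for a finite alphabet, lower tail. -/
lemma tendsto_lowerTail {p : α → ℝ} (hp : p ∈ stdSimplex ℝ α) (g : α → ℝ) {c : ℝ}
    (hc : c < ∑ a, p a * g a) :
    Tendsto (fun n : ℕ => ∑ x : Fin n → α, (∏ i, p (x i)) * ind (∑ i, g (x i) ≤ n * c))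
      atTop (𝓝 0) := by
  set μ := ∑ a, p a * g a with hμ
  set V := ∑ a, p a * (g a - μ) ^ 2
  have hlim : Tendsto (fun n : ℕ => V / (μ - c) ^ 2 * ((n : ℝ))⁻¹) atTop (𝓝 0) := by
    simpa using (tendsto_inv_atTop_nhds_zero_nat (𝕜 := ℝ)).const_mul (V / (μ - c) ^ 2)
  refine squeeze_zero' (Eventually.of_forall fun n => Finset.sum_nonneg fun x _ =>
    mul_nonneg ((pi_mem_stdSimplex hp).1 x) (ind_nonneg _)) ?_ hlim
  filter_upwards [eventually_gt_atTop 0] with n hn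
  have hn' : (0 : ℝ) < n := by exact_mod_cast hn
  have hd : 0 < μ - c := sub_pos.2 hc
  have hcent : ∑ a, p a * (g a - μ) = 0 := by
    simp_rw [mul_sub, Finset.sum_sub_distrib, ← Finset.sum_mul, hp.2]
    simp [μ]
  have hsq := sum_pi_sq (ι := Fin n) hp hcent
  rw [Fintype.card_fin] at hsq
  -- Chebyshev's inequality: on the event the centred sum is at least `n * (μ - c)` in absolute
  -- value.
  have hpt : ∀ x : Fin n → α, (∏ i, p (x i)) * ind (∑ i, g (x i) ≤ n * c)
      ≤ ((∏ i, p (x i)) * (∑ i, (g (x i) - μ)) ^ 2) * ((n * (μ - c)) ^ 2)⁻¹ := by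
    intro x
    rw [mul_assoc]
    refine mul_le_mul_of_nonneg_left ?_ ((pi_mem_stdSimplex hp).1 x)
    by_cases hx : ∑ i, g (x i) ≤ n * c
    · rw [ind_true hx, ← div_eq_mul_inv, le_div_iff₀ (by positivity), one_mul,
        Finset.sum_sub_distrib]
      simp only [Finset.sum_const, Finset.card_univ, Fintype.card_fin, nsmul_eq_mul]
      refine sq_le_sq.2 ?_
      rw [abs_of_nonneg (by positivity), abs_of_nonpos (by nlinarith)]
      linarith
    · rw [ind_false hx]; positivity
  calc _ ≤ ∑ x : Fin n → α, ((∏ i, p (x i)) * (∑ i, (g (x i) - μ)) ^ 2)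
            * ((n * (μ - c)) ^ 2)⁻¹ := Finset.sum_le_sum fun x _ => hpt x
    _ = V / (μ - c) ^ 2 * ((n : ℝ))⁻¹ := by
        rw [← Finset.sum_mul, hsq]
        change n * V * _ = _
        field_simp

/-- The product of likelihood ratios is unlikely to be exponentially smaller than its mean
exponent predicts. -/
lemma tendsto_lowerTail_prod {p : α → ℝ} (hp : p ∈ stdSimplex ℝ α) {ρ : α → ℝ}
    (hρ : ∀ a, 0 < p a → 0 < ρ a) {c : ℝ} (hc : c < ∑ a, p a * Real.log (ρ a)) :
    Tendsto (fun n : ℕ => ∑ x : Fin n → α,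
      (∏ i, p (x i)) * ind (∏ i, ρ (x i) ≤ Real.exp (n * c))) atTop (𝓝 0) := by
  refine squeeze_zero (fun n => Finset.sum_nonneg fun x _ =>
    mul_nonneg ((pi_mem_stdSimplex hp).1 x) (ind_nonneg _)) (fun n => ?_)
    (tendsto_lowerTail hp (fun a => Real.log (ρ a)) hc)
  refine Finset.sum_le_sum fun x _ => ?_
  rcases ((pi_mem_stdSimplex hp).1 x).eq_or_lt with h0 | h0
  · simp only at h0
    rw [← h0, zero_mul, zero_mul]
  · refine mul_le_mul_of_nonneg_left (ind_mono fun hx => ?_) h0.le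
    -- A word of positive weight has only letters of positive weight, so the logarithm of the
    -- product splits; words of weight zero do not count.
    have hpos : ∀ i, 0 < ρ (x i) := fun i => hρ _ <| (hp.1 _).lt_of_ne' fun hi =>
      h0.ne' (Finset.prod_eq_zero (Finset.mem_univ i) hi)
    rw [← Real.log_prod (fun i _ => (hpos i).ne')]
    exact (Real.log_le_iff_le_exp (Finset.prod_pos fun i _ => hpos i)).2 hx

/-- The lower-tail statement applied to the inverse ratios. -/
lemma tendsto_upperTail_prod {p : α → ℝ} (hp : p ∈ stdSimplex ℝ α) {ρ : α → ℝ}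
    (hρ : ∀ a, 0 < p a → 0 < ρ a) {c : ℝ} (hc : ∑ a, p a * Real.log (ρ a) < c) :
    Tendsto (fun n : ℕ => ∑ x : Fin n → α,
      (∏ i, p (x i)) * ind (Real.exp (n * c) < ∏ i, ρ (x i))) atTop (𝓝 0) := by
  have hc' : -c < ∑ a, p a * Real.log ((ρ a)⁻¹) := by
    simp only [Real.log_inv, mul_neg, Finset.sum_neg_distrib]
    linarith
  refine squeeze_zero (fun n => Finset.sum_nonneg fun x _ =>
    mul_nonneg ((pi_mem_stdSimplex hp).1 x) (ind_nonneg _)) (fun n => ?_)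
    (tendsto_lowerTail_prod hp (fun a ha => inv_pos.2 (hρ a ha)) hc')
  refine Finset.sum_le_sum fun x _ => mul_le_mul_of_nonneg_left (ind_mono fun hx => ?_)
    ((pi_mem_stdSimplex hp).1 x)
  rw [Finset.prod_inv_distrib, mul_neg, Real.exp_neg]
  exact inv_anti₀ (Real.exp_pos _) hx.le

end Tails

/-! ### Threshold decoding: false alarms and the union bound. -/

section Packing

/-- Markov's inequality. This bounds the chance that an independent codeword passes the threshold
test. The hypothesis is `≤ 1`, not `= 1`, because the ratios used later may vanish through division
by zero. -/
lemma sum_ind_ratio_le {α : Type*} [Fintype α] {p ρ : α → ℝ} (hp : ∀ a, 0 ≤ p a)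
    (hρ : ∀ a, 0 ≤ ρ a) (h : ∑ a, p a * ρ a ≤ 1) {E : ℝ} (hE : 0 < E) :
    ∑ a, p a * ind (E < ρ a) ≤ E⁻¹ := by
  calc ∑ a, p a * ind (E < ρ a) ≤ ∑ a, (p a * ρ a) * E⁻¹ := by
        refine Finset.sum_le_sum fun a _ => ?_
        rw [mul_assoc]
        refine mul_le_mul_of_nonneg_left ?_ (hp a)
        by_cases hx : E < ρ a
        · rw [ind_true hx, ← div_eq_mul_inv, le_div_iff₀ hE]
          linarith
        · rw [ind_false hx]
          exact mul_nonneg (hρ a) (inv_pos.2 hE).le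
    _ ≤ E⁻¹ := by
        rw [← Finset.sum_mul]
        exact mul_le_of_le_one_left (inv_pos.2 hE).le h

lemma sum_pi_ratio_le {ι α : Type*} [Fintype ι] [DecidableEq ι] [Fintype α] {p : α → ℝ}
    {ρ : ι → α → ℝ} (hp : ∀ a, 0 ≤ p a) (hρ : ∀ i a, 0 ≤ ρ i a) (h : ∀ i, ∑ a, p a * ρ i a ≤ 1) :
    ∑ x : ι → α, (∏ i, p (x i)) * ∏ i, ρ i (x i) ≤ 1 := by
  simp_rw [← Finset.prod_mul_distrib]
  rw [sum_pi_prod fun i a => p a * ρ i a]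
  exact Finset.prod_le_one (fun i _ => Finset.sum_nonneg fun a _ => mul_nonneg (hp a) (hρ i a))
    fun i _ => h i

/-- Union bound for a decoder that picks any index passing the test: an error needs the true index
to fail or some other index to pass. -/
lemma ind_epsilon_ne_le {M : Type*} [Fintype M] [DecidableEq M] [Nonempty M] (G : M → Prop) (m : M) :
    ind (Classical.epsilon G ≠ m) ≤ ind (¬ G m) + ∑ m' ∈ Finset.univ.erase m, ind (G m') := by
  have hs : ∀ s : Finset M, 0 ≤ ∑ m' ∈ s, ind (G m') := fun s =>
    Finset.sum_nonneg fun _ _ => ind_nonneg _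
  by_cases hm : G m
  · by_cases he : Classical.epsilon G = m
    · rw [ind_false (not_not.2 he)]
      exact add_nonneg (ind_nonneg _) (hs _)
    · rw [ind_true he]
      have hG : G (Classical.epsilon G) := Classical.epsilon_spec ⟨m, hm⟩
      have := Finset.single_le_sum (f := fun m' => ind (G m')) (fun _ _ => ind_nonneg _)
        (Finset.mem_erase.2 ⟨he, Finset.mem_univ _⟩ :
          Classical.epsilon G ∈ Finset.univ.erase m)
      simp only [ind_true hG] at this
      linarith [ind_nonneg (¬ G m)]
  · rw [ind_true hm]
    linarith [ind_le_one (Classical.epsilon G ≠ m), hs (Finset.univ.erase m)]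

end Packing

/-! ### Sums over words of pairs and over words with a first letter. -/

section Reindex

lemma sum_pi_prod_type {ι α β : Type*} [Fintype ι] [DecidableEq ι] [Fintype α] [Fintype β]
    (f : (ι → α × β) → ℝ) :
    ∑ x : ι → α × β, f x = ∑ a : ι → α, ∑ b : ι → β, f fun i => (a i, b i) := by
  rw [← Fintype.sum_prod_type' (f := fun (a : ι → α) (b : ι → β) => f fun i => (a i, b i))]
  exact Fintype.sum_equiv (Equiv.arrowProdEquivProdArrow ι (fun _ => α) (fun _ => β)) _ _ fun x => rfl

lemma sum_pi_fin_succ {α : Type*} [Fintype α] {n : ℕ} (f : (Fin (n + 1) → α) → ℝ) :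
    ∑ x, f x = ∑ a, ∑ x : Fin n → α, f (Fin.cons a x) := by
  rw [← Fintype.sum_prod_type' (f := fun (a : α) (x : Fin n → α) => f (Fin.cons a x))]
  exact (Fintype.sum_equiv (Fin.consEquiv fun _ => α) _ _ fun x => rfl).symm

end Reindex

/-! ### Real weights of a distribution and entropies as means of logarithms. -/

section PMFWeights

variable {α β : Type*} [Fintype α]

lemma toReal_mem_stdSimplex (p : PMF α) : (fun a => (p a).toReal) ∈ stdSimplex ℝ α := by
  refine ⟨fun a => ENNReal.toReal_nonneg, ?_⟩
  rw [← ENNReal.toReal_sum fun a _ => p.apply_ne_top a, ← tsum_fintype (L := .unconditional _),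
    p.tsum_coe]
  simp

lemma toReal_map_apply (p : PMF α) (A : α → β) (b : β) :
    ((p.map A) b).toReal = ∑ a, (p a).toReal * ind (A a = b) := by
  classical
  rw [PMF.map_apply, tsum_fintype, ENNReal.toReal_sum]
  · refine Finset.sum_congr rfl fun a _ => ?_
    by_cases h : A a = b
    · simp [h, ind]
    · simp [h, ind, Ne.symm h]
  · intro a _
    split_ifs
    · exact p.apply_ne_top a
    · simp

lemma sum_toReal_map [Fintype β] (p : PMF α) (A : α → β) (f : β → ℝ) :
    ∑ b, ((p.map A) b).toReal * f b = ∑ a, (p a).toReal * f (A a) := by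
  classical
  simp_rw [toReal_map_apply, Finset.sum_mul]
  rw [Finset.sum_comm]
  refine Finset.sum_congr rfl fun a _ => ?_
  rw [Finset.sum_eq_single (A a)]
  · simp [ind]
  · intro b _ hb
    simp [ind, Ne.symm hb]
  · simp

lemma toReal_map_pos (p : PMF α) (A : α → β) {a : α} (h : 0 < (p a).toReal) :
    0 < ((p.map A) (A a)).toReal := by
  rw [toReal_map_apply]
  refine Finset.sum_pos' (fun _ _ => mul_nonneg ENNReal.toReal_nonneg (ind_nonneg _))
    ⟨a, Finset.mem_univ _, ?_⟩
  simpa [ind] using h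

lemma entropy_map [Fintype β] (p : PMF α) (A : α → β) :
    entropy (p.map A) = -∑ a, (p a).toReal * Real.log ((p.map A) (A a)).toReal := by
  rw [← sum_toReal_map p A fun b => Real.log ((p.map A) b).toReal, entropy,
    ← Finset.sum_neg_distrib]
  exact Finset.sum_congr rfl fun b _ => by simp [Real.negMulLog]

end PMFWeights

/-! ### Soft covering by a random codebook. -/

section SoftCovering

/-- Cauchy-Schwarz, in the form in which a variance bound controls a mean absolute deviation. -/
lemma average_abs_le_sqrt {α : Type*} [Fintype α] {p : α → ℝ} (hp : p ∈ stdSimplex ℝ α)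
    (f : α → ℝ) : ∑ a, p a * |f a| ≤ Real.sqrt (∑ a, p a * f a ^ 2) := by
  refine Real.le_sqrt_of_sq_le ?_
  have := Finset.sum_sq_le_sum_mul_sum_of_sq_le_mul Finset.univ (r := fun a => p a * |f a|)
    (f := p) (g := fun a => p a * f a ^ 2) (fun a _ => hp.1 a)
    (fun a _ => mul_nonneg (hp.1 a) (sq_nonneg _)) (fun a _ => le_of_eq (by rw [mul_pow, sq_abs]; ring))
  rwa [hp.2, one_mul] at this

variable {S T L : Type*} [Fintype S] [Fintype T] [Fintype L] [DecidableEq L] [Nonempty L]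

/-- Soft covering at a single point: an i.i.d. codebook of size `|L|` reproduces the output
probability `p` of a channel with likelihoods `k`. -/
lemma soft_covering_apply {pT k q : T → ℝ} {p a : ℝ} (hT : pT ∈ stdSimplex ℝ T)
    (hq : q ∈ stdSimplex ℝ T) (hp : 0 ≤ p) (hk : ∀ t, 0 ≤ k t)
    (hkq : ∀ t, pT t * k t = p * q t) (ha : 0 ≤ a) :
    ∑ C : L → T, (∏ l, pT (C l)) * max (p - (Fintype.card L : ℝ)⁻¹ * ∑ l, k (C l)) 0
      ≤ p * ∑ t, q t * ind (a * p < k t) + p * Real.sqrt (a / Fintype.card L) := by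
  set n : ℝ := (Fintype.card L : ℝ) with hn
  have hn0 : 0 < n := by
    rw [hn]; exact_mod_cast Fintype.card_pos
  -- The likelihood is cut off at `a * p`, since without truncation its variance is not controlled.
  -- The removed mass is `p - μ`, which is the first term of the bound.
  set kA : T → ℝ := fun t => k t * ind (k t ≤ a * p) with hkA
  set μ := ∑ t, pT t * kA t with hμ
  have hC := pi_mem_stdSimplex (ι := L) hT
  have hkA_le : ∀ t, kA t ≤ k t := fun t => mul_le_of_le_one_right (hk t) (ind_le_one _)
  have hkA0 : ∀ t, 0 ≤ kA t := fun t => mul_nonneg (hk t) (ind_nonneg _)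
  have hcent : ∑ t, pT t * (kA t - μ) = 0 := by
    simp_rw [mul_sub, Finset.sum_sub_distrib, ← Finset.sum_mul, hT.2]
    simp [μ]
  have hpμ : p - μ = p * ∑ t, q t * ind (a * p < k t) := by
    have h1 : μ = p * ∑ t, q t * ind (k t ≤ a * p) := by
      rw [hμ, Finset.mul_sum]
      refine Finset.sum_congr rfl fun t _ => ?_
      rw [hkA, ← mul_assoc, hkq, mul_assoc]
    have h2 : ∑ t, q t * ind (a * p < k t) + ∑ t, q t * ind (k t ≤ a * p) = 1 := by
      rw [← Finset.sum_add_distrib, ← hq.2]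
      refine Finset.sum_congr rfl fun t _ => ?_
      by_cases h : k t ≤ a * p
      · rw [ind_true h, ind_false (not_lt.2 h)]; ring
      · rw [ind_false h, ind_true (not_le.1 h)]; ring
    rw [h1]
    linear_combination (-p) * h2
  -- Below the cutoff `kA ^ 2 ≤ a * p * k`, and `pT * k = p * q` sums to `p`.
  have hvar : ∑ t, pT t * (kA t - μ) ^ 2 ≤ a * p ^ 2 := by
    calc ∑ t, pT t * (kA t - μ) ^ 2 = ∑ t, pT t * kA t ^ 2 - μ ^ 2 := by
          have : ∀ t, pT t * (kA t - μ) ^ 2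
              = pT t * kA t ^ 2 - 2 * μ * (pT t * kA t) + pT t * μ ^ 2 := fun t => by ring
          simp_rw [this, Finset.sum_add_distrib, Finset.sum_sub_distrib, ← Finset.mul_sum,
            ← Finset.sum_mul, hT.2, ← hμ]
          ring
      _ ≤ ∑ t, pT t * kA t ^ 2 := by nlinarith [sq_nonneg μ]
      _ ≤ ∑ t, (a * p) * (p * q t) := by
          refine Finset.sum_le_sum fun t _ => ?_
          rw [← hkq]
          have : kA t ^ 2 ≤ a * p * k t := by
            by_cases h : k t ≤ a * p
            · simp only [hkA, ind_true h, mul_one]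
              rw [sq]
              exact mul_le_mul_of_nonneg_right h (hk t)
            · simp only [hkA, ind_false h, mul_zero]
              rw [zero_pow two_ne_zero]
              exact mul_nonneg (mul_nonneg ha hp) (hk t)
          nlinarith [mul_le_mul_of_nonneg_left this (hT.1 t)]
      _ = a * p ^ 2 := by
          rw [← Finset.mul_sum, ← Finset.mul_sum, hq.2]
          ring
  have hpt : ∀ C : L → T, max (p - n⁻¹ * ∑ l, k (C l)) 0
      ≤ (p - μ) + |n⁻¹ * ∑ l, (kA (C l) - μ)| := by
    intro C
    have h0 : 0 ≤ p - μ := by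
      rw [hpμ]
      exact mul_nonneg hp (Finset.sum_nonneg fun t _ => mul_nonneg (hq.1 t) (ind_nonneg _))
    refine max_le ?_ (add_nonneg h0 (abs_nonneg _))
    have h1 : n⁻¹ * ∑ l, (kA (C l) - μ) = n⁻¹ * (∑ l, kA (C l)) - μ := by
      rw [Finset.sum_sub_distrib]
      simp only [Finset.sum_const, Finset.card_univ, nsmul_eq_mul]
      rw [← hn]
      field_simp
    have h2 : n⁻¹ * ∑ l, kA (C l) ≤ n⁻¹ * ∑ l, k (C l) :=
      mul_le_mul_of_nonneg_left (Finset.sum_le_sum fun l _ => hkA_le _) (inv_pos.2 hn0).le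
    have h3 := neg_abs_le (n⁻¹ * ∑ l, (kA (C l) - μ))
    linarith
  calc _ ≤ ∑ C : L → T, (∏ l, pT (C l)) * ((p - μ) + |n⁻¹ * ∑ l, (kA (C l) - μ)|) :=
        Finset.sum_le_sum fun C _ => mul_le_mul_of_nonneg_left (hpt C) (hC.1 C)
    _ = (p - μ) + ∑ C : L → T, (∏ l, pT (C l)) * |n⁻¹ * ∑ l, (kA (C l) - μ)| := by
        simp_rw [mul_add, Finset.sum_add_distrib, ← Finset.sum_mul]
        rw [hC.2, one_mul]
    _ ≤ (p - μ) + Real.sqrt (∑ C : L → T, (∏ l, pT (C l)) * (n⁻¹ * ∑ l, (kA (C l) - μ)) ^ 2) := by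
        gcongr
        exact average_abs_le_sqrt hC _
    _ ≤ (p - μ) + Real.sqrt (p ^ 2 * (a / n)) := by
        gcongr
        have := sum_pi_sq (ι := L) hT hcent
        calc _ = n⁻¹ ^ 2 * (n * ∑ t, pT t * (kA t - μ) ^ 2) := by
              rw [hn, ← this, Finset.mul_sum]
              exact Finset.sum_congr rfl fun C _ => by ring
          _ ≤ n⁻¹ ^ 2 * (n * (a * p ^ 2)) := by gcongr
          _ = p ^ 2 * (a / n) := by field_simp
    _ = _ := by
        rw [Real.sqrt_mul (sq_nonneg p), Real.sqrt_sq hp, hpμ]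

/-- The pointwise bound summed over the source. The left side measures how much of `p` is not
covered by the average of the backward likelihoods of the codewords; it is small once the codebook
is much larger than `a` and the ratios `k t s / p s` rarely exceed `a`. -/
lemma soft_covering {p : S → ℝ} {q : S → T → ℝ} {pT : T → ℝ} {k : T → S → ℝ} {a : ℝ}
    (hp : p ∈ stdSimplex ℝ S) (hq : ∀ s, q s ∈ stdSimplex ℝ T) (hT : pT ∈ stdSimplex ℝ T)
    (hk : ∀ t s, 0 ≤ k t s) (hkq : ∀ t s, pT t * k t s = p s * q s t) (ha : 0 ≤ a) :
    ∑ C : L → T, (∏ l, pT (C l)) *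
        ∑ s, max (p s - (Fintype.card L : ℝ)⁻¹ * ∑ l, k (C l) s) 0
      ≤ ∑ s, ∑ t, p s * q s t * ind (a * p s < k t s) + Real.sqrt (a / Fintype.card L) := by
  simp_rw [Finset.mul_sum (s := (Finset.univ : Finset S))]
  rw [Finset.sum_comm]
  calc _ ≤ ∑ s, (p s * ∑ t, q s t * ind (a * p s < k t s)
            + p s * Real.sqrt (a / Fintype.card L)) :=
        Finset.sum_le_sum fun s _ => soft_covering_apply hT (hq s) (hp.1 s) (fun t => hk t s)
          (fun t => hkq t s) ha
    _ = _ := by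
        rw [Finset.sum_add_distrib, ← Finset.sum_mul, hp.2, one_mul]
        simp_rw [Finset.mul_sum, mul_assoc]

end SoftCovering

/-! ### One-shot Wyner-Ziv coding. -/

section OneShot

variable {S S' T R M J : Type*} [Fintype J] [DecidableEq J] [Nonempty J]

/-- Decoder of the binned codebook `C`: within the bin `m` it looks for a codeword whose likelihood
ratio with the side information exceeds `E`. -/
noncomputable def binDecode (ρ : T → S' → ℝ) (E : ℝ) (h : T → S' → R) (C : M × J → T)
    (m : M) (s' : S') : R :=
  h (C (m, Classical.epsilon fun j => E < ρ (C (m, j)) s')) s'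

/-- The index `j` is arbitrary because only the bin is transmitted; which codeword of the bin was
meant exists only in the analysis. If the decoder finds `j`, the cost is that of `j`; otherwise it
is at most `dmax`, and the union bound applies. -/
lemma binDecode_cost_le {ρ : T → S' → ℝ} {E : ℝ} {h : T → S' → R} {δ : R → ℝ} {dmax : ℝ}
    (hd : ∀ r, 0 ≤ δ r) (hd' : ∀ r, δ r ≤ dmax) (C : M × J → T) (m : M) (j : J) (s' : S') :
    δ (binDecode ρ E h C m s') ≤ δ (h (C (m, j)) s') + dmax * (ind (¬ E < ρ (C (m, j)) s')
      + ∑ j' ∈ Finset.univ.erase j, ind (E < ρ (C (m, j')) s')) := by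
  have h0 : 0 ≤ dmax := (hd (h (C (m, j)) s')).trans (hd' _)
  have hle := mul_le_mul_of_nonneg_left
    (ind_epsilon_ne_le (fun j => E < ρ (C (m, j)) s') j) h0
  have : δ (binDecode ρ E h C m s') ≤ δ (h (C (m, j)) s')
      + dmax * ind ((Classical.epsilon fun j => E < ρ (C (m, j)) s') ≠ j) := by
    by_cases he : (Classical.epsilon fun j => E < ρ (C (m, j)) s') = j
    · rw [ind_false (not_not.2 he), binDecode, he]
      linarith
    · rw [ind_true he]
      linarith [hd (h (C (m, j)) s'), hd' (binDecode ρ E h C m s')]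
  refine this.trans ?_
  linarith

/-- One-shot Wyner-Ziv coding with a random binned codebook and the best encoder. -/
theorem wynerZiv_oneShot [Fintype S] [Fintype S'] [Fintype T] [Fintype M] [DecidableEq M]
    [Nonempty M] {p : S → ℝ} {κ : S → S' → ℝ} {q : S → T → ℝ} {pT : T → ℝ}
    {k : T → S → ℝ} {ρ : T → S' → ℝ} {a E dmax : ℝ} {d : S → R → ℝ}
    (hp : p ∈ stdSimplex ℝ S) (hκ : ∀ s s', 0 ≤ κ s s') (hκ' : ∀ s, ∑ s', κ s s' ≤ 1)
    (hq : ∀ s, q s ∈ stdSimplex ℝ T) (hT : pT ∈ stdSimplex ℝ T)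
    (hk : ∀ t s, 0 ≤ k t s) (hkq : ∀ t s, pT t * k t s = p s * q s t) (ha : 0 ≤ a)
    (hρ : ∀ t s', 0 ≤ ρ t s') (hρ' : ∀ s', ∑ t, pT t * ρ t s' ≤ 1) (hE : 0 < E)
    (hd : ∀ s r, 0 ≤ d s r) (hd' : ∀ s r, d s r ≤ dmax) (hdmax : 0 ≤ dmax) (h : T → S' → R) :
    ∃ (enc : S → M) (dec : M → S' → R),
      ∑ s, ∑ s', p s * κ s s' * d s (dec (enc s) s')
        ≤ ∑ s, ∑ s', ∑ t, p s * κ s s' * q s t * d s (h t s')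
          + dmax * (∑ s, ∑ s', ∑ t, p s * κ s s' * q s t * ind (¬ E < ρ t s')
            + ((Fintype.card J : ℝ) - 1) * E⁻¹
            + ∑ s, ∑ t, p s * q s t * ind (a * p s < k t s)
            + Real.sqrt (a / (Fintype.card M * Fintype.card J))) := by
  have hC := pi_mem_stdSimplex (ι := M × J) hT
  set n : ℝ := (Fintype.card (M × J) : ℝ) with hn
  have hn0 : 0 < n := by rw [hn]; exact_mod_cast Fintype.card_pos
  set X : (M × J → T) → S → ℝ := fun C s => n⁻¹ * ∑ l, k (C l) s with hX
  set c : (M × J → T) → S → M → ℝ :=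
    fun C s m => ∑ s', κ s s' * d s (binDecode ρ E h C m s') with hc
  -- For each codebook the encoder takes a bin of least expected cost given the source. Its cost is
  -- then at most that of the bin of every codeword `l`, whatever weights are put on `l`.
  choose enc henc using fun (C : M × J → T) (s : S) => Finite.exists_min (c C s)
  -- single codeword and codeword pair costs
  set F : T → ℝ := fun t => ∑ s, ∑ s', k t s * κ s s' * (d s (h t s') + dmax * ind (¬ E < ρ t s'))
    with hF
  set G : T → T → ℝ := fun t t' => ∑ s, ∑ s', k t s * κ s s' * ind (E < ρ t' s') with hG
  have hksum : ∀ s, ∑ t, pT t * k t s = p s := by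
    intro s
    simp_rw [hkq, ← Finset.mul_sum, (hq s).2, mul_one]
  have hEF : ∑ t, pT t * F t = ∑ s, ∑ s', ∑ t, p s * κ s s' * q s t * d s (h t s')
      + dmax * ∑ s, ∑ s', ∑ t, p s * κ s s' * q s t * ind (¬ E < ρ t s') := by
    simp_rw [hF, Finset.mul_sum, ← Finset.sum_add_distrib]
    rw [Finset.sum_comm]
    refine Finset.sum_congr rfl fun s _ => ?_
    rw [Finset.sum_comm]
    refine Finset.sum_congr rfl fun s' _ => Finset.sum_congr rfl fun t _ => ?_
    linear_combination (κ s s' * (d s (h t s') + dmax * ind (¬ E < ρ t s'))) * hkq t s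
  -- The second codeword is independent of the first, hence of the side information that the first
  -- one induces, so it passes the test with probability at most `E⁻¹`.
  have hEG : ∑ t, ∑ t', pT t * pT t' * G t t' ≤ E⁻¹ := by
    calc ∑ t, ∑ t', pT t * pT t' * G t t'
        = ∑ s, ∑ s', p s * κ s s' * ∑ t', pT t' * ind (E < ρ t' s') := by
          have ht : ∀ t, ∑ t', pT t * pT t' * G t t'
              = ∑ s, ∑ s', pT t * k t s * (κ s s' * ∑ t', pT t' * ind (E < ρ t' s')) := by
            intro t
            simp_rw [hG, Finset.mul_sum]
            rw [Finset.sum_comm]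
            refine Finset.sum_congr rfl fun s _ => ?_
            rw [Finset.sum_comm]
            exact Finset.sum_congr rfl fun s' _ => Finset.sum_congr rfl fun t' _ => by ring
          simp_rw [ht]
          rw [Finset.sum_comm]
          refine Finset.sum_congr rfl fun s _ => ?_
          rw [Finset.sum_comm]
          refine Finset.sum_congr rfl fun s' _ => ?_
          rw [← Finset.sum_mul, hksum, mul_assoc]
      _ ≤ ∑ s, ∑ s', p s * κ s s' * E⁻¹ := by
          refine Finset.sum_le_sum fun s _ => Finset.sum_le_sum fun s' _ =>
            mul_le_mul_of_nonneg_left ?_ (mul_nonneg (hp.1 s) (hκ s s'))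
          exact sum_ind_ratio_le hT.1 (fun t => hρ t s') (hρ' s') hE
      _ = (∑ s, p s * ∑ s', κ s s') * E⁻¹ := by
          simp_rw [Finset.mul_sum, Finset.sum_mul]
      _ ≤ E⁻¹ := mul_le_of_le_one_left (inv_pos.2 hE).le (average_le hp hκ')
  have hccost : ∀ C s (l : M × J), c C s l.1 ≤ ∑ s', κ s s' *
      (d s (h (C l) s') + dmax * (ind (¬ E < ρ (C l) s')
        + ∑ j' ∈ Finset.univ.erase l.2, ind (E < ρ (C (l.1, j')) s'))) := fun C s l =>
    Finset.sum_le_sum fun s' _ => mul_le_mul_of_nonneg_left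
      (binDecode_cost_le (hd s) (hd' s) C l.1 l.2 s') (hκ s s')
  have hkc : ∀ C (l : M × J), ∑ s, k (C l) s * c C s l.1
      ≤ F (C l) + dmax * ∑ j' ∈ Finset.univ.erase l.2, G (C l) (C (l.1, j')) := by
    intro C l
    calc _ ≤ ∑ s, k (C l) s * ∑ s', κ s s' * (d s (h (C l) s') + dmax * (ind (¬ E < ρ (C l) s')
            + ∑ j' ∈ Finset.univ.erase l.2, ind (E < ρ (C (l.1, j')) s'))) :=
          Finset.sum_le_sum fun s _ => mul_le_mul_of_nonneg_left (hccost C s l) (hk _ _)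
      _ = _ := by
          simp_rw [hF, hG, Finset.mul_sum]
          rw [Finset.sum_comm (s := Finset.univ.erase l.2), ← Finset.sum_add_distrib]
          refine Finset.sum_congr rfl fun s _ => ?_
          rw [Finset.sum_comm (s := Finset.univ.erase l.2), ← Finset.sum_add_distrib]
          refine Finset.sum_congr rfl fun s' _ => ?_
          rw [← Finset.mul_sum, ← Finset.mul_sum]
          ring
  have hcmax : ∀ C s m, c C s m ≤ dmax := by
    intro C s m
    calc c C s m ≤ ∑ s', κ s s' * dmax :=
          Finset.sum_le_sum fun s' _ => mul_le_mul_of_nonneg_left (hd' _ _) (hκ _ _)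
      _ = (∑ s', κ s s') * dmax := by rw [Finset.sum_mul]
      _ ≤ dmax := mul_le_of_le_one_left hdmax (hκ' s)
  have hc0 : ∀ C s m, 0 ≤ c C s m := fun C s m =>
    Finset.sum_nonneg fun s' _ => mul_nonneg (hκ _ _) (hd _ _)
  -- Change of measure from `p` to the codebook mixture `X C`. As the costs lie between `0` and
  -- `dmax`, the price is `dmax` times the uncovered mass.
  have htot : ∀ C, ∑ s, p s * c C s (enc C s)
      ≤ n⁻¹ * ∑ l, (F (C l) + dmax * ∑ j' ∈ Finset.univ.erase l.2, G (C l) (C (l.1, j')))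
        + dmax * ∑ s, max (p s - X C s) 0 := by
    intro C
    have h1 : ∀ s, p s * c C s (enc C s)
        ≤ X C s * c C s (enc C s) + dmax * max (p s - X C s) 0 := by
      intro s
      have h2 : p s - X C s ≤ max (p s - X C s) 0 := le_max_left _ _
      have h3 : 0 ≤ max (p s - X C s) 0 := le_max_right _ _
      nlinarith [mul_le_mul_of_nonneg_right h2 (hc0 C s (enc C s)),
        mul_le_mul_of_nonneg_left (hcmax C s (enc C s)) h3]
    calc _ ≤ ∑ s, (X C s * c C s (enc C s) + dmax * max (p s - X C s) 0) :=
          Finset.sum_le_sum fun s _ => h1 s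
      _ = n⁻¹ * ∑ l, ∑ s, k (C l) s * c C s (enc C s) + dmax * ∑ s, max (p s - X C s) 0 := by
          rw [Finset.sum_add_distrib, ← Finset.mul_sum, Finset.sum_comm]
          congr 1
          rw [Finset.mul_sum]
          exact Finset.sum_congr rfl fun s _ => by rw [hX, mul_assoc, Finset.sum_mul]
      _ ≤ _ := by
          gcongr with l
          refine le_trans (Finset.sum_le_sum fun s _ => ?_) (hkc C l)
          exact mul_le_mul_of_nonneg_left (henc C s l.1) (hk _ _)
  have havg : ∑ C : M × J → T, (∏ l, pT (C l)) * ∑ s, p s * c C s (enc C s)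
      ≤ ∑ s, ∑ s', ∑ t, p s * κ s s' * q s t * d s (h t s')
          + dmax * (∑ s, ∑ s', ∑ t, p s * κ s s' * q s t * ind (¬ E < ρ t s')
            + ((Fintype.card J : ℝ) - 1) * E⁻¹
            + ∑ s, ∑ t, p s * q s t * ind (a * p s < k t s)
            + Real.sqrt (a / (Fintype.card M * Fintype.card J))) := by
    have hsoft := soft_covering (L := M × J) hp hq hT hk hkq ha
    have hcard : (Fintype.card M * Fintype.card J : ℝ) = n := by
      rw [hn, Fintype.card_prod]; push_cast; rfl
    rw [← hn] at hsoft
    have hl : ∀ l : M × J, ∑ C : M × J → T, (∏ l, pT (C l)) *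
        (F (C l) + dmax * ∑ j' ∈ Finset.univ.erase l.2, G (C l) (C (l.1, j')))
        ≤ ∑ t, pT t * F t + dmax * (((Fintype.card J : ℝ) - 1) * E⁻¹) := by
      intro l
      simp_rw [mul_add, Finset.sum_add_distrib]
      rw [sum_pi_eval hT l F]
      gcongr
      simp_rw [mul_left_comm _ dmax]
      rw [← Finset.mul_sum]
      gcongr
      simp_rw [Finset.mul_sum]
      rw [Finset.sum_comm]
      calc _ ≤ ∑ j' ∈ Finset.univ.erase l.2, E⁻¹ := by
            refine Finset.sum_le_sum fun j' hj' => ?_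
            -- Only the other `|J| - 1` codewords of the same bin compete, and distinct positions of
            -- the codebook are independent.
            have hne : l ≠ (l.1, j') := fun he => (Finset.ne_of_mem_erase hj') (by rw [he])
            rw [sum_pi_eval_two hT hne G]
            exact hEG
        _ = _ := by
            rw [Finset.sum_const, Finset.card_erase_of_mem (Finset.mem_univ _), nsmul_eq_mul,
              Finset.card_univ, Nat.cast_sub Fintype.card_pos, Nat.cast_one]
    calc _ ≤ ∑ C : M × J → T, (∏ l, pT (C l)) *
          (n⁻¹ * ∑ l, (F (C l) + dmax * ∑ j' ∈ Finset.univ.erase l.2, G (C l) (C (l.1, j')))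
          + dmax * ∑ s, max (p s - X C s) 0) :=
          Finset.sum_le_sum fun C _ => mul_le_mul_of_nonneg_left (htot C) (hC.1 C)
      _ = n⁻¹ * ∑ l, ∑ C : M × J → T, (∏ l, pT (C l)) *
            (F (C l) + dmax * ∑ j' ∈ Finset.univ.erase l.2, G (C l) (C (l.1, j')))
          + dmax * ∑ C : M × J → T, (∏ l, pT (C l)) * ∑ s, max (p s - X C s) 0 := by
          rw [Finset.sum_comm (s := (Finset.univ : Finset (M × J))), Finset.mul_sum,
            Finset.mul_sum, ← Finset.sum_add_distrib]
          refine Finset.sum_congr rfl fun C _ => ?_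
          rw [← Finset.mul_sum]
          ring
      _ ≤ n⁻¹ * ∑ _l : M × J, (∑ t, pT t * F t + dmax * (((Fintype.card J : ℝ) - 1) * E⁻¹))
          + dmax * (∑ s, ∑ t, p s * q s t * ind (a * p s < k t s) + Real.sqrt (a / n)) := by
          gcongr with l
          exact hl l
      _ = _ := by
          rw [Finset.sum_const, Finset.card_univ, nsmul_eq_mul, ← hn, hEF, hcard,
            inv_mul_cancel_left₀ hn0.ne']
          ring
  obtain ⟨C, hCle⟩ := exists_le_of_average_le hC havg
  refine ⟨enc C, binDecode ρ E h C, le_trans (le_of_eq ?_) hCle⟩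
  refine Finset.sum_congr rfl fun s _ => ?_
  rw [hc, Finset.mul_sum]
  exact Finset.sum_congr rfl fun s' _ => by ring

end OneShot

/-! ### Uniform bounds on the block distortion. -/

section BlockCost

variable {S R : Type*}

lemma blockCost_nonneg (d : S → R → ℝ≥0) {n : ℕ} (s : Fin n → S) (x : Fin n → R) :
    0 ≤ (n : ℝ)⁻¹ * ∑ i, (d (s i) (x i) : ℝ) :=
  mul_nonneg (inv_nonneg.2 (Nat.cast_nonneg n))
    (Finset.sum_nonneg fun _ _ => NNReal.coe_nonneg _)

variable [Fintype S] [Fintype R]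

/-- Sum of all the values of a distortion measure, which bounds each of them. -/
noncomputable def totalCost (d : S → R → ℝ≥0) : ℝ := ∑ s, ∑ x, (d s x : ℝ)

lemma totalCost_nonneg (d : S → R → ℝ≥0) : 0 ≤ totalCost d :=
  Finset.sum_nonneg fun _ _ => Finset.sum_nonneg fun _ _ => NNReal.coe_nonneg _

lemma le_totalCost (d : S → R → ℝ≥0) (s : S) (x : R) : (d s x : ℝ) ≤ totalCost d :=
  (Finset.single_le_sum (f := fun x => (d s x : ℝ)) (fun _ _ => NNReal.coe_nonneg _)
      (Finset.mem_univ x)).trans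
    (Finset.single_le_sum (f := fun s => ∑ x, (d s x : ℝ))
      (fun _ _ => Finset.sum_nonneg fun _ _ => NNReal.coe_nonneg _) (Finset.mem_univ s))

lemma blockCost_le (d : S → R → ℝ≥0) {n : ℕ} (s : Fin n → S) (x : Fin n → R) :
    (n : ℝ)⁻¹ * ∑ i, (d (s i) (x i) : ℝ) ≤ totalCost d := by
  rcases Nat.eq_zero_or_pos n with h0 | h0
  · subst h0
    simpa using totalCost_nonneg d
  · rw [inv_mul_le_iff₀ (by exact_mod_cast h0)]
    calc ∑ i, (d (s i) (x i) : ℝ) ≤ ∑ _i : Fin n, totalCost d :=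
          Finset.sum_le_sum fun i _ => le_totalCost d _ _
      _ = n * totalCost d := by simp

end BlockCost

/-! ### Wyner-Ziv coding for blocks. -/

section WynerZiv

variable {S S' T : Type*}

lemma toReal_wzLaw (P : PMF (S × S')) (q : S → PMF T) (ω : S × S' × T) :
    (wzLaw P q ω).toReal = (P (ω.1, ω.2.1)).toReal * (q ω.1 ω.2.2).toReal := by
  classical
  obtain ⟨s, s', t⟩ := ω
  rw [← ENNReal.toReal_mul]
  congr 1
  rw [wzLaw, PMF.bind_apply, tsum_eq_single (s, s')]
  · simp only
    congr 1
    rw [PMF.map_apply, tsum_eq_single t]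
    · simp
    · intro t' ht'
      simp [ht'.symm]
  · rintro ⟨a, b⟩ hab
    rw [PMF.map_apply]
    simp only [mul_eq_zero]
    right
    refine ENNReal.tsum_eq_zero.2 fun t' => if_neg ?_
    simp only [Prod.mk.injEq, not_and]
    intro h1 h2
    exact absurd (by rw [h1, h2]) hab

lemma wzLaw_pos {P : PMF (S × S')} {q : S → PMF T} {ω : S × S' × T}
    (h : 0 < (wzLaw P q ω).toReal) :
    0 < (P (ω.1, ω.2.1)).toReal ∧ 0 < (q ω.1 ω.2.2).toReal := by
  rw [toReal_wzLaw] at h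
  exact ⟨pos_of_mul_pos_left h ENNReal.toReal_nonneg, pos_of_mul_pos_right h ENNReal.toReal_nonneg⟩

variable [Fintype S]

/-- Marginal law of the side information. -/
noncomputable def sideLaw (P : PMF (S × S')) (s' : S') : ℝ := ∑ s, (P (s, s')).toReal

/-- Joint law of the description and the side information. -/
noncomputable def descSideLaw (P : PMF (S × S')) (q : S → PMF T) (t : T) (s' : S') : ℝ :=
  ∑ s, (P (s, s')).toReal * (q s t).toReal

lemma descSideLaw_nonneg (P : PMF (S × S')) (q : S → PMF T) (t : T) (s' : S') :
    0 ≤ descSideLaw P q t s' :=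
  Finset.sum_nonneg fun _ _ => mul_nonneg ENNReal.toReal_nonneg ENNReal.toReal_nonneg

lemma sideLaw_nonneg (P : PMF (S × S')) (s' : S') : 0 ≤ sideLaw P s' :=
  Finset.sum_nonneg fun _ _ => ENNReal.toReal_nonneg

lemma sum_descSideLaw [Fintype T] (P : PMF (S × S')) (q : S → PMF T) (s' : S') :
    ∑ t, descSideLaw P q t s' = sideLaw P s' := by
  unfold descSideLaw
  rw [Finset.sum_comm]
  simp_rw [← Finset.mul_sum, (toReal_mem_stdSimplex (q _)).2, mul_one]
  rfl

variable [Fintype S']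

/-- Marginal law of the source. -/
noncomputable def srcLaw (P : PMF (S × S')) (s : S) : ℝ := ∑ s', (P (s, s')).toReal

/-- Marginal law of the description. -/
noncomputable def descLaw (P : PMF (S × S')) (q : S → PMF T) (t : T) : ℝ :=
  ∑ s, srcLaw P s * (q s t).toReal

lemma srcLaw_mem_stdSimplex (P : PMF (S × S')) : srcLaw P ∈ stdSimplex ℝ S := by
  refine ⟨fun s => Finset.sum_nonneg fun _ _ => ENNReal.toReal_nonneg, ?_⟩
  have := (toReal_mem_stdSimplex P).2
  rwa [Fintype.sum_prod_type] at this

lemma marginals_pos {P : PMF (S × S')} {q : S → PMF T} {ω : S × S' × T}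
    (h : 0 < (wzLaw P q ω).toReal) :
    0 < sideLaw P ω.2.1 ∧ 0 < descLaw P q ω.2.2 ∧ 0 < descSideLaw P q ω.2.2 ω.2.1 := by
  obtain ⟨h1, h2⟩ := wzLaw_pos h
  have h3 : 0 < srcLaw P ω.1 :=
    Finset.sum_pos' (fun _ _ => ENNReal.toReal_nonneg) ⟨_, Finset.mem_univ _, h1⟩
  exact ⟨Finset.sum_pos' (fun _ _ => ENNReal.toReal_nonneg) ⟨_, Finset.mem_univ _, h1⟩,
    Finset.sum_pos' (fun s _ => mul_nonneg ((srcLaw_mem_stdSimplex P).1 s) ENNReal.toReal_nonneg)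
      ⟨_, Finset.mem_univ _, mul_pos h3 h2⟩,
    Finset.sum_pos' (fun s _ => mul_nonneg ENNReal.toReal_nonneg ENNReal.toReal_nonneg)
      ⟨_, Finset.mem_univ _, mul_pos h1 h2⟩⟩

/-- Likelihood ratio of the description and the source. -/
noncomputable def srcRatio (P : PMF (S × S')) (q : S → PMF T) (ω : S × S' × T) : ℝ :=
  (q ω.1 ω.2.2).toReal / descLaw P q ω.2.2

/-- Likelihood ratio of the description and the side information. -/
noncomputable def sideRatio (P : PMF (S × S')) (q : S → PMF T) (t : T) (s' : S') : ℝ :=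
  descSideLaw P q t s' / (descLaw P q t * sideLaw P s')

lemma srcRatio_pos {P : PMF (S × S')} {q : S → PMF T} {ω : S × S' × T}
    (h : 0 < (wzLaw P q ω).toReal) : 0 < srcRatio P q ω :=
  div_pos (wzLaw_pos h).2 (marginals_pos h).2.1

lemma sideRatio_pos {P : PMF (S × S')} {q : S → PMF T} {ω : S × S' × T}
    (h : 0 < (wzLaw P q ω).toReal) : 0 < sideRatio P q ω.2.2 ω.2.1 :=
  div_pos (marginals_pos h).2.2 (mul_pos (marginals_pos h).2.1 (marginals_pos h).1)

variable [Fintype T]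

lemma sum_wzLaw (P : PMF (S × S')) (q : S → PMF T) (f : S × S' × T → ℝ) :
    ∑ ω, (wzLaw P q ω).toReal * f ω
      = ∑ s, ∑ s', ∑ t, (P (s, s')).toReal * (q s t).toReal * f (s, s', t) := by
  simp_rw [Fintype.sum_prod_type, toReal_wzLaw]

lemma descLaw_mem_stdSimplex (P : PMF (S × S')) (q : S → PMF T) :
    descLaw P q ∈ stdSimplex ℝ T := by
  refine ⟨fun t => Finset.sum_nonneg fun s _ =>
    mul_nonneg ((srcLaw_mem_stdSimplex P).1 s) ENNReal.toReal_nonneg, ?_⟩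
  unfold descLaw
  rw [Finset.sum_comm]
  simp_rw [← Finset.mul_sum, (toReal_mem_stdSimplex (q _)).2, mul_one]
  exact (srcLaw_mem_stdSimplex P).2

lemma sideRatio_nonneg (P : PMF (S × S')) (q : S → PMF T) (t : T) (s' : S') :
    0 ≤ sideRatio P q t s' :=
  div_nonneg (descSideLaw_nonneg P q t s')
    (mul_nonneg ((descLaw_mem_stdSimplex P q).1 t) (sideLaw_nonneg P s'))

/-- The ratio is a change of measure from the law of the description to its law given `s'`. The sum
is `0` instead of `1` when `s'` has probability zero. -/
lemma sum_mul_sideRatio_le (P : PMF (S × S')) (q : S → PMF T) (s' : S') :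
    ∑ t, descLaw P q t * sideRatio P q t s' ≤ 1 := by
  calc ∑ t, descLaw P q t * sideRatio P q t s' ≤ ∑ t, descSideLaw P q t s' / sideLaw P s' := by
        refine Finset.sum_le_sum fun t _ => ?_
        rcases ((descLaw_mem_stdSimplex P q).1 t).eq_or_lt with h0 | h0
        · rw [← h0, zero_mul]
          exact div_nonneg (descSideLaw_nonneg P q t s') (sideLaw_nonneg P s')
        · rw [sideRatio, ← mul_div_assoc, mul_div_mul_left _ _ h0.ne']
    _ = sideLaw P s' / sideLaw P s' := by rw [← Finset.sum_div, sum_descSideLaw]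
    _ ≤ 1 := div_self_le_one _

/-- This is `I(S; T | S') = I(S; T) - I(T; S')`, both terms being means of log-likelihood ratios. It
rests on the Markov chain, through the factorization of the joint law as `P(s, s') q(t | s)`. -/
lemma condMutualInfo_wzLaw (P : PMF (S × S')) (q : S → PMF T) :
    condMutualInfo (wzLaw P q) (fun ω => ω.1) (fun ω => ω.2.2) (fun ω => ω.2.1)
      = ∑ ω, (wzLaw P q ω).toReal * Real.log (srcRatio P q ω)
        - ∑ ω, (wzLaw P q ω).toReal * Real.log (sideRatio P q ω.2.2 ω.2.1) := by
  have hAC : ∀ ω : S × S' × T,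
      (((wzLaw P q).map fun ω => (ω.1, ω.2.1)) (ω.1, ω.2.1)).toReal
        = (P (ω.1, ω.2.1)).toReal := by
    intro ω
    have : (wzLaw P q).map (fun ω => (ω.1, ω.2.1)) = P := by
      rw [wzLaw, PMF.map_bind]
      simp only [PMF.map_comp, Function.comp_def, Prod.mk.eta]
      have hc : ∀ s : S × S', (q s.1).map (fun _ => s) = PMF.pure s := fun s =>
        PMF.map_const _ _
      simp only [hc, PMF.bind_pure]
    rw [this]
  have hBC : ∀ ω : S × S' × T,
      (((wzLaw P q).map fun ω => (ω.2.2, ω.2.1)) (ω.2.2, ω.2.1)).toReal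
        = descSideLaw P q ω.2.2 ω.2.1 := by
    intro ω
    rw [toReal_map_apply, sum_wzLaw, descSideLaw]
    refine Finset.sum_congr rfl fun s _ => ?_
    rw [Finset.sum_eq_single ω.2.1, Finset.sum_eq_single ω.2.2]
    · simp [ind]
    · intro t _ ht
      simp [ind, ht]
    · simp
    · intro s' _ hs'
      exact Finset.sum_eq_zero fun t _ => by simp [ind, hs']
    · simp
  have hABC : ∀ ω : S × S' × T,
      (((wzLaw P q).map fun ω => (ω.1, ω.2.2, ω.2.1)) (ω.1, ω.2.2, ω.2.1)).toReal
        = (P (ω.1, ω.2.1)).toReal * (q ω.1 ω.2.2).toReal := by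
    intro ω
    rw [toReal_map_apply, Finset.sum_eq_single ω, toReal_wzLaw]
    · simp [ind]
    · intro ω' _ hω'
      rw [ind_false, mul_zero]
      simp only [Prod.mk.injEq, not_and]
      intro h1 h2 h3
      exact hω' (Prod.ext h1 (Prod.ext h3 h2))
    · simp
  have hC : ∀ ω : S × S' × T,
      (((wzLaw P q).map fun ω => ω.2.1) ω.2.1).toReal = sideLaw P ω.2.1 := by
    intro ω
    rw [toReal_map_apply, sum_wzLaw, sideLaw]
    refine Finset.sum_congr rfl fun s _ => ?_
    rw [Finset.sum_eq_single ω.2.1]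
    · simp [ind, ← Finset.mul_sum, (toReal_mem_stdSimplex (q _)).2]
    · intro s' _ hs'
      simp [ind, hs']
    · simp
  rw [condMutualInfo, entropy_map _ fun ω : S × S' × T => (ω.1, ω.2.1),
    entropy_map _ fun ω : S × S' × T => (ω.2.2, ω.2.1),
    entropy_map _ fun ω : S × S' × T => (ω.1, ω.2.2, ω.2.1),
    entropy_map _ fun ω : S × S' × T => ω.2.1]
  simp_rw [hAC, hBC, hABC, hC]
  rw [← Finset.sum_neg_distrib, ← Finset.sum_neg_distrib, ← Finset.sum_add_distrib,
    ← Finset.sum_neg_distrib, ← Finset.sum_sub_distrib, ← Finset.sum_neg_distrib,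
    ← Finset.sum_sub_distrib, ← Finset.sum_sub_distrib]
  refine Finset.sum_congr rfl fun ω _ => ?_
  rcases (ENNReal.toReal_nonneg (a := wzLaw P q ω)).eq_or_lt with h0 | h0
  · rw [← h0]; ring
  · obtain ⟨h1, h2⟩ := wzLaw_pos h0
    obtain ⟨h3, h4, h5⟩ := marginals_pos h0
    rw [srcRatio, sideRatio, Real.log_div h2.ne' h4.ne', Real.log_div h5.ne' (mul_pos h4 h3).ne',
      Real.log_mul h4.ne' h3.ne', Real.log_mul h1.ne' h2.ne']
    ring

lemma sum_pi_triple {ι : Type*} [Fintype ι] [DecidableEq ι] (f : (ι → S × S' × T) → ℝ) :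
    ∑ ω, f ω = ∑ s : ι → S, ∑ s' : ι → S', ∑ t : ι → T, f fun i => (s i, s' i, t i) := by
  rw [sum_pi_prod_type]
  exact Finset.sum_congr rfl fun s _ => sum_pi_prod_type fun x => f fun i => (s i, x i)

variable {R : Type*} [Fintype R]

/-- Wyner-Ziv coding at any rate above `I(S; T | S')`. -/
theorem wynerZiv (P : PMF (S × S')) (q : S → PMF T) (h : T → S' → R) (d : S → R → ℝ≥0) {r : ℝ}
    (hr : condMutualInfo (wzLaw P q) (fun ω => ω.1) (fun ω => ω.2.2) (fun ω => ω.2.1) < r) :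
    ∃ ε : ℕ → ℝ, Tendsto ε atTop (𝓝 0) ∧ ∀ n M : ℕ, Real.exp (n * r) ≤ M →
      ∃ (enc : (Fin n → S) → Fin M) (dec : Fin M → (Fin n → S') → Fin n → R),
        ∑ s : Fin n → S, ∑ s' : Fin n → S', (∏ i, (P (s i, s' i)).toReal) *
            ((n : ℝ)⁻¹ * ∑ i, (d (s i) (dec (enc s) s' i) : ℝ))
          ≤ ∑ ω, (wzLaw P q ω).toReal * (d ω.1 (h ω.2.2 ω.2.1) : ℝ) + ε n := by
  set w : S × S' × T → ℝ := fun ω => (wzLaw P q ω).toReal with hw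
  have hws : w ∈ stdSimplex ℝ (S × S' × T) := toReal_mem_stdSimplex _
  set I₁ := ∑ ω, w ω * Real.log (srcRatio P q ω) with hI₁
  set I₂ := ∑ ω, w ω * Real.log (sideRatio P q ω.2.2 ω.2.1) with hI₂
  rw [condMutualInfo_wzLaw] at hr
  change I₁ - I₂ < r at hr
  -- The rate gap is divided into four parts: one for each tail threshold, one for the bin size
  -- below `E`, and one for the codebook size above `a`.
  obtain ⟨δ, hδ, hrδ⟩ : ∃ δ : ℝ, 0 < δ ∧ r = I₁ - I₂ + 4 * δ :=
    ⟨(r - (I₁ - I₂)) / 4, by linarith, by ring⟩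
  have hdmax0 := totalCost_nonneg d
  have ht₂ := tendsto_lowerTail_prod hws (ρ := fun ω => sideRatio P q ω.2.2 ω.2.1)
    (fun ω hω => sideRatio_pos hω) (c := I₂ - δ) (by linarith)
  have ht₁ := tendsto_upperTail_prod hws (ρ := srcRatio P q)
    (fun ω hω => srcRatio_pos hω) (c := I₁ + δ) (by linarith)
  have hexp : Tendsto (fun n : ℕ => Real.exp (-(n * δ))) atTop (𝓝 0) :=
    Real.tendsto_exp_neg_atTop_nhds_zero.comp
      (tendsto_natCast_atTop_atTop.atTop_mul_const hδ)
  have hsqrt : Tendsto (fun n : ℕ => Real.sqrt (Real.exp (-(n * δ)))) atTop (𝓝 0) := by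
    simpa [Function.comp_def] using (Real.continuous_sqrt.tendsto 0).comp hexp
  refine ⟨fun n => totalCost d * (∑ x : Fin n → S × S' × T, (∏ i, w (x i)) *
        ind (∏ i, sideRatio P q (x i).2.2 (x i).2.1 ≤ Real.exp (n * (I₂ - δ)))
      + Real.exp (-(n * δ))
      + ∑ x : Fin n → S × S' × T, (∏ i, w (x i)) *
        ind (Real.exp (n * (I₁ + δ)) < ∏ i, srcRatio P q (x i))
      + Real.sqrt (Real.exp (-(n * δ)))), ?_, ?_⟩
  · simpa using (((ht₂.add hexp).add ht₁).add hsqrt).const_mul (totalCost d)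
  intro n M hM
  have hM0 : 0 < M := by
    have := (Real.exp_pos (n * r)).trans_le hM
    exact_mod_cast this
  have : Nonempty (Fin M) := ⟨⟨0, hM0⟩⟩
  -- The bin size is about `exp(n(I₂ - 2δ))`: a factor `exp(-nδ)` below `E = exp(n(I₂ - δ))`, yet
  -- large enough that `M * J` exceeds `a = exp(n(I₁ + δ))` by `exp(nδ)`.
  set J : ℕ := ⌈Real.exp (n * (I₂ - 2 * δ))⌉₊ with hJ
  have hJle : Real.exp (n * (I₂ - 2 * δ)) ≤ J := Nat.le_ceil _
  have hJlt : (J : ℝ) - 1 ≤ Real.exp (n * (I₂ - 2 * δ)) := by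
    linarith [Nat.ceil_lt_add_one (Real.exp_pos (n * (I₂ - 2 * δ))).le]
  have hJ0 : 0 < J := Nat.ceil_pos.2 (Real.exp_pos _)
  have : Nonempty (Fin J) := ⟨⟨0, hJ0⟩⟩
  -- The conditional law of the side information is zero when the source letter has probability
  -- zero, which is why only total mass at most one is required of it.
  set κ : S → S' → ℝ := fun s s' => (P (s, s')).toReal / srcLaw P s with hκ
  have hpκ : ∀ s s', srcLaw P s * κ s s' = (P (s, s')).toReal := by
    intro s s'
    by_cases h0 : srcLaw P s = 0
    · have : (P (s, s')).toReal = 0 :=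
        (Finset.sum_eq_zero_iff_of_nonneg fun _ _ => ENNReal.toReal_nonneg).1 h0 s'
          (Finset.mem_univ _)
      rw [h0, this, zero_mul]
    · exact mul_div_cancel₀ _ h0
  have hκ0 : ∀ s s', 0 ≤ κ s s' := fun s s' =>
    div_nonneg ENNReal.toReal_nonneg ((srcLaw_mem_stdSimplex P).1 s)
  have hκ1 : ∀ s, ∑ s', κ s s' ≤ 1 := fun s => by
    rw [hκ, ← Finset.sum_div]
    exact div_self_le_one _
  -- Bayes: the backward law of the source letter given the description letter.
  set k : T → S → ℝ := fun t s => srcLaw P s * ((q s t).toReal / descLaw P q t) with hk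
  have hk0 : ∀ t s, 0 ≤ k t s := fun t s => mul_nonneg ((srcLaw_mem_stdSimplex P).1 s)
    (div_nonneg ENNReal.toReal_nonneg ((descLaw_mem_stdSimplex P q).1 t))
  have hkq : ∀ t s, descLaw P q t * k t s = srcLaw P s * (q s t).toReal := by
    intro t s
    by_cases h0 : descLaw P q t = 0
    · have : srcLaw P s * (q s t).toReal = 0 :=
        (Finset.sum_eq_zero_iff_of_nonneg fun s _ =>
          mul_nonneg ((srcLaw_mem_stdSimplex P).1 s) ENNReal.toReal_nonneg).1 h0 s
          (Finset.mem_univ _)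
      rw [h0, this, zero_mul]
    · rw [hk]; field_simp
  have hprod : ∀ (s : Fin n → S) (s' : Fin n → S'),
      (∏ i, srcLaw P (s i)) * ∏ i, κ (s i) (s' i) = ∏ i, (P (s i, s' i)).toReal := by
    intro s s'
    rw [← Finset.prod_mul_distrib]
    exact Finset.prod_congr rfl fun i _ => hpκ _ _
  have hprodw : ∀ (s : Fin n → S) (s' : Fin n → S') (t : Fin n → T),
      (∏ i, srcLaw P (s i)) * (∏ i, κ (s i) (s' i)) * (∏ i, (q (s i) (t i)).toReal)
        = ∏ i, w (s i, s' i, t i) := by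
    intro s s' t
    rw [hprod, ← Finset.prod_mul_distrib]
    exact Finset.prod_congr rfl fun i _ => by rw [hw]; simp only [toReal_wzLaw]
  obtain ⟨enc, dec, hed⟩ := wynerZiv_oneShot (M := Fin M) (J := Fin J)
    (S := Fin n → S) (S' := Fin n → S') (T := Fin n → T) (R := Fin n → R)
    (p := fun s => ∏ i, srcLaw P (s i)) (κ := fun s s' => ∏ i, κ (s i) (s' i))
    (q := fun s t => ∏ i, (q (s i) (t i)).toReal) (pT := fun t => ∏ i, descLaw P q (t i))
    (k := fun t s => ∏ i, k (t i) (s i)) (ρ := fun t s' => ∏ i, sideRatio P q (t i) (s' i))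
    (a := Real.exp (n * (I₁ + δ))) (E := Real.exp (n * (I₂ - δ))) (dmax := totalCost d)
    (d := fun s x => (n : ℝ)⁻¹ * ∑ i, (d (s i) (x i) : ℝ))
    (pi_mem_stdSimplex (srcLaw_mem_stdSimplex P))
    (fun s s' => Finset.prod_nonneg fun i _ => hκ0 _ _)
    (fun s => by
      rw [sum_pi_prod fun i a => κ (s i) a]
      exact Finset.prod_le_one (fun i _ => Finset.sum_nonneg fun a _ => hκ0 _ _) fun i _ => hκ1 _)
    (fun s => by
      refine ⟨fun t => Finset.prod_nonneg fun i _ => ENNReal.toReal_nonneg, ?_⟩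
      rw [sum_pi_prod fun i a => (q (s i) a).toReal]
      exact Finset.prod_eq_one fun i _ => (toReal_mem_stdSimplex (q (s i))).2)
    (pi_mem_stdSimplex (descLaw_mem_stdSimplex P q))
    (fun t s => Finset.prod_nonneg fun i _ => hk0 _ _)
    (fun t s => by
      simp only [← Finset.prod_mul_distrib]
      exact Finset.prod_congr rfl fun i _ => hkq _ _)
    (Real.exp_pos _).le
    (fun t s' => Finset.prod_nonneg fun i _ => sideRatio_nonneg P q _ _)
    (fun s' => sum_pi_ratio_le (ρ := fun i t => sideRatio P q t (s' i))
      (descLaw_mem_stdSimplex P q).1 (fun i t => sideRatio_nonneg P q _ _)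
      (fun i => sum_mul_sideRatio_le P q _))
    (Real.exp_pos _)
    (blockCost_nonneg d) (blockCost_le d)
    hdmax0 (fun t s' i => h (t i) (s' i))
  refine ⟨enc, dec, ?_⟩
  simp only [hprodw] at hed
  simp only [hprod] at hed
  refine hed.trans (add_le_add ?_ (mul_le_mul_of_nonneg_left ?_ hdmax0))
  · rw [← sum_pi_triple (fun x : Fin n → S × S' × T => (∏ i, w (x i)) *
      ((n : ℝ)⁻¹ * ∑ i, (d (x i).1 (h (x i).2.2 (x i).2.1) : ℝ)))]
    calc _ = (n : ℝ)⁻¹ * ∑ i : Fin n, ∑ x : Fin n → S × S' × T, (∏ i, w (x i)) *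
            (d (x i).1 (h (x i).2.2 (x i).2.1) : ℝ) := by
          rw [Finset.sum_comm, Finset.mul_sum]
          refine Finset.sum_congr rfl fun x _ => ?_
          rw [← Finset.mul_sum]; ring
      _ = (n : ℝ)⁻¹ * (n * ∑ ω, w ω * (d ω.1 (h ω.2.2 ω.2.1) : ℝ)) := by
          congr 1
          rw [Finset.sum_congr rfl fun i _ => sum_pi_eval hws i
            fun ω => (d ω.1 (h ω.2.2 ω.2.1) : ℝ)]
          simp
      _ ≤ _ := by
          rw [← mul_assoc]
          exact mul_le_of_le_one_left (Finset.sum_nonneg fun ω _ =>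
            mul_nonneg (hws.1 ω) (NNReal.coe_nonneg _)) inv_mul_le_one
  · refine add_le_add (add_le_add (add_le_add ?_ ?_) ?_) ?_
    · rw [sum_pi_triple]
      refine le_of_eq ?_
      simp only [not_lt]
    · rw [Fintype.card_fin]
      calc ((J : ℝ) - 1) * (Real.exp (n * (I₂ - δ)))⁻¹
          ≤ Real.exp (n * (I₂ - 2 * δ)) * (Real.exp (n * (I₂ - δ)))⁻¹ := by gcongr
        _ = Real.exp (-(n * δ)) := by
            rw [← Real.exp_neg, ← Real.exp_add]
            congr 1; ring
    · rw [sum_pi_triple]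
      refine Finset.sum_le_sum fun s _ => ?_
      rw [Finset.sum_comm]
      refine Finset.sum_le_sum fun t _ => ?_
      have hmarg : ∏ i, srcLaw P (s i) = ∑ s' : Fin n → S', ∏ i, (P (s i, s' i)).toReal := by
        rw [sum_pi_prod fun i a => (P (s i, a)).toReal]
        rfl
      -- The event does not involve the side information, which is inserted so that the bound
      -- becomes a tail under the joint law `w`.
      rw [hmarg, Finset.sum_mul, Finset.sum_mul]
      refine Finset.sum_le_sum fun s' _ => ?_
      rw [← hprodw, hprod]
      refine mul_le_mul_of_nonneg_left (ind_mono fun hlt => ?_) (mul_nonneg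
        (Finset.prod_nonneg fun _ _ => ENNReal.toReal_nonneg)
        (Finset.prod_nonneg fun _ _ => ENNReal.toReal_nonneg))
      -- Cancelling the source probability on both sides leaves the threshold event for `srcRatio`.
      rw [← hmarg, hk, Finset.prod_mul_distrib, mul_comm] at hlt
      exact lt_of_mul_lt_mul_left hlt
        (Finset.prod_nonneg fun i _ => (srcLaw_mem_stdSimplex P).1 _)
    · refine Real.sqrt_le_sqrt ?_
      rw [Fintype.card_fin, Fintype.card_fin, div_le_iff₀ (by positivity)]
      calc Real.exp (n * (I₁ + δ)) = Real.exp (-(n * δ)) *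
            (Real.exp (n * r) * Real.exp (n * (I₂ - 2 * δ))) := by
            rw [← Real.exp_add, ← Real.exp_add, hrδ]
            congr 1; ring
        _ ≤ _ := by gcongr

end WynerZiv

/-! ### One-shot channel coding in one direction. -/

section TwoWayOneShot

lemma mul_mem_stdSimplex {α β : Type*} [Fintype α] [Fintype β] {p : α → ℝ} {q : β → ℝ}
    (hp : p ∈ stdSimplex ℝ α) (hq : q ∈ stdSimplex ℝ β) :
    (fun x : α × β => p x.1 * q x.2) ∈ stdSimplex ℝ (α × β) := by
  refine ⟨fun x => mul_nonneg (hp.1 _) (hq.1 _), ?_⟩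
  rw [Fintype.sum_prod_type]
  simp_rw [← Finset.mul_sum, hq.2, mul_one, hp.2]

variable {A A' Y M M' : Type*} [Fintype A] [Fintype A'] [Fintype Y]
  [Fintype M] [DecidableEq M] [Nonempty M] [Fintype M'] [DecidableEq M']

/-- Error probability of threshold decoding, averaged over random codebooks. -/
lemma average_error_le {q : A → ℝ} {q' : A' → ℝ} {Φ ρ : A → A' → Y → ℝ} {E : ℝ}
    (hq : q ∈ stdSimplex ℝ A) (hq' : q' ∈ stdSimplex ℝ A')
    (hΦ : ∀ a a', Φ a a' ∈ stdSimplex ℝ Y)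
    (hρ : ∀ a a' y, 0 ≤ ρ a a' y) (hρ' : ∀ a' y, ∑ a, q a * ρ a a' y ≤ 1) (hE : 0 < E)
    (m : M) (m' : M') :
    ∑ C : M → A, (∏ i, q (C i)) * ∑ C' : M' → A', (∏ i, q' (C' i)) *
        ∑ y, Φ (C m) (C' m') y * ind ((Classical.epsilon fun i => E < ρ (C i) (C' m') y) ≠ m)
      ≤ ∑ a, q a * ∑ a', q' a' * ∑ y, Φ a a' y * ind (¬ E < ρ a a' y)
        + ((Fintype.card M : ℝ) - 1) * E⁻¹ := by
  have hC := pi_mem_stdSimplex (ι := M) hq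
  -- The decoder knows its own message, so the other codebook enters only through the single
  -- codeword at `m'`.
  have hinner : ∀ C : M → A, ∑ C' : M' → A', (∏ i, q' (C' i)) *
        ∑ y, Φ (C m) (C' m') y * ind ((Classical.epsilon fun i => E < ρ (C i) (C' m') y) ≠ m)
      = ∑ a', q' a' * ∑ y, Φ (C m) a' y *
        ind ((Classical.epsilon fun i => E < ρ (C i) a' y) ≠ m) := fun C =>
    sum_pi_eval hq' m' fun a' => ∑ y, Φ (C m) a' y *
        ind ((Classical.epsilon fun i => E < ρ (C i) a' y) ≠ m)
  simp_rw [hinner]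
  set F : A → ℝ := fun a => ∑ a', q' a' * ∑ y, Φ a a' y * ind (¬ E < ρ a a' y) with hF
  set G : A → A → ℝ := fun a b => ∑ a', q' a' * ∑ y, Φ a a' y * ind (E < ρ b a' y) with hG
  have hle : ∀ C : M → A, ∑ a', q' a' * ∑ y, Φ (C m) a' y *
        ind ((Classical.epsilon fun i => E < ρ (C i) a' y) ≠ m)
      ≤ F (C m) + ∑ i ∈ Finset.univ.erase m, G (C m) (C i) := by
    intro C
    have h1 : ∑ i ∈ Finset.univ.erase m, G (C m) (C i) = ∑ a', q' a' * ∑ y, Φ (C m) a' y *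
        ∑ i ∈ Finset.univ.erase m, ind (E < ρ (C i) a' y) := by
      simp_rw [hG, Finset.mul_sum]
      rw [Finset.sum_comm]
      refine Finset.sum_congr rfl fun a' _ => ?_
      rw [Finset.sum_comm]
    rw [h1, hF, ← Finset.sum_add_distrib]
    refine Finset.sum_le_sum fun a' _ => ?_
    rw [← mul_add, ← Finset.sum_add_distrib]
    refine mul_le_mul_of_nonneg_left (Finset.sum_le_sum fun y _ => ?_) (hq'.1 a')
    rw [← mul_add]
    refine mul_le_mul_of_nonneg_left ?_ ((hΦ _ _).1 y)
    exact ind_epsilon_ne_le (fun i => E < ρ (C i) a' y) m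
  have hGle : ∑ a, ∑ b, q a * q b * G a b ≤ E⁻¹ := by
    have h2 : ∀ a, ∑ b, q b * G a b ≤ E⁻¹ := by
      intro a
      calc ∑ b, q b * G a b
          = ∑ a', q' a' * ∑ y, Φ a a' y * ∑ b, q b * ind (E < ρ b a' y) := by
            simp_rw [hG, Finset.mul_sum]
            rw [Finset.sum_comm]
            refine Finset.sum_congr rfl fun a' _ => ?_
            rw [Finset.sum_comm]
            exact Finset.sum_congr rfl fun y _ => Finset.sum_congr rfl fun b _ => by ring
        _ ≤ E⁻¹ := average_le hq' fun a' => average_le (hΦ a a') fun y =>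
            sum_ind_ratio_le hq.1 (fun b => hρ b a' y) (hρ' a' y) hE
    simp_rw [mul_assoc, ← Finset.mul_sum]
    exact average_le hq h2
  calc _ ≤ ∑ C : M → A, (∏ i, q (C i)) *
          (F (C m) + ∑ i ∈ Finset.univ.erase m, G (C m) (C i)) :=
        Finset.sum_le_sum fun C _ => mul_le_mul_of_nonneg_left (hle C) (hC.1 C)
    _ = ∑ a, q a * F a + ∑ i ∈ Finset.univ.erase m, ∑ C : M → A, (∏ i, q (C i)) *
          G (C m) (C i) := by
        simp_rw [mul_add, Finset.sum_add_distrib]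
        rw [sum_pi_eval hq m F, Finset.sum_comm (s := Finset.univ.erase m)]
        simp_rw [Finset.mul_sum]
    _ ≤ ∑ a, q a * F a + ∑ i ∈ Finset.univ.erase m, E⁻¹ := by
        gcongr with i hi
        rw [sum_pi_eval_two hq (Finset.ne_of_mem_erase hi).symm G]
        exact hGle
    _ = _ := by
        rw [Finset.sum_const, Finset.card_erase_of_mem (Finset.mem_univ _), nsmul_eq_mul,
          Finset.card_univ, Nat.cast_sub Fintype.card_pos, Nat.cast_one]

end TwoWayOneShot

/-! ### One-shot coding in both directions at once. -/

section TwoWay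

variable {Γ A₁ A₂ Y₁ Y₂ M₁ M₂ I : Type*} [Fintype Γ] [Fintype A₁] [Fintype A₂] [Fintype Y₁]
  [Fintype Y₂] [Fintype M₁] [DecidableEq M₁] [Nonempty M₁] [Fintype M₂] [DecidableEq M₂]
  [Nonempty M₂] [Fintype I]

/-- One-shot coding for a two-way channel `Φ` with common randomness: there are a value of the
common randomness and two codebooks for which threshold decoding is good on average over an
arbitrary joint law `Q` of the message pair. -/
theorem twoWay_oneShot {r : Γ → ℝ} {q₁ : A₁ → ℝ} {q₂ : A₂ → ℝ}
    {Φ : Γ → A₁ → A₂ → Y₁ → Y₂ → ℝ} {ρ₁ : Γ → A₁ → A₂ → Y₂ → ℝ} {ρ₂ : Γ → A₂ → A₁ → Y₁ → ℝ}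
    {E₁ E₂ : ℝ} (hr : r ∈ stdSimplex ℝ Γ) (hq₁ : q₁ ∈ stdSimplex ℝ A₁)
    (hq₂ : q₂ ∈ stdSimplex ℝ A₂) (hΦ : ∀ c a₁ a₂ y₁ y₂, 0 ≤ Φ c a₁ a₂ y₁ y₂)
    (hΦ' : ∀ c a₁ a₂, ∑ y₁, ∑ y₂, Φ c a₁ a₂ y₁ y₂ = 1)
    (hρ₁ : ∀ c a₁ a₂ y, 0 ≤ ρ₁ c a₁ a₂ y) (hρ₁' : ∀ c a₂ y, ∑ a₁, q₁ a₁ * ρ₁ c a₁ a₂ y ≤ 1)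
    (hρ₂ : ∀ c a₂ a₁ y, 0 ≤ ρ₂ c a₂ a₁ y) (hρ₂' : ∀ c a₁ y, ∑ a₂, q₂ a₂ * ρ₂ c a₂ a₁ y ≤ 1)
    (hE₁ : 0 < E₁) (hE₂ : 0 < E₂) {Q : I → ℝ} (hQ : Q ∈ stdSimplex ℝ I)
    (μ₁ : I → M₁) (μ₂ : I → M₂) :
    ∃ (c : Γ) (C₁ : M₁ → A₁) (C₂ : M₂ → A₂) (dec₁ : M₁ → Y₁ → M₂) (dec₂ : M₂ → Y₂ → M₁),
      ∑ i, Q i * ∑ y₁, ∑ y₂, Φ c (C₁ (μ₁ i)) (C₂ (μ₂ i)) y₁ y₂ *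
          (ind (dec₂ (μ₂ i) y₂ ≠ μ₁ i) + ind (dec₁ (μ₁ i) y₁ ≠ μ₂ i))
        ≤ ∑ c, ∑ a₁, ∑ a₂, ∑ y₁, ∑ y₂, r c * q₁ a₁ * q₂ a₂ * Φ c a₁ a₂ y₁ y₂ *
              ind (¬ E₁ < ρ₁ c a₁ a₂ y₂)
          + ((Fintype.card M₁ : ℝ) - 1) * E₁⁻¹
          + (∑ c, ∑ a₁, ∑ a₂, ∑ y₁, ∑ y₂, r c * q₁ a₁ * q₂ a₂ * Φ c a₁ a₂ y₁ y₂ *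
              ind (¬ E₂ < ρ₂ c a₂ a₁ y₁)
          + ((Fintype.card M₂ : ℝ) - 1) * E₂⁻¹) := by
  set dec₁ : Γ → (M₁ → A₁) → (M₂ → A₂) → M₁ → Y₁ → M₂ := fun c C₁ C₂ m₁ y₁ =>
    Classical.epsilon fun m₂ => E₂ < ρ₂ c (C₂ m₂) (C₁ m₁) y₁ with hdec₁
  set dec₂ : Γ → (M₁ → A₁) → (M₂ → A₂) → M₂ → Y₂ → M₁ := fun c C₁ C₂ m₂ y₂ =>
    Classical.epsilon fun m₁ => E₁ < ρ₁ c (C₁ m₁) (C₂ m₂) y₂ with hdec₂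
  set e₁ : Γ → (M₁ → A₁) → (M₂ → A₂) → M₁ → M₂ → ℝ := fun c C₁ C₂ m₁ m₂ =>
    ∑ y₂, (∑ y₁, Φ c (C₁ m₁) (C₂ m₂) y₁ y₂) * ind (dec₂ c C₁ C₂ m₂ y₂ ≠ m₁) with he₁
  set e₂ : Γ → (M₁ → A₁) → (M₂ → A₂) → M₁ → M₂ → ℝ := fun c C₁ C₂ m₁ m₂ =>
    ∑ y₁, (∑ y₂, Φ c (C₁ m₁) (C₂ m₂) y₁ y₂) * ind (dec₁ c C₁ C₂ m₁ y₁ ≠ m₂) with he₂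
  have hsplit : ∀ c C₁ C₂ m₁ m₂, ∑ y₁, ∑ y₂, Φ c (C₁ m₁) (C₂ m₂) y₁ y₂ *
      (ind (dec₂ c C₁ C₂ m₂ y₂ ≠ m₁) + ind (dec₁ c C₁ C₂ m₁ y₁ ≠ m₂))
      = e₁ c C₁ C₂ m₁ m₂ + e₂ c C₁ C₂ m₁ m₂ := by
    intro c C₁ C₂ m₁ m₂
    simp_rw [he₁, he₂, mul_add, Finset.sum_add_distrib, Finset.sum_mul]
    congr 1
    rw [Finset.sum_comm]
  set W₁ : (M₁ → A₁) → ℝ := fun C => ∏ i, q₁ (C i) with hW₁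
  set W₂ : (M₂ → A₂) → ℝ := fun C => ∏ i, q₂ (C i) with hW₂
  have hcb := mul_mem_stdSimplex hr (mul_mem_stdSimplex (pi_mem_stdSimplex (ι := M₁) hq₁)
    (pi_mem_stdSimplex (ι := M₂) hq₂))
  have hbound₁ : ∀ m₁ m₂, ∑ c, r c * ∑ C₁, W₁ C₁ * ∑ C₂, W₂ C₂ * e₁ c C₁ C₂ m₁ m₂
      ≤ ∑ c, ∑ a₁, ∑ a₂, ∑ y₁, ∑ y₂, r c * q₁ a₁ * q₂ a₂ * Φ c a₁ a₂ y₁ y₂ *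
              ind (¬ E₁ < ρ₁ c a₁ a₂ y₂) + ((Fintype.card M₁ : ℝ) - 1) * E₁⁻¹ := by
    intro m₁ m₂
    calc _ ≤ ∑ c, r c * (∑ a₁, q₁ a₁ * ∑ a₂, q₂ a₂ * ∑ y₂, (∑ y₁, Φ c a₁ a₂ y₁ y₂) *
            ind (¬ E₁ < ρ₁ c a₁ a₂ y₂) + ((Fintype.card M₁ : ℝ) - 1) * E₁⁻¹) :=
          Finset.sum_le_sum fun c _ => mul_le_mul_of_nonneg_left
            (average_error_le (Φ := fun a₁ a₂ y₂ => ∑ y₁, Φ c a₁ a₂ y₁ y₂) hq₁ hq₂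
              (fun a₁ a₂ => ⟨fun y₂ => Finset.sum_nonneg fun y₁ _ => hΦ c a₁ a₂ y₁ y₂, by
                rw [Finset.sum_comm]; exact hΦ' c a₁ a₂⟩)
              (hρ₁ c) (hρ₁' c) hE₁ m₁ m₂) (hr.1 c)
      _ = _ := by
          simp_rw [mul_add, Finset.sum_add_distrib, ← Finset.sum_mul, hr.2, one_mul]
          congr 1
          simp_rw [Finset.mul_sum, Finset.sum_mul, Finset.mul_sum]
          refine Finset.sum_congr rfl fun c _ => Finset.sum_congr rfl fun a₁ _ =>
            Finset.sum_congr rfl fun a₂ _ => ?_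
          rw [Finset.sum_comm]
          exact Finset.sum_congr rfl fun y₁ _ => Finset.sum_congr rfl fun y₂ _ => by ring
  have hbound₂ : ∀ m₁ m₂, ∑ c, r c * ∑ C₁, W₁ C₁ * ∑ C₂, W₂ C₂ * e₂ c C₁ C₂ m₁ m₂
      ≤ ∑ c, ∑ a₁, ∑ a₂, ∑ y₁, ∑ y₂, r c * q₁ a₁ * q₂ a₂ * Φ c a₁ a₂ y₁ y₂ *
              ind (¬ E₂ < ρ₂ c a₂ a₁ y₁) + ((Fintype.card M₂ : ℝ) - 1) * E₂⁻¹ := by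
    intro m₁ m₂
    have hcomm : ∀ c, ∑ C₁, W₁ C₁ * ∑ C₂, W₂ C₂ * e₂ c C₁ C₂ m₁ m₂
        = ∑ C₂, W₂ C₂ * ∑ C₁, W₁ C₁ * e₂ c C₁ C₂ m₁ m₂ := by
      intro c
      simp_rw [Finset.mul_sum]
      rw [Finset.sum_comm]
      exact Finset.sum_congr rfl fun _ _ => Finset.sum_congr rfl fun _ _ => by ring
    simp_rw [hcomm]
    calc _ ≤ ∑ c, r c * (∑ a₂, q₂ a₂ * ∑ a₁, q₁ a₁ * ∑ y₁, (∑ y₂, Φ c a₁ a₂ y₁ y₂) *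
            ind (¬ E₂ < ρ₂ c a₂ a₁ y₁) + ((Fintype.card M₂ : ℝ) - 1) * E₂⁻¹) :=
          Finset.sum_le_sum fun c _ => mul_le_mul_of_nonneg_left
            (average_error_le (Φ := fun a₂ a₁ y₁ => ∑ y₂, Φ c a₁ a₂ y₁ y₂) hq₂ hq₁
              (fun a₂ a₁ => ⟨fun y₁ => Finset.sum_nonneg fun y₂ _ => hΦ c a₁ a₂ y₁ y₂,
                hΦ' c a₁ a₂⟩)
              (hρ₂ c) (hρ₂' c) hE₂ m₂ m₁) (hr.1 c)
      _ = _ := by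
          simp_rw [mul_add, Finset.sum_add_distrib, ← Finset.sum_mul, hr.2, one_mul]
          congr 1
          simp_rw [Finset.mul_sum, Finset.sum_mul, Finset.mul_sum]
          refine Finset.sum_congr rfl fun c _ => ?_
          rw [Finset.sum_comm]
          exact Finset.sum_congr rfl fun a₁ _ => Finset.sum_congr rfl fun a₂ _ =>
            Finset.sum_congr rfl fun y₁ _ => Finset.sum_congr rfl fun y₂ _ => by ring
  have havg : ∑ x : Γ × (M₁ → A₁) × (M₂ → A₂), (r x.1 * (W₁ x.2.1 * W₂ x.2.2)) *
      ∑ i, Q i * (e₁ x.1 x.2.1 x.2.2 (μ₁ i) (μ₂ i) + e₂ x.1 x.2.1 x.2.2 (μ₁ i) (μ₂ i))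
      = ∑ i, Q i * (∑ c, r c * ∑ C₁, W₁ C₁ * ∑ C₂, W₂ C₂ * e₁ c C₁ C₂ (μ₁ i) (μ₂ i)
            + ∑ c, r c * ∑ C₁, W₁ C₁ * ∑ C₂, W₂ C₂ * e₂ c C₁ C₂ (μ₁ i) (μ₂ i)) := by
    simp_rw [Finset.mul_sum (s := (Finset.univ : Finset I))]
    rw [Finset.sum_comm]
    refine Finset.sum_congr rfl fun i _ => ?_
    simp_rw [Fintype.sum_prod_type]
    rw [← Finset.sum_add_distrib, Finset.mul_sum]
    refine Finset.sum_congr rfl fun c _ => ?_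
    rw [← mul_add, ← Finset.sum_add_distrib, Finset.mul_sum, Finset.mul_sum]
    refine Finset.sum_congr rfl fun C₁ _ => ?_
    rw [← mul_add, ← Finset.sum_add_distrib, Finset.mul_sum, Finset.mul_sum, Finset.mul_sum]
    exact Finset.sum_congr rfl fun C₂ _ => by ring
  -- The two error probabilities are averaged as a sum, so a single choice of common randomness and
  -- codebooks serves both terminals. The bounds hold for each message pair, so `Q` needs no product
  -- structure.
  obtain ⟨⟨c, C₁, C₂⟩, hx⟩ := exists_le_of_average_le hcb
    (havg.trans_le (average_le hQ fun i => add_le_add (hbound₁ _ _) (hbound₂ _ _)))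
  refine ⟨c, C₁, C₂, dec₁ c C₁ C₂, dec₂ c C₁ C₂, le_trans (le_of_eq ?_) hx⟩
  simp_rw [hsplit]

end TwoWay

/-! ### Information density and mutual information. -/

section InfoRatio

variable {Ω α β : Type*}

/-- Likelihood ratio (exponential of the information density) of two random variables. -/
noncomputable def infoRatio (p : PMF Ω) (A : Ω → α) (B : Ω → β) (a : α) (b : β) : ℝ :=
  ((p.map fun ω => (A ω, B ω)) (a, b)).toReal / (((p.map A) a).toReal * ((p.map B) b).toReal)

lemma infoRatio_nonneg (p : PMF Ω) (A : Ω → α) (B : Ω → β) (a : α) (b : β) :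
    0 ≤ infoRatio p A B a b :=
  div_nonneg ENNReal.toReal_nonneg (mul_nonneg ENNReal.toReal_nonneg ENNReal.toReal_nonneg)

variable [Fintype Ω]

lemma infoRatio_pos (p : PMF Ω) (A : Ω → α) (B : Ω → β) {ω : Ω} (h : 0 < (p ω).toReal) :
    0 < infoRatio p A B (A ω) (B ω) :=
  div_pos (toReal_map_pos p (fun ω => (A ω, B ω)) h)
    (mul_pos (toReal_map_pos p A h) (toReal_map_pos p B h))

variable [Fintype α]

/-- The weighted ratio is the conditional law of `A` given `B = b`, of mass one or, if `b` has
probability zero, zero. -/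
lemma sum_mul_infoRatio_le (p : PMF Ω) (A : Ω → α) (B : Ω → β) (b : β) :
    ∑ a, ((p.map A) a).toReal * infoRatio p A B a b ≤ 1 := by
  have hmarg : ∑ a, ((p.map fun ω => (A ω, B ω)) (a, b)).toReal = ((p.map B) b).toReal := by
    simp_rw [toReal_map_apply]
    rw [Finset.sum_comm]
    refine Finset.sum_congr rfl fun ω _ => ?_
    rw [← Finset.mul_sum, Finset.sum_eq_single (A ω)]
    · by_cases h : B ω = b
      · rw [ind_true h, ind_true (by rw [h])]
      · rw [ind_false h, ind_false fun h' => h (Prod.ext_iff.1 h').2]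
    · intro a _ ha
      exact ind_false fun h => ha (Prod.ext_iff.1 h).1.symm
    · simp
  calc ∑ a, ((p.map A) a).toReal * infoRatio p A B a b
      ≤ ∑ a, ((p.map fun ω => (A ω, B ω)) (a, b)).toReal / ((p.map B) b).toReal := by
        refine Finset.sum_le_sum fun a _ => ?_
        rcases (ENNReal.toReal_nonneg (a := (p.map A) a)).eq_or_lt with h0 | h0
        · rw [← h0, zero_mul]
          exact div_nonneg ENNReal.toReal_nonneg ENNReal.toReal_nonneg
        · rw [infoRatio, ← mul_div_assoc, mul_div_mul_left _ _ h0.ne']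
    _ ≤ 1 := by
        rw [← Finset.sum_div, hmarg]
        exact div_self_le_one _

lemma mutualInfo_eq_sum_log [Fintype β] (p : PMF Ω) (A : Ω → α) (B : Ω → β) :
    mutualInfo p A B = ∑ ω, (p ω).toReal * Real.log (infoRatio p A B (A ω) (B ω)) := by
  rw [mutualInfo, entropy_map p A, entropy_map p B, entropy_map p fun ω => (A ω, B ω),
    ← Finset.sum_neg_distrib, ← Finset.sum_neg_distrib, ← Finset.sum_add_distrib,
    ← Finset.sum_neg_distrib, ← Finset.sum_sub_distrib]
  refine Finset.sum_congr rfl fun ω _ => ?_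
  rcases (ENNReal.toReal_nonneg (a := p ω)).eq_or_lt with h0 | h0
  · rw [← h0]; ring
  · have h1 := toReal_map_pos p A h0
    have h2 := toReal_map_pos p B h0
    rw [infoRatio, Real.log_div (toReal_map_pos p (fun ω => (A ω, B ω)) h0).ne' (mul_pos h1 h2).ne',
      Real.log_mul h1.ne' h2.ne']
    ring

lemma sum_toReal_bind [Fintype β] (p : PMF α) (f : α → PMF β) (g : β → ℝ) :
    ∑ b, ((p.bind f) b).toReal * g b = ∑ a, (p a).toReal * ∑ b, (f a b).toReal * g b := by
  have h : ∀ b, ((p.bind f) b).toReal = ∑ a, (p a).toReal * (f a b).toReal := by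
    intro b
    rw [PMF.bind_apply, tsum_fintype, ENNReal.toReal_sum fun a _ =>
      ENNReal.mul_ne_top (p.apply_ne_top a) ((f a).apply_ne_top b)]
    simp_rw [ENNReal.toReal_mul]
  simp_rw [h, Finset.sum_mul, Finset.mul_sum]
  rw [Finset.sum_comm]
  simp_rw [mul_assoc]

end InfoRatio

/-! ### Running Han's scheme over consecutive channel uses. -/

section Column

variable {V X Y V' X' Y' : Type*}

/-- What a terminal remembers of a channel use of Han's scheme: its auxiliary letter, its channel
input and its channel output. -/
def nextMemory (γ : V → V → X × Y → X) (o : V × (X × Y)) (v : V) (y : Y) : V × (X × Y) :=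
  (v, (γ v o.1 o.2, y))

/-- Channel inputs of a terminal during `B` consecutive channel uses of Han's scheme, started from
the memory `o`. -/
def columnInput (γ : V → V → X × Y → X) :
    {B : ℕ} → V × (X × Y) → (Fin B → V) → (Fin B → Y) → Fin B → X
  | 0, _, _, _ => Fin.elim0
  | _ + 1, o, v, y => Fin.cons (γ (v 0) o.1 o.2)
      (columnInput γ (nextMemory γ o (v 0) (y 0)) (Fin.tail v) (Fin.tail y))

/-- Causality of the inputs, which makes the scheme implementable by an encoder that has seen only
past outputs. -/
lemma columnInput_congr (γ : V → V → X × Y → X) {B : ℕ} (o : V × (X × Y)) (v : Fin B → V)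
    {y y' : Fin B → Y} {b : Fin B} (h : ∀ i < b, y i = y' i) :
    columnInput γ o v y b = columnInput γ o v y' b := by
  induction B generalizing o with
  | zero => exact b.elim0
  | succ B ih =>
    refine Fin.cases (fun _ => rfl) (fun b h => ?_) b h
    simp only [columnInput, Fin.cons_succ]
    rw [h 0 (Fin.succ_pos b)]
    exact ih _ _ fun i hi => h i.succ (Fin.succ_lt_succ_iff.2 hi)

/-- Product over `B` consecutive channel uses of the ratios `ι` of the previous auxiliary letter of
a terminal and the observations of the other terminal. -/
def columnRatio (ι : V → X' × Y' × V' × (X' × Y') → ℝ) (γ : V' → V' → X' × Y' → X') :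
    {B : ℕ} → V → V' × (X' × Y') → (Fin B → V) → (Fin B → V') → (Fin B → Y') → ℝ
  | 0, _, _, _, _, _ => 1
  | _ + 1, u, o, v, v', y => ι u (γ (v' 0) o.1 o.2, y 0, o) *
      columnRatio ι γ (v 0) (nextMemory γ o (v' 0) (y 0)) (Fin.tail v) (Fin.tail v') (Fin.tail y)

lemma columnRatio_nonneg {ι : V → X' × Y' × V' × (X' × Y') → ℝ} (hι : ∀ u z, 0 ≤ ι u z)
    (γ : V' → V' → X' × Y' → X') {B : ℕ} (u : V) (o : V' × (X' × Y')) (v : Fin B → V)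
    (v' : Fin B → V') (y : Fin B → Y') : 0 ≤ columnRatio ι γ u o v v' y := by
  induction B generalizing u o with
  | zero => exact zero_le_one
  | succ B ih => exact mul_nonneg (hι _ _) (ih _ _ _ _ _)

/-- Each letter of the sender enters only the ratio of the following use, and the observations in
that ratio depend on `v'` and `y` but not on `v`. Summing from the last letter backwards, every
layer contributes at most one by `hι'`. The last letter occurs in no ratio and is summed by `hp'`.
-/
lemma sum_columnRatio_le [Fintype V] {p : V → ℝ} (hp : ∀ v, 0 ≤ p v)
    {ι : V → X' × Y' × V' × (X' × Y') → ℝ} (hι : ∀ u z, 0 ≤ ι u z)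
    (hι' : ∀ z, ∑ u, p u * ι u z ≤ 1) (γ : V' → V' → X' × Y' → X') {B : ℕ}
    (o : V' × (X' × Y')) (v' : Fin B → V') (y : Fin B → Y') (hp' : ∑ v, p v ≤ 1) :
    ∑ u, p u * ∑ v : Fin B → V, (∏ b, p (v b)) * columnRatio ι γ u o v v' y ≤ 1 := by
  induction B generalizing o with
  | zero => simpa [columnRatio] using hp'
  | succ B ih =>
    refine le_trans (Finset.sum_le_sum fun u _ => mul_le_mul_of_nonneg_left ?_ (hp u))
      (hι' (γ (v' 0) o.1 o.2, y 0, o))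
    rw [sum_pi_fin_succ]
    calc _ = ι u (γ (v' 0) o.1 o.2, y 0, o) * ∑ a, p a * ∑ v : Fin B → V, (∏ b, p (v b)) *
            columnRatio ι γ a (nextMemory γ o (v' 0) (y 0)) v (Fin.tail v') (Fin.tail y) := by
          simp_rw [Finset.mul_sum]
          refine Finset.sum_congr rfl fun a _ => Finset.sum_congr rfl fun v _ => ?_
          rw [Fin.prod_univ_succ]
          simp only [columnRatio, Fin.cons_zero, Fin.cons_succ, Fin.tail_cons]
          ring
      _ ≤ _ := mul_le_of_le_one_right (hι _ _) (ih _ _ _)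

end Column

/-! ### The law of a column and stationarity. -/

section ColumnLaw

variable {X₁ X₂ Y₁ Y₂ V₁ V₂ : Type*} {W : X₁ → X₂ → PMF (Y₁ × Y₂)}

/-- Probability of the outputs of `B` consecutive channel uses of Han's scheme. -/
noncomputable def columnProb (W : X₁ → X₂ → PMF (Y₁ × Y₂)) (γ₁ : V₁ → V₁ → X₁ × Y₁ → X₁)
    (γ₂ : V₂ → V₂ → X₂ × Y₂ → X₂) {B : ℕ} (o₁ : V₁ × (X₁ × Y₁)) (o₂ : V₂ × (X₂ × Y₂))
    (v₁ : Fin B → V₁) (v₂ : Fin B → V₂) (y₁ : Fin B → Y₁) (y₂ : Fin B → Y₂) : ℝ :=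
  ∏ b, (W (columnInput γ₁ o₁ v₁ y₁ b) (columnInput γ₂ o₂ v₂ y₂ b) (y₁ b, y₂ b)).toReal

lemma columnProb_nonneg (W : X₁ → X₂ → PMF (Y₁ × Y₂)) (γ₁ : V₁ → V₁ → X₁ × Y₁ → X₁)
    (γ₂ : V₂ → V₂ → X₂ × Y₂ → X₂) {B : ℕ} (o₁ : V₁ × (X₁ × Y₁)) (o₂ : V₂ × (X₂ × Y₂))
    (v₁ : Fin B → V₁) (v₂ : Fin B → V₂) (y₁ : Fin B → Y₁) (y₂ : Fin B → Y₂) :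
    0 ≤ columnProb W γ₁ γ₂ o₁ o₂ v₁ v₂ y₁ y₂ :=
  Finset.prod_nonneg fun _ _ => ENNReal.toReal_nonneg

lemma columnProb_succ (W : X₁ → X₂ → PMF (Y₁ × Y₂)) (γ₁ : V₁ → V₁ → X₁ × Y₁ → X₁)
    (γ₂ : V₂ → V₂ → X₂ × Y₂ → X₂) {B : ℕ} (o₁ : V₁ × (X₁ × Y₁)) (o₂ : V₂ × (X₂ × Y₂))
    (v₁ : Fin (B + 1) → V₁) (v₂ : Fin (B + 1) → V₂) (y₁ : Fin (B + 1) → Y₁)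
    (y₂ : Fin (B + 1) → Y₂) :
    columnProb W γ₁ γ₂ o₁ o₂ v₁ v₂ y₁ y₂
      = (W (γ₁ (v₁ 0) o₁.1 o₁.2) (γ₂ (v₂ 0) o₂.1 o₂.2) (y₁ 0, y₂ 0)).toReal *
        columnProb W γ₁ γ₂ (nextMemory γ₁ o₁ (v₁ 0) (y₁ 0)) (nextMemory γ₂ o₂ (v₂ 0) (y₂ 0))
          (Fin.tail v₁) (Fin.tail v₂) (Fin.tail y₁) (Fin.tail y₂) := by
  rw [columnProb, Fin.prod_univ_succ]
  rfl

lemma sum_columnProb [Fintype Y₁] [Fintype Y₂] (W : X₁ → X₂ → PMF (Y₁ × Y₂))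
    (γ₁ : V₁ → V₁ → X₁ × Y₁ → X₁) (γ₂ : V₂ → V₂ → X₂ × Y₂ → X₂) {B : ℕ} (o₁ : V₁ × (X₁ × Y₁))
    (o₂ : V₂ × (X₂ × Y₂)) (v₁ : Fin B → V₁) (v₂ : Fin B → V₂) :
    ∑ y₁, ∑ y₂, columnProb W γ₁ γ₂ o₁ o₂ v₁ v₂ y₁ y₂ = 1 := by
  induction B generalizing o₁ o₂ with
  | zero => simp [columnProb]
  | succ B ih =>
    rw [sum_pi_fin_succ]
    simp_rw [sum_pi_fin_succ (n := B) (α := Y₂), columnProb_succ, Fin.cons_zero, Fin.tail_cons]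
    rw [← (toReal_mem_stdSimplex (W (γ₁ (v₁ 0) o₁.1 o₁.2) (γ₂ (v₂ 0) o₂.1 o₂.2))).2,
      Fintype.sum_prod_type]
    refine Finset.sum_congr rfl fun a _ => ?_
    rw [Finset.sum_comm]
    refine Finset.sum_congr rfl fun b _ => ?_
    simp_rw [← Finset.mul_sum]
    rw [ih, mul_one]

namespace HanDistribution

/-- Memory of terminal 1 in a past of Han's scheme. -/
def mem₁ (c : HanPast V₁ V₂ X₁ X₂ Y₁ Y₂) : V₁ × (X₁ × Y₁) := (c.1, c.2.2.1)

/-- Memory of terminal 2 in a past of Han's scheme. -/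
def mem₂ (c : HanPast V₁ V₂ X₁ X₂ Y₁ Y₂) : V₂ × (X₂ × Y₂) := (c.2.1, c.2.2.2)

variable (H : HanDistribution W V₁ V₂)

/-- Conditional law of the new auxiliary letters and channel outputs given the past. -/
noncomputable def stepLaw (c : HanPast V₁ V₂ X₁ X₂ Y₁ Y₂) (τ : V₁ × V₂ × Y₁ × Y₂) : ℝ :=
  (H.p₁ τ.1).toReal * (H.p₂ τ.2.1).toReal *
    (W (H.γ₁ τ.1 c.1 c.2.2.1) (H.γ₂ τ.2.1 c.2.1 c.2.2.2) τ.2.2).toReal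

/-- All the variables of one step, as functions of the past and of the new letters and outputs. -/
def outcome (c : HanPast V₁ V₂ X₁ X₂ Y₁ Y₂) (τ : V₁ × V₂ × Y₁ × Y₂) :
    HanSpace V₁ V₂ X₁ X₂ Y₁ Y₂ :=
  ((τ.1, τ.2.1), c, (H.γ₁ τ.1 c.1 c.2.2.1, H.γ₂ τ.2.1 c.2.1 c.2.2.2), τ.2.2)

/-- The past of the next step. -/
def nextPast (c : HanPast V₁ V₂ X₁ X₂ Y₁ Y₂) (τ : V₁ × V₂ × Y₁ × Y₂) :
    HanPast V₁ V₂ X₁ X₂ Y₁ Y₂ :=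
  (τ.1, τ.2.1, (H.γ₁ τ.1 c.1 c.2.2.1, τ.2.2.1), (H.γ₂ τ.2.1 c.2.1 c.2.2.2, τ.2.2.2))

/-- Law of the letters and outputs of `B` consecutive channel uses given the past. -/
noncomputable def columnLaw :
    {B : ℕ} → HanPast V₁ V₂ X₁ X₂ Y₁ Y₂ → (Fin B → V₁ × V₂ × Y₁ × Y₂) → ℝ
  | 0, _, _ => 1
  | _ + 1, c, x => H.stepLaw c (x 0) * columnLaw (H.nextPast c (x 0)) (Fin.tail x)

/-- Product of the ratios `g` along `B` consecutive channel uses. -/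
noncomputable def seqRatio (g : HanPast V₁ V₂ X₁ X₂ Y₁ Y₂ → V₁ × V₂ × Y₁ × Y₂ → ℝ) :
    {B : ℕ} → HanPast V₁ V₂ X₁ X₂ Y₁ Y₂ → (Fin B → V₁ × V₂ × Y₁ × Y₂) → ℝ
  | 0, _, _ => 1
  | _ + 1, c, x => g c (x 0) * seqRatio g (H.nextPast c (x 0)) (Fin.tail x)

lemma stepLaw_nonneg (c : HanPast V₁ V₂ X₁ X₂ Y₁ Y₂) (τ : V₁ × V₂ × Y₁ × Y₂) :
    0 ≤ H.stepLaw c τ :=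
  mul_nonneg (mul_nonneg ENNReal.toReal_nonneg ENNReal.toReal_nonneg) ENNReal.toReal_nonneg

lemma columnLaw_nonneg {B : ℕ} (c : HanPast V₁ V₂ X₁ X₂ Y₁ Y₂)
    (x : Fin B → V₁ × V₂ × Y₁ × Y₂) : 0 ≤ H.columnLaw c x := by
  induction B generalizing c with
  | zero => exact zero_le_one
  | succ B ih => exact mul_nonneg (H.stepLaw_nonneg _ _) (ih _ _)

/-- Links the recursive form, suited to induction and stationarity, with the product form, in which
the auxiliary letters are independent of the past and of each other as random codebooks require. -/
lemma columnLaw_eq {B : ℕ} (c : HanPast V₁ V₂ X₁ X₂ Y₁ Y₂) (x : Fin B → V₁ × V₂ × Y₁ × Y₂) :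
    H.columnLaw c x = (∏ b, (H.p₁ (x b).1).toReal) * (∏ b, (H.p₂ (x b).2.1).toReal) *
      columnProb W H.γ₁ H.γ₂ (mem₁ c) (mem₂ c) (fun b => (x b).1) (fun b => (x b).2.1)
        (fun b => (x b).2.2.1) (fun b => (x b).2.2.2) := by
  induction B generalizing c with
  | zero => simp [columnLaw, columnProb]
  | succ B ih =>
    rw [columnLaw, ih, columnProb_succ, Fin.prod_univ_succ, Fin.prod_univ_succ, stepLaw]
    unfold Fin.tail
    simp only [mem₁, mem₂, nextPast, nextMemory, Prod.mk.eta]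
    ring

lemma columnRatio_eq_seqRatio₁ (ι : V₁ → X₂ × Y₂ × V₂ × (X₂ × Y₂) → ℝ) {B : ℕ}
    (c : HanPast V₁ V₂ X₁ X₂ Y₁ Y₂) (x : Fin B → V₁ × V₂ × Y₁ × Y₂) :
    columnRatio ι H.γ₂ c.1 (mem₂ c) (fun b => (x b).1) (fun b => (x b).2.1)
        (fun b => (x b).2.2.2)
      = H.seqRatio (fun c τ => ι c.1 (H.γ₂ τ.2.1 c.2.1 c.2.2.2, τ.2.2.2, c.2.1, c.2.2.2)) c x := by
  induction B generalizing c with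
  | zero => rfl
  | succ B ih =>
    rw [seqRatio, ← ih]
    rfl

lemma columnRatio_eq_seqRatio₂ (ι : V₂ → X₁ × Y₁ × V₁ × (X₁ × Y₁) → ℝ) {B : ℕ}
    (c : HanPast V₁ V₂ X₁ X₂ Y₁ Y₂) (x : Fin B → V₁ × V₂ × Y₁ × Y₂) :
    columnRatio ι H.γ₁ c.2.1 (mem₁ c) (fun b => (x b).2.1) (fun b => (x b).1)
        (fun b => (x b).2.2.1)
      = H.seqRatio (fun c τ => ι c.2.1 (H.γ₁ τ.1 c.1 c.2.2.1, τ.2.2.1, c.1, c.2.2.1)) c x := by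
  induction B generalizing c with
  | zero => rfl
  | succ B ih =>
    rw [seqRatio, ← ih]
    rfl

lemma map_law_past : H.law.map (fun ω => ω.2.1) = H.past := by
  simp only [law, hanLaw, PMF.map_bind, PMF.map_comp, Function.comp_def]
  have h : ∀ (x₁ : X₁) (x₂ : X₂) (t : HanPast V₁ V₂ X₁ X₂ Y₁ Y₂),
      (W x₁ x₂).map (fun _ => t) = PMF.pure t := fun _ _ t => PMF.map_const _ _
  simp only [h, PMF.bind_pure, PMF.bind_const]

/-- Stationarity identifies the law of the previous letter with that of a fresh one, so the ratios
are normalized with respect to the law used to draw the codebook. -/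
lemma map_past_fst : H.past.map (fun c => c.1) = H.p₁ := by
  conv_lhs => rw [← H.stationary]
  simp only [hanLaw, PMF.map_bind, PMF.map_comp, Function.comp_def]
  have h : ∀ (x₁ : X₁) (x₂ : X₂) (t : V₁), (W x₁ x₂).map (fun _ => t) = PMF.pure t :=
    fun _ _ t => PMF.map_const _ _
  simp only [h, PMF.bind_pure, PMF.bind_const]

lemma map_past_snd : H.past.map (fun c => c.2.1) = H.p₂ := by
  conv_lhs => rw [← H.stationary]
  simp only [hanLaw, PMF.map_bind, PMF.map_comp, Function.comp_def]
  have h : ∀ (x₁ : X₁) (x₂ : X₂) (t : V₂), (W x₁ x₂).map (fun _ => t) = PMF.pure t :=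
    fun _ _ t => PMF.map_const _ _
  simp only [h, PMF.bind_pure, PMF.bind_const]

lemma map_law_fst : H.law.map (fun ω => ω.2.1.1) = H.p₁ := by
  rw [← H.map_past_fst, ← H.map_law_past, PMF.map_comp]
  rfl

lemma map_law_snd : H.law.map (fun ω => ω.2.1.2.1) = H.p₂ := by
  rw [← H.map_past_snd, ← H.map_law_past, PMF.map_comp]
  rfl

variable [Fintype Y₁] [Fintype Y₂] [Fintype V₁] [Fintype V₂]

lemma stepLaw_mem_stdSimplex (c : HanPast V₁ V₂ X₁ X₂ Y₁ Y₂) :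
    H.stepLaw c ∈ stdSimplex ℝ (V₁ × V₂ × Y₁ × Y₂) := by
  refine ⟨H.stepLaw_nonneg c, ?_⟩
  simp_rw [Fintype.sum_prod_type (α₁ := V₁), Fintype.sum_prod_type (α₁ := V₂), stepLaw,
    ← Finset.mul_sum, (toReal_mem_stdSimplex (W _ _)).2, mul_one, ← Finset.mul_sum,
    (toReal_mem_stdSimplex H.p₂).2, mul_one, (toReal_mem_stdSimplex H.p₁).2]

lemma columnLaw_mem_stdSimplex {B : ℕ} (c : HanPast V₁ V₂ X₁ X₂ Y₁ Y₂) :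
    H.columnLaw c ∈ stdSimplex ℝ (Fin B → V₁ × V₂ × Y₁ × Y₂) := by
  refine ⟨H.columnLaw_nonneg c, ?_⟩
  induction B generalizing c with
  | zero => simp [columnLaw]
  | succ B ih =>
    rw [sum_pi_fin_succ]
    simp_rw [columnLaw, Fin.cons_zero, Fin.tail_cons, ← Finset.mul_sum, ih, mul_one]
    exact (H.stepLaw_mem_stdSimplex c).2

variable [Fintype X₁] [Fintype X₂]

lemma sum_law (G : HanSpace V₁ V₂ X₁ X₂ Y₁ Y₂ → ℝ) :
    ∑ ω, (H.law ω).toReal * G ω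
      = ∑ c, (H.past c).toReal * ∑ τ, H.stepLaw c τ * G (H.outcome c τ) := by
  rw [law, hanLaw, sum_toReal_bind]
  simp_rw [sum_toReal_bind, sum_toReal_map, Finset.mul_sum]
  simp_rw [Finset.sum_comm (t := (Finset.univ : Finset (HanPast V₁ V₂ X₁ X₂ Y₁ Y₂)))]
  refine Finset.sum_congr rfl fun c _ => ?_
  rw [Fintype.sum_prod_type]
  refine Finset.sum_congr rfl fun v₁ _ => ?_
  rw [Fintype.sum_prod_type]
  refine Finset.sum_congr rfl fun v₂ _ => Finset.sum_congr rfl fun y _ => ?_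
  simp only [stepLaw, outcome]
  ring

/-- Stationarity in the form needed for induction: one step started from the law `H.past` ends in
that same law. -/
lemma sum_stepLaw_nextPast (F : HanPast V₁ V₂ X₁ X₂ Y₁ Y₂ → ℝ) :
    ∑ c, (H.past c).toReal * ∑ τ, H.stepLaw c τ * F (H.nextPast c τ)
      = ∑ c, (H.past c).toReal * F c := by
  conv_rhs => rw [← H.stationary]
  rw [sum_toReal_map]
  exact (H.sum_law fun ω =>
    F (ω.1.1, ω.1.2, (ω.2.2.1.1, ω.2.2.2.1), (ω.2.2.1.2, ω.2.2.2.2))).symm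

lemma law_outcome_pos {c : HanPast V₁ V₂ X₁ X₂ Y₁ Y₂} {τ : V₁ × V₂ × Y₁ × Y₂}
    (hc : 0 < (H.past c).toReal) (hτ : 0 < H.stepLaw c τ) :
    0 < (H.law (H.outcome c τ)).toReal := by
  have h := H.sum_law fun ω => ind (ω = H.outcome c τ)
  rw [Finset.sum_eq_single (H.outcome c τ), ind_true rfl, mul_one] at h
  · rw [h]
    have h0 : ∀ c', 0 ≤ (H.past c').toReal *
        ∑ τ', H.stepLaw c' τ' * ind (H.outcome c' τ' = H.outcome c τ) := fun c' =>
      mul_nonneg ENNReal.toReal_nonneg (Finset.sum_nonneg fun τ' _ =>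
        mul_nonneg (H.stepLaw_nonneg _ _) (ind_nonneg _))
    refine Finset.sum_pos' (fun c' _ => h0 c') ⟨c, Finset.mem_univ _, mul_pos hc ?_⟩
    refine Finset.sum_pos' (fun τ' _ => mul_nonneg (H.stepLaw_nonneg _ _) (ind_nonneg _))
      ⟨τ, Finset.mem_univ _, ?_⟩
    rwa [ind_true rfl, mul_one]
  · intro ω _ hω
    rw [ind_false hω, mul_zero]
  · simp

lemma past_nextPast_pos {c : HanPast V₁ V₂ X₁ X₂ Y₁ Y₂} {τ : V₁ × V₂ × Y₁ × Y₂}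
    (hc : 0 < (H.past c).toReal) (hτ : 0 < H.stepLaw c τ) :
    0 < (H.past (H.nextPast c τ)).toReal := by
  have h := toReal_map_pos H.law (fun ω : HanSpace V₁ V₂ X₁ X₂ Y₁ Y₂ =>
    (ω.1.1, ω.1.2, (ω.2.2.1.1, ω.2.2.2.1), (ω.2.2.1.2, ω.2.2.2.2))) (H.law_outcome_pos hc hτ)
  have hs := H.stationary
  rw [← law] at hs
  rw [hs] at h
  exact h

section Mean

variable {g : HanPast V₁ V₂ X₁ X₂ Y₁ Y₂ → V₁ × V₂ × Y₁ × Y₂ → ℝ}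

lemma seqRatio_pos (hg : ∀ c τ, 0 < (H.past c).toReal → 0 < H.stepLaw c τ → 0 < g c τ) {B : ℕ}
    {c : HanPast V₁ V₂ X₁ X₂ Y₁ Y₂} {x : Fin B → V₁ × V₂ × Y₁ × Y₂}
    (hc : 0 < (H.past c).toReal) (hx : 0 < H.columnLaw c x) : 0 < H.seqRatio g c x := by
  induction B generalizing c with
  | zero => exact one_pos
  | succ B ih =>
    rw [columnLaw] at hx
    have h1 := pos_of_mul_pos_left hx (H.columnLaw_nonneg _ _)
    have h2 := pos_of_mul_pos_right hx (H.stepLaw_nonneg _ _)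
    exact mul_pos (hg _ _ hc h1) (ih (H.past_nextPast_pos hc h1) h2)

/-- The first factor contributes the one-step mean; after averaging over the first use, the rest
starts again from the stationary law. Positivity along trajectories of positive weight allows the
logarithm to be split, and trajectories of weight zero are treated separately. -/
lemma mean_log_seqRatio (hg : ∀ c τ, 0 < (H.past c).toReal → 0 < H.stepLaw c τ → 0 < g c τ)
    (B : ℕ) :
    ∑ c, (H.past c).toReal * ∑ x : Fin B → V₁ × V₂ × Y₁ × Y₂,
        H.columnLaw c x * Real.log (H.seqRatio g c x)
      = B * ∑ c, (H.past c).toReal * ∑ τ, H.stepLaw c τ * Real.log (g c τ) := by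
  induction B with
  | zero => simp [seqRatio]
  | succ B ih =>
    have hstep : ∀ c, (H.past c).toReal * ∑ x : Fin (B + 1) → V₁ × V₂ × Y₁ × Y₂,
          H.columnLaw c x * Real.log (H.seqRatio g c x)
        = (H.past c).toReal * ∑ τ, H.stepLaw c τ * Real.log (g c τ)
          + (H.past c).toReal * ∑ τ, H.stepLaw c τ * ∑ x : Fin B → V₁ × V₂ × Y₁ × Y₂,
            H.columnLaw (H.nextPast c τ) x * Real.log (H.seqRatio g (H.nextPast c τ) x) := by
      intro c
      rcases (ENNReal.toReal_nonneg (a := H.past c)).eq_or_lt with h0 | h0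
      · rw [← h0]; ring
      rw [← mul_add, ← Finset.sum_add_distrib, sum_pi_fin_succ]
      congr 1
      refine Finset.sum_congr rfl fun τ _ => ?_
      rcases (H.stepLaw_nonneg c τ).eq_or_lt with h1 | h1
      · simp [columnLaw, ← h1]
      have hpt : ∀ x : Fin B → V₁ × V₂ × Y₁ × Y₂,
          H.columnLaw c (Fin.cons τ x : Fin (B + 1) → V₁ × V₂ × Y₁ × Y₂) *
            Real.log (H.seqRatio g c (Fin.cons τ x : Fin (B + 1) → V₁ × V₂ × Y₁ × Y₂))
          = H.stepLaw c τ * (H.columnLaw (H.nextPast c τ) x * Real.log (g c τ)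
            + H.columnLaw (H.nextPast c τ) x * Real.log (H.seqRatio g (H.nextPast c τ) x)) := by
        intro x
        rw [columnLaw, seqRatio, Fin.cons_zero, Fin.tail_cons]
        rcases (H.columnLaw_nonneg (H.nextPast c τ) x).eq_or_lt with h2 | h2
        · rw [← h2]; ring
        · rw [Real.log_mul (hg c τ h0 h1).ne'
            (H.seqRatio_pos hg (H.past_nextPast_pos h0 h1) h2).ne']
          ring
      simp_rw [hpt]
      rw [← Finset.mul_sum, Finset.sum_add_distrib, ← Finset.sum_mul,
        (H.columnLaw_mem_stdSimplex _).2, one_mul, mul_add]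
    simp_rw [hstep]
    rw [Finset.sum_add_distrib, H.sum_stepLaw_nextPast fun c =>
      ∑ x : Fin B → V₁ × V₂ × Y₁ × Y₂, H.columnLaw c x * Real.log (H.seqRatio g c x), ih]
    push_cast
    ring

end Mean

end HanDistribution

end ColumnLaw

/-! ### Decoding metrics and random coding over blocks of columns. -/

namespace HanDistribution

variable {X₁ X₂ Y₁ Y₂ V₁ V₂ : Type*} {W : X₁ → X₂ → PMF (Y₁ × Y₂)}

/-- Likelihood ratio of `Ṽ₁` and the observations of terminal 2. -/
noncomputable def ratio₁ (H : HanDistribution W V₁ V₂) :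
    V₁ → X₂ × Y₂ × V₂ × (X₂ × Y₂) → ℝ :=
  infoRatio H.law (fun ω => ω.2.1.1) (fun ω => (ω.2.2.1.2, ω.2.2.2.2, ω.2.1.2.1, ω.2.1.2.2.2))

/-- Likelihood ratio of `Ṽ₂` and the observations of terminal 1. -/
noncomputable def ratio₂ (H : HanDistribution W V₁ V₂) :
    V₂ → X₁ × Y₁ × V₁ × (X₁ × Y₁) → ℝ :=
  infoRatio H.law (fun ω => ω.2.1.2.1) (fun ω => (ω.2.2.1.1, ω.2.2.2.1, ω.2.1.1, ω.2.1.2.2.1))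

/-- Decoding metric of terminal 2 for a column of `B + 1` channel uses. -/
noncomputable def metric₁ (H : HanDistribution W V₁ V₂) {B : ℕ} (c : HanPast V₁ V₂ X₁ X₂ Y₁ Y₂)
    (v₁ : Fin (B + 1) → V₁) (v₂ : Fin (B + 1) → V₂) (y₂ : Fin (B + 1) → Y₂) : ℝ :=
  columnRatio H.ratio₁ H.γ₂ (v₁ 0) (nextMemory H.γ₂ (mem₂ c) (v₂ 0) (y₂ 0)) (Fin.tail v₁)
    (Fin.tail v₂) (Fin.tail y₂)

/-- Decoding metric of terminal 1 for a column of `B + 1` channel uses. -/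
noncomputable def metric₂ (H : HanDistribution W V₁ V₂) {B : ℕ} (c : HanPast V₁ V₂ X₁ X₂ Y₁ Y₂)
    (v₂ : Fin (B + 1) → V₂) (v₁ : Fin (B + 1) → V₁) (y₁ : Fin (B + 1) → Y₁) : ℝ :=
  columnRatio H.ratio₂ H.γ₁ (v₂ 0) (nextMemory H.γ₁ (mem₁ c) (v₁ 0) (y₁ 0)) (Fin.tail v₂)
    (Fin.tail v₁) (Fin.tail y₁)

lemma metric₁_nonneg (H : HanDistribution W V₁ V₂) {B : ℕ} (c : HanPast V₁ V₂ X₁ X₂ Y₁ Y₂)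
    (v₁ : Fin (B + 1) → V₁) (v₂ : Fin (B + 1) → V₂) (y₂ : Fin (B + 1) → Y₂) :
    0 ≤ H.metric₁ c v₁ v₂ y₂ :=
  columnRatio_nonneg (fun _ _ => infoRatio_nonneg _ _ _ _ _) _ _ _ _ _ _

lemma metric₂_nonneg (H : HanDistribution W V₁ V₂) {B : ℕ} (c : HanPast V₁ V₂ X₁ X₂ Y₁ Y₂)
    (v₂ : Fin (B + 1) → V₂) (v₁ : Fin (B + 1) → V₁) (y₁ : Fin (B + 1) → Y₁) :
    0 ≤ H.metric₂ c v₂ v₁ y₁ :=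
  columnRatio_nonneg (fun _ _ => infoRatio_nonneg _ _ _ _ _) _ _ _ _ _ _

/-- Letters of a column: initial past, auxiliary letters and channel outputs. -/
abbrev Column (V₁ V₂ X₁ X₂ Y₁ Y₂ : Type*) (B : ℕ) : Type _ :=
  HanPast V₁ V₂ X₁ X₂ Y₁ Y₂ × (Fin B → V₁) × (Fin B → V₂) × (Fin B → Y₁) × (Fin B → Y₂)

/-- Law of a column whose initial past follows the stationary law. -/
noncomputable def columnWeight (H : HanDistribution W V₁ V₂) {B : ℕ}
    (z : Column V₁ V₂ X₁ X₂ Y₁ Y₂ B) : ℝ :=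
  (H.past z.1).toReal * (∏ b, (H.p₁ (z.2.1 b)).toReal) * (∏ b, (H.p₂ (z.2.2.1 b)).toReal) *
    columnProb W H.γ₁ H.γ₂ (mem₁ z.1) (mem₂ z.1) z.2.1 z.2.2.1 z.2.2.2.1 z.2.2.2.2

lemma columnWeight_nonneg (H : HanDistribution W V₁ V₂) {B : ℕ}
    (z : Column V₁ V₂ X₁ X₂ Y₁ Y₂ B) : 0 ≤ H.columnWeight z :=
  mul_nonneg (mul_nonneg (mul_nonneg ENNReal.toReal_nonneg
    (Finset.prod_nonneg fun _ _ => ENNReal.toReal_nonneg))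
    (Finset.prod_nonneg fun _ _ => ENNReal.toReal_nonneg)) (columnProb_nonneg _ _ _ _ _ _ _ _ _)

lemma columnWeight_pos (H : HanDistribution W V₁ V₂) {B : ℕ}
    {z : Column V₁ V₂ X₁ X₂ Y₁ Y₂ B} (h : 0 < H.columnWeight z) :
    0 < (H.past z.1).toReal ∧
      0 < H.columnLaw z.1 fun b => (z.2.1 b, z.2.2.1 b, z.2.2.2.1 b, z.2.2.2.2 b) := by
  have he : H.columnWeight z = (H.past z.1).toReal *
      H.columnLaw z.1 fun b => (z.2.1 b, z.2.2.1 b, z.2.2.2.1 b, z.2.2.2.2 b) := by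
    rw [columnLaw_eq, columnWeight]
    ring
  rw [he] at h
  exact ⟨pos_of_mul_pos_left h (H.columnLaw_nonneg _ _),
    pos_of_mul_pos_right h ENNReal.toReal_nonneg⟩

lemma prod_columnWeight (H : HanDistribution W V₁ V₂) {n B : ℕ}
    (c : Fin n → HanPast V₁ V₂ X₁ X₂ Y₁ Y₂)
    (v₁ : Fin n → Fin B → V₁) (v₂ : Fin n → Fin B → V₂) (y₁ : Fin n → Fin B → Y₁) (y₂ : Fin n → Fin B → Y₂) :
    ∏ j, H.columnWeight (c j, v₁ j, v₂ j, y₁ j, y₂ j)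
      = (∏ j, (H.past (c j)).toReal) * (∏ j, ∏ b, (H.p₁ (v₁ j b)).toReal) *
        (∏ j, ∏ b, (H.p₂ (v₂ j b)).toReal) *
        ∏ j, columnProb W H.γ₁ H.γ₂ (mem₁ (c j)) (mem₂ (c j)) (v₁ j) (v₂ j) (y₁ j) (y₂ j) := by
  simp only [columnWeight, Finset.prod_mul_distrib]

lemma sum_prod_columnProb [Fintype Y₁] [Fintype Y₂] (W : X₁ → X₂ → PMF (Y₁ × Y₂))
    (γ₁ : V₁ → V₁ → X₁ × Y₁ → X₁) (γ₂ : V₂ → V₂ → X₂ × Y₂ → X₂) {n B : ℕ}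
    (c : Fin n → HanPast V₁ V₂ X₁ X₂ Y₁ Y₂)
    (v₁ : Fin n → Fin B → V₁) (v₂ : Fin n → Fin B → V₂) :
    ∑ y₁ : Fin n → Fin B → Y₁, ∑ y₂ : Fin n → Fin B → Y₂,
      ∏ j, columnProb W γ₁ γ₂ (mem₁ (c j)) (mem₂ (c j)) (v₁ j) (v₂ j) (y₁ j) (y₂ j) = 1 := by
  rw [← sum_pi_prod_type fun y : Fin n → (Fin B → Y₁) × (Fin B → Y₂) =>
      ∏ j, columnProb W γ₁ γ₂ (mem₁ (c j)) (mem₂ (c j)) (v₁ j) (v₂ j) (y j).1 (y j).2,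
    sum_pi_prod fun j (y : (Fin B → Y₁) × (Fin B → Y₂)) =>
      columnProb W γ₁ γ₂ (mem₁ (c j)) (mem₂ (c j)) (v₁ j) (v₂ j) y.1 y.2]
  refine Finset.prod_eq_one fun j _ => ?_
  rw [Fintype.sum_prod_type]
  exact sum_columnProb _ _ _ _ _ _ _

variable [Fintype X₁] [Fintype X₂] [Fintype Y₁] [Fintype Y₂] [Fintype V₁] [Fintype V₂]

lemma sum_columnWeight (H : HanDistribution W V₁ V₂) {B : ℕ}
    (f : Column V₁ V₂ X₁ X₂ Y₁ Y₂ B → ℝ) :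
    ∑ z, H.columnWeight z * f z
      = ∑ c, (H.past c).toReal * ∑ x : Fin B → V₁ × V₂ × Y₁ × Y₂, H.columnLaw c x *
        f (c, fun b => (x b).1, fun b => (x b).2.1, fun b => (x b).2.2.1,
          fun b => (x b).2.2.2) := by
  rw [Fintype.sum_prod_type]
  refine Finset.sum_congr rfl fun c _ => ?_
  rw [sum_pi_prod_type, Fintype.sum_prod_type, Finset.mul_sum]
  refine Finset.sum_congr rfl fun v₁ _ => ?_
  rw [sum_pi_prod_type fun x : Fin B → V₂ × Y₁ × Y₂ => _, Fintype.sum_prod_type, Finset.mul_sum]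
  refine Finset.sum_congr rfl fun v₂ _ => ?_
  rw [sum_pi_prod_type fun x : Fin B → Y₁ × Y₂ => _, Fintype.sum_prod_type, Finset.mul_sum]
  refine Finset.sum_congr rfl fun y₁ _ => ?_
  rw [Finset.mul_sum]
  refine Finset.sum_congr rfl fun y₂ _ => ?_
  rw [columnLaw_eq]
  simp only [columnWeight]
  ring

lemma columnWeight_mem_stdSimplex (H : HanDistribution W V₁ V₂) (B : ℕ) :
    (H.columnWeight : Column V₁ V₂ X₁ X₂ Y₁ Y₂ B → ℝ) ∈ stdSimplex ℝ _ := by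
  refine ⟨H.columnWeight_nonneg, ?_⟩
  have h := H.sum_columnWeight (B := B) fun _ => 1
  simp_rw [mul_one, (H.columnLaw_mem_stdSimplex _).2, mul_one] at h
  rw [h]
  exact (toReal_mem_stdSimplex H.past).2

section SeqRatio

variable (H : HanDistribution W V₁ V₂)
  {g : HanPast V₁ V₂ X₁ X₂ Y₁ Y₂ → V₁ × V₂ × Y₁ × Y₂ → ℝ}

lemma seqRatio_nextPast_pos
    (hg : ∀ c τ, 0 < (H.past c).toReal → 0 < H.stepLaw c τ → 0 < g c τ) {B : ℕ}
    {c : HanPast V₁ V₂ X₁ X₂ Y₁ Y₂} {x : Fin (B + 1) → V₁ × V₂ × Y₁ × Y₂}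
    (hc : 0 < (H.past c).toReal) (hx : 0 < H.columnLaw c x) :
    0 < H.seqRatio g (H.nextPast c (x 0)) (Fin.tail x) := by
  rw [columnLaw] at hx
  have h1 := pos_of_mul_pos_left hx (H.columnLaw_nonneg _ _)
  exact H.seqRatio_pos hg (H.past_nextPast_pos hc h1)
    (pos_of_mul_pos_right hx (H.stepLaw_nonneg _ _))

/-- The first use of a column only creates a genuine previous letter, so `B + 1` uses give `B`
ratios; stationarity removes the dependence on that first use. -/
lemma mean_log_seqRatio_nextPast
    (hg : ∀ c τ, 0 < (H.past c).toReal → 0 < H.stepLaw c τ → 0 < g c τ) (B : ℕ) :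
    ∑ c, (H.past c).toReal * ∑ x : Fin (B + 1) → V₁ × V₂ × Y₁ × Y₂, H.columnLaw c x *
        Real.log (H.seqRatio g (H.nextPast c (x 0)) (Fin.tail x))
      = B * ∑ c, (H.past c).toReal * ∑ τ, H.stepLaw c τ * Real.log (g c τ) := by
  rw [← H.mean_log_seqRatio hg B, ← H.sum_stepLaw_nextPast fun c =>
    ∑ x : Fin B → V₁ × V₂ × Y₁ × Y₂, H.columnLaw c x * Real.log (H.seqRatio g c x)]
  refine Finset.sum_congr rfl fun c _ => ?_
  rw [sum_pi_fin_succ]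
  congr 1
  refine Finset.sum_congr rfl fun τ _ => ?_
  rw [Finset.mul_sum]
  refine Finset.sum_congr rfl fun x _ => ?_
  rw [columnLaw, Fin.cons_zero, Fin.tail_cons, mul_assoc]

end SeqRatio

variable (H : HanDistribution W V₁ V₂)

lemma metric₁_pos {B : ℕ} {z : Column V₁ V₂ X₁ X₂ Y₁ Y₂ (B + 1)} (h : 0 < H.columnWeight z) :
    0 < H.metric₁ z.1 z.2.1 z.2.2.1 z.2.2.2.2 := by
  obtain ⟨hc, hx⟩ := H.columnWeight_pos h
  have hp := H.seqRatio_nextPast_pos (fun c τ hc hτ => infoRatio_pos H.law (fun ω => ω.2.1.1)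
    (fun ω => (ω.2.2.1.2, ω.2.2.2.2, ω.2.1.2.1, ω.2.1.2.2.2)) (H.law_outcome_pos hc hτ)) hc hx
  refine hp.trans_eq ?_
  exact (H.columnRatio_eq_seqRatio₁ H.ratio₁ _ _).symm

lemma metric₂_pos {B : ℕ} {z : Column V₁ V₂ X₁ X₂ Y₁ Y₂ (B + 1)} (h : 0 < H.columnWeight z) :
    0 < H.metric₂ z.1 z.2.2.1 z.2.1 z.2.2.2.1 := by
  obtain ⟨hc, hx⟩ := H.columnWeight_pos h
  have hp := H.seqRatio_nextPast_pos (fun c τ hc hτ => infoRatio_pos H.law (fun ω => ω.2.1.2.1)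
    (fun ω => (ω.2.2.1.1, ω.2.2.2.1, ω.2.1.1, ω.2.1.2.2.1)) (H.law_outcome_pos hc hτ)) hc hx
  refine hp.trans_eq ?_
  exact (H.columnRatio_eq_seqRatio₂ H.ratio₂ _ _).symm

lemma mean_log_metric₁ (B : ℕ) :
    ∑ z : Column V₁ V₂ X₁ X₂ Y₁ Y₂ (B + 1), H.columnWeight z *
      Real.log (H.metric₁ z.1 z.2.1 z.2.2.1 z.2.2.2.2) = B * H.info₁ := by
  rw [sum_columnWeight, info₁, mutualInfo_eq_sum_log, sum_law]
  refine Eq.trans ?_ (H.mean_log_seqRatio_nextPast (fun c τ hc hτ => infoRatio_pos H.law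
    (fun ω => ω.2.1.1) (fun ω => (ω.2.2.1.2, ω.2.2.2.2, ω.2.1.2.1, ω.2.1.2.2.2))
    (H.law_outcome_pos hc hτ)) B)
  refine Finset.sum_congr rfl fun c _ => ?_
  congr 1
  refine Finset.sum_congr rfl fun x _ => ?_
  congr 2
  exact H.columnRatio_eq_seqRatio₁ H.ratio₁ (H.nextPast c (x 0)) (Fin.tail x)

lemma mean_log_metric₂ (B : ℕ) :
    ∑ z : Column V₁ V₂ X₁ X₂ Y₁ Y₂ (B + 1), H.columnWeight z *
      Real.log (H.metric₂ z.1 z.2.2.1 z.2.1 z.2.2.2.1) = B * H.info₂ := by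
  rw [sum_columnWeight, info₂, mutualInfo_eq_sum_log, sum_law]
  refine Eq.trans ?_ (H.mean_log_seqRatio_nextPast (fun c τ hc hτ => infoRatio_pos H.law
    (fun ω => ω.2.1.2.1) (fun ω => (ω.2.2.1.1, ω.2.2.2.1, ω.2.1.1, ω.2.1.2.2.1))
    (H.law_outcome_pos hc hτ)) B)
  refine Finset.sum_congr rfl fun c _ => ?_
  congr 1
  refine Finset.sum_congr rfl fun x _ => ?_
  congr 2
  exact H.columnRatio_eq_seqRatio₂ H.ratio₂ (H.nextPast c (x 0)) (Fin.tail x)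

lemma sum_mul_metric₁_le {B : ℕ} (c : HanPast V₁ V₂ X₁ X₂ Y₁ Y₂) (v₂ : Fin (B + 1) → V₂)
    (y₂ : Fin (B + 1) → Y₂) :
    ∑ v₁ : Fin (B + 1) → V₁, (∏ b, (H.p₁ (v₁ b)).toReal) * H.metric₁ c v₁ v₂ y₂ ≤ 1 := by
  rw [sum_pi_fin_succ]
  refine le_trans (le_of_eq ?_) (sum_columnRatio_le (p := fun v => (H.p₁ v).toReal)
    (fun _ => ENNReal.toReal_nonneg) (ι := H.ratio₁) (fun _ _ => infoRatio_nonneg _ _ _ _ _)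
    (fun z => ?_) H.γ₂ (nextMemory H.γ₂ (mem₂ c) (v₂ 0) (y₂ 0)) (Fin.tail v₂) (Fin.tail y₂)
    (toReal_mem_stdSimplex H.p₁).2.le)
  · refine Finset.sum_congr rfl fun a _ => ?_
    rw [Finset.mul_sum]
    refine Finset.sum_congr rfl fun v _ => ?_
    rw [Fin.prod_univ_succ, metric₁]
    simp only [Fin.cons_zero, Fin.cons_succ, Fin.tail_cons, mul_assoc]
  · have h := sum_mul_infoRatio_le H.law (fun ω => ω.2.1.1)
      (fun ω => (ω.2.2.1.2, ω.2.2.2.2, ω.2.1.2.1, ω.2.1.2.2.2)) z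
    rwa [H.map_law_fst] at h

lemma sum_mul_metric₂_le {B : ℕ} (c : HanPast V₁ V₂ X₁ X₂ Y₁ Y₂) (v₁ : Fin (B + 1) → V₁)
    (y₁ : Fin (B + 1) → Y₁) :
    ∑ v₂ : Fin (B + 1) → V₂, (∏ b, (H.p₂ (v₂ b)).toReal) * H.metric₂ c v₂ v₁ y₁ ≤ 1 := by
  rw [sum_pi_fin_succ]
  refine le_trans (le_of_eq ?_) (sum_columnRatio_le (p := fun v => (H.p₂ v).toReal)
    (fun _ => ENNReal.toReal_nonneg) (ι := H.ratio₂) (fun _ _ => infoRatio_nonneg _ _ _ _ _)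
    (fun z => ?_) H.γ₁ (nextMemory H.γ₁ (mem₁ c) (v₁ 0) (y₁ 0)) (Fin.tail v₁) (Fin.tail y₁)
    (toReal_mem_stdSimplex H.p₂).2.le)
  · refine Finset.sum_congr rfl fun a _ => ?_
    rw [Finset.mul_sum]
    refine Finset.sum_congr rfl fun v _ => ?_
    rw [Fin.prod_univ_succ, metric₂]
    simp only [Fin.cons_zero, Fin.cons_succ, Fin.tail_cons, mul_assoc]
  · have h := sum_mul_infoRatio_le H.law (fun ω => ω.2.1.2.1)
      (fun ω => (ω.2.2.1.1, ω.2.2.2.1, ω.2.1.1, ω.2.1.2.2.1)) z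
    rwa [H.map_law_snd] at h

/-- Sums over blocks of columns. -/
lemma sum_pi_column {n B : ℕ} (f : (Fin n → Column V₁ V₂ X₁ X₂ Y₁ Y₂ B) → ℝ) :
    ∑ z, f z = ∑ c : Fin n → HanPast V₁ V₂ X₁ X₂ Y₁ Y₂, ∑ v₁ : Fin n → Fin B → V₁,
      ∑ v₂ : Fin n → Fin B → V₂, ∑ y₁ : Fin n → Fin B → Y₁, ∑ y₂ : Fin n → Fin B → Y₂,
        f fun i => (c i, v₁ i, v₂ i, y₁ i, y₂ i) := by
  rw [sum_pi_prod_type]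
  refine Finset.sum_congr rfl fun c _ => ?_
  rw [sum_pi_prod_type fun x => f fun i => (c i, x i)]
  refine Finset.sum_congr rfl fun v₁ _ => ?_
  rw [sum_pi_prod_type fun x => f fun i => (c i, v₁ i, x i)]
  refine Finset.sum_congr rfl fun v₂ _ => ?_
  rw [sum_pi_prod_type fun x => f fun i => (c i, v₁ i, v₂ i, x i)]

/-- Random coding bound for a block of `n` columns of `B + 1` channel uses. -/
theorem exists_block_code (n B : ℕ) {M₁ M₂ : ℕ} (hM₁ : 0 < M₁) (hM₂ : 0 < M₂) {E₁ E₂ : ℝ}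
    (hE₁ : 0 < E₁) (hE₂ : 0 < E₂) {I : Type*} [Fintype I] {Q : I → ℝ}
    (hQ : Q ∈ stdSimplex ℝ I) (μ₁ : I → Fin M₁) (μ₂ : I → Fin M₂) :
    ∃ (c : Fin n → HanPast V₁ V₂ X₁ X₂ Y₁ Y₂) (C₁ : Fin M₁ → Fin n → Fin (B + 1) → V₁)
      (C₂ : Fin M₂ → Fin n → Fin (B + 1) → V₂)
      (dec₁ : Fin M₁ → (Fin n → Fin (B + 1) → Y₁) → Fin M₂)
      (dec₂ : Fin M₂ → (Fin n → Fin (B + 1) → Y₂) → Fin M₁),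
      ∑ i, Q i * ∑ y₁, ∑ y₂, (∏ j, columnProb W H.γ₁ H.γ₂ (mem₁ (c j)) (mem₂ (c j))
          (C₁ (μ₁ i) j) (C₂ (μ₂ i) j) (y₁ j) (y₂ j)) *
        (ind (dec₂ (μ₂ i) y₂ ≠ μ₁ i) + ind (dec₁ (μ₁ i) y₁ ≠ μ₂ i))
      ≤ ∑ x : Fin n → Column V₁ V₂ X₁ X₂ Y₁ Y₂ (B + 1), (∏ j, H.columnWeight (x j)) *
            ind (∏ j, H.metric₁ (x j).1 (x j).2.1 (x j).2.2.1 (x j).2.2.2.2 ≤ E₁)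
        + ((M₁ : ℝ) - 1) * E₁⁻¹
        + (∑ x : Fin n → Column V₁ V₂ X₁ X₂ Y₁ Y₂ (B + 1), (∏ j, H.columnWeight (x j)) *
            ind (∏ j, H.metric₂ (x j).1 (x j).2.2.1 (x j).2.1 (x j).2.2.2.1 ≤ E₂)
        + ((M₂ : ℝ) - 1) * E₂⁻¹) := by
  have : Nonempty (Fin M₁) := ⟨⟨0, hM₁⟩⟩
  have : Nonempty (Fin M₂) := ⟨⟨0, hM₂⟩⟩
  obtain ⟨c, C₁, C₂, dec₁, dec₂, h⟩ := twoWay_oneShot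
    (r := fun c : Fin n → HanPast V₁ V₂ X₁ X₂ Y₁ Y₂ => ∏ j, (H.past (c j)).toReal)
    (q₁ := fun v : Fin n → Fin (B + 1) → V₁ => ∏ j, ∏ b, (H.p₁ (v j b)).toReal)
    (q₂ := fun v : Fin n → Fin (B + 1) → V₂ => ∏ j, ∏ b, (H.p₂ (v j b)).toReal)
    (Φ := fun c v₁ v₂ (y₁ : Fin n → Fin (B + 1) → Y₁) (y₂ : Fin n → Fin (B + 1) → Y₂) =>
      ∏ j, columnProb W H.γ₁ H.γ₂ (mem₁ (c j)) (mem₂ (c j)) (v₁ j) (v₂ j) (y₁ j) (y₂ j))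
    (ρ₁ := fun c v₁ v₂ y₂ => ∏ j, H.metric₁ (c j) (v₁ j) (v₂ j) (y₂ j))
    (ρ₂ := fun c v₂ v₁ y₁ => ∏ j, H.metric₂ (c j) (v₂ j) (v₁ j) (y₁ j))
    (E₁ := E₁) (E₂ := E₂)
    (pi_mem_stdSimplex (toReal_mem_stdSimplex H.past))
    (pi_mem_stdSimplex (pi_mem_stdSimplex (toReal_mem_stdSimplex H.p₁)))
    (pi_mem_stdSimplex (pi_mem_stdSimplex (toReal_mem_stdSimplex H.p₂)))
    (fun c v₁ v₂ y₁ y₂ => Finset.prod_nonneg fun j _ => columnProb_nonneg _ _ _ _ _ _ _ _ _)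
    (sum_prod_columnProb W H.γ₁ H.γ₂)
    (fun c v₁ v₂ y => Finset.prod_nonneg fun j _ => H.metric₁_nonneg _ _ _ _)
    (fun c v₂ y => sum_pi_ratio_le
      (p := fun v : Fin (B + 1) → V₁ => ∏ b, (H.p₁ (v b)).toReal)
      (ρ := fun j v₁ => H.metric₁ (c j) v₁ (v₂ j) (y j))
      (pi_mem_stdSimplex (toReal_mem_stdSimplex H.p₁)).1
      (fun j v => H.metric₁_nonneg _ _ _ _) fun j => H.sum_mul_metric₁_le _ _ _)
    (fun c v₂ v₁ y => Finset.prod_nonneg fun j _ => H.metric₂_nonneg _ _ _ _)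
    (fun c v₁ y => sum_pi_ratio_le
      (p := fun v : Fin (B + 1) → V₂ => ∏ b, (H.p₂ (v b)).toReal)
      (ρ := fun j v₂ => H.metric₂ (c j) v₂ (v₁ j) (y j))
      (pi_mem_stdSimplex (toReal_mem_stdSimplex H.p₂)).1
      (fun j v => H.metric₂_nonneg _ _ _ _) fun j => H.sum_mul_metric₂_le _ _ _)
    hE₁ hE₂ hQ μ₁ μ₂
  refine ⟨c, C₁, C₂, dec₁, dec₂, h.trans (le_of_eq ?_)⟩
  rw [Fintype.card_fin, Fintype.card_fin]
  refine congrArg₂ _ (congrArg₂ _ (Eq.trans ?_ (sum_pi_column fun x =>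
      (∏ j, H.columnWeight (x j)) *
        ind (∏ j, H.metric₁ (x j).1 (x j).2.1 (x j).2.2.1 (x j).2.2.2.2 ≤ E₁)).symm) rfl)
    (congrArg₂ _ (Eq.trans ?_ (sum_pi_column fun x => (∏ j, H.columnWeight (x j)) *
        ind (∏ j, H.metric₂ (x j).1 (x j).2.2.1 (x j).2.1 (x j).2.2.2.1 ≤ E₂)).symm) rfl)
  · simp only [prod_columnWeight, not_lt]
  · simp only [prod_columnWeight, not_lt]

universe u

/-- Han's coding scheme: blocks of `n` columns, each consisting of `B + 1` channel uses, carry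
messages at rates up to `B` times the informations of the Han distribution. -/
theorem exists_code (B : ℕ) {r₁ r₂ : ℝ} (h₁ : r₁ < B * H.info₁) (h₂ : r₂ < B * H.info₂) :
    ∃ ε : ℕ → ℝ, Tendsto ε atTop (𝓝 0) ∧ ∀ n M₁ M₂ : ℕ, 0 < M₁ → 0 < M₂ →
      (M₁ : ℝ) - 1 ≤ Real.exp (n * r₁) → (M₂ : ℝ) - 1 ≤ Real.exp (n * r₂) →
      ∀ (I : Type u) [Fintype I] (Q : I → ℝ) (_ : Q ∈ stdSimplex ℝ I)
        (μ₁ : I → Fin M₁) (μ₂ : I → Fin M₂),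
      ∃ (c : Fin n → HanPast V₁ V₂ X₁ X₂ Y₁ Y₂) (C₁ : Fin M₁ → Fin n → Fin (B + 1) → V₁)
        (C₂ : Fin M₂ → Fin n → Fin (B + 1) → V₂)
        (dec₁ : Fin M₁ → (Fin n → Fin (B + 1) → Y₁) → Fin M₂)
        (dec₂ : Fin M₂ → (Fin n → Fin (B + 1) → Y₂) → Fin M₁),
        ∑ i, Q i * ∑ y₁, ∑ y₂, (∏ j, columnProb W H.γ₁ H.γ₂ (mem₁ (c j)) (mem₂ (c j))
            (C₁ (μ₁ i) j) (C₂ (μ₂ i) j) (y₁ j) (y₂ j)) *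
          (ind (dec₂ (μ₂ i) y₂ ≠ μ₁ i) + ind (dec₁ (μ₁ i) y₁ ≠ μ₂ i)) ≤ ε n := by
  -- The decoding threshold is put strictly between the rate and the mean exponent: the true
  -- codeword then passes with high probability and the false ones are exponentially unlikely to.
  obtain ⟨c₁, hc₁, hc₁'⟩ := exists_between h₁
  obtain ⟨c₂, hc₂, hc₂'⟩ := exists_between h₂
  rw [← H.mean_log_metric₁ B] at hc₁'
  rw [← H.mean_log_metric₂ B] at hc₂'
  have ht₁ := tendsto_lowerTail_prod (H.columnWeight_mem_stdSimplex (B + 1))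
    (fun z hz => H.metric₁_pos hz) hc₁'
  have ht₂ := tendsto_lowerTail_prod (H.columnWeight_mem_stdSimplex (B + 1))
    (fun z hz => H.metric₂_pos hz) hc₂'
  have hexp : ∀ {δ : ℝ}, 0 < δ → Tendsto (fun n : ℕ => Real.exp (-(n * δ))) atTop (𝓝 0) :=
    fun hδ => Real.tendsto_exp_neg_atTop_nhds_zero.comp
      (tendsto_natCast_atTop_atTop.atTop_mul_const hδ)
  have hlim := (ht₁.add (hexp (sub_pos.2 hc₁))).add (ht₂.add (hexp (sub_pos.2 hc₂)))
  rw [add_zero, add_zero] at hlim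
  refine ⟨_, hlim, ?_⟩
  intro n M₁ M₂ hM₁ hM₂ hr₁ hr₂ I _ Q hQ μ₁ μ₂
  obtain ⟨c, C₁, C₂, dec₁, dec₂, h⟩ := H.exists_block_code n B hM₁ hM₂
    (Real.exp_pos (n * c₁)) (Real.exp_pos (n * c₂)) hQ μ₁ μ₂
  have hcard : ∀ {M : ℕ} {r c : ℝ}, (M : ℝ) - 1 ≤ Real.exp (n * r) →
      ((M : ℝ) - 1) * (Real.exp (n * c))⁻¹ ≤ Real.exp (-(n * (c - r))) := by
    intro M r c hM
    calc ((M : ℝ) - 1) * (Real.exp (n * c))⁻¹ ≤ Real.exp (n * r) * (Real.exp (n * c))⁻¹ := by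
          gcongr
      _ = Real.exp (-(n * (c - r))) := by
          rw [← Real.exp_neg, ← Real.exp_add]
          congr 1; ring
  exact ⟨c, C₁, C₂, dec₁, dec₂, h.trans (add_le_add (add_le_add le_rfl (hcard hr₁))
    (add_le_add le_rfl (hcard hr₂)))⟩

end HanDistribution

/-! ### Arrangement of time into columns. -/

section Unflatten

/-- Time indices `0, …, n * L - 1` arranged in `n` columns of length `L`. -/
def unflatten {Y : Type*} {n L : ℕ} (y : Fin (n * L) → Y) (i : Fin n) (b : Fin L) : Y :=
  y (finProdFinEquiv (i, b))

lemma sum_unflatten {Y : Type*} [Fintype Y] {n L : ℕ} (f : (Fin n → Fin L → Y) → ℝ) :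
    ∑ y : Fin (n * L) → Y, f (unflatten y) = ∑ y, f y :=
  Fintype.sum_equiv ((finProdFinEquiv.symm.arrowCongr (Equiv.refl Y)).trans
    (Equiv.curry (Fin n) (Fin L) Y)) _ _ fun _ => rfl

lemma prod_unflatten {n L : ℕ} (f : Fin n × Fin L → ℝ) :
    ∏ t : Fin (n * L), f (finProdFinEquiv.symm t) = ∏ i, ∏ b, f (i, b) := by
  rw [← Fintype.prod_prod_type' (f := fun i b => f (i, b))]
  exact Fintype.prod_equiv finProdFinEquiv.symm _ _ fun _ => rfl

end Unflatten

/-! ### The separate source-channel code. -/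

section SeparateCode

variable {S₁ S₂ R₁ R₂ X₁ X₂ Y₁ Y₂ V₁ V₂ : Type*} {W : X₁ → X₂ → PMF (Y₁ × Y₂)} {n L k M₁ M₂ : ℕ}

/-- Input at time `t` of a terminal that uses columns of length `L` of Han's scheme with auxiliary
letters `v` and initial memories `o`. Only the outputs received before time `t` are used. -/
def blockInput {V X Y : Type*} (γ : V → V → X × Y → X) (y₀ : Y) (o : Fin n → V × (X × Y))
    (v : Fin n → Fin L → V) (t : Fin (n * L)) (y : Fin t → Y) : X :=
  columnInput γ (o (finProdFinEquiv.symm t).1) (v (finProdFinEquiv.symm t).1)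
    (unflatten (fun u : Fin (n * L) => if h : u.1 < t.1 then y ⟨u.1, h⟩ else y₀)
      (finProdFinEquiv.symm t).1) (finProdFinEquiv.symm t).2

lemma blockInput_eq {V X Y : Type*} (γ : V → V → X × Y → X) (y₀ : Y) (o : Fin n → V × (X × Y))
    (v : Fin n → Fin L → V) (t : Fin (n * L)) (y : Fin (n * L) → Y) :
    blockInput γ y₀ o v t (fun i => y (Fin.castLE t.2.le i))
      = columnInput γ (o (finProdFinEquiv.symm t).1) (v (finProdFinEquiv.symm t).1)
          (unflatten y (finProdFinEquiv.symm t).1) (finProdFinEquiv.symm t).2 := by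
  refine columnInput_congr γ _ _ fun b hb => ?_
  -- A column occupies consecutive times, so earlier in the column means earlier in time. The
  -- default output `y₀` is therefore never read by the input at time `t`.
  have hlt : (finProdFinEquiv ((finProdFinEquiv.symm t).1, b)).1 < t.1 := by
    conv_rhs => rw [← finProdFinEquiv.apply_symm_apply t]
    simp only [finProdFinEquiv_apply_val]
    exact Nat.add_lt_add_right hb _
  simp only [unflatten, dif_pos hlt]
  rfl

/-- Separate source-channel code built from the source encoders `φⱼ`, the source decoders `ψⱼ`, the
codebooks `Cⱼ`, the initial pasts `c` and the channel decoders `δⱼ`. -/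
def separateCode (γ₁ : V₁ → V₁ → X₁ × Y₁ → X₁) (γ₂ : V₂ → V₂ → X₂ × Y₂ → X₂) (y₁ : Y₁) (y₂ : Y₂)
    (c : Fin n → HanPast V₁ V₂ X₁ X₂ Y₁ Y₂) (C₁ : Fin M₁ → Fin n → Fin L → V₁)
    (C₂ : Fin M₂ → Fin n → Fin L → V₂) (δ₁ : Fin M₁ → (Fin n → Fin L → Y₁) → Fin M₂)
    (δ₂ : Fin M₂ → (Fin n → Fin L → Y₂) → Fin M₁) (φ₁ : (Fin k → S₁) → Fin M₁)
    (φ₂ : (Fin k → S₂) → Fin M₂) (ψ₁ : Fin M₁ → (Fin k → S₂) → Fin k → R₁)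
    (ψ₂ : Fin M₂ → (Fin k → S₁) → Fin k → R₂) : Code S₁ S₂ R₁ R₂ X₁ X₂ Y₁ Y₂ (n * L) k where
  enc₁ t s y := blockInput γ₁ y₁ (fun i => HanDistribution.mem₁ (c i)) (C₁ (φ₁ s)) t y
  enc₂ t s y := blockInput γ₂ y₂ (fun i => HanDistribution.mem₂ (c i)) (C₂ (φ₂ s)) t y
  dec₁ s y := ψ₂ (δ₁ (φ₁ s) (unflatten y)) s
  dec₂ s y := ψ₁ (δ₂ (φ₂ s) (unflatten y)) s

variable {γ₁ : V₁ → V₁ → X₁ × Y₁ → X₁} {γ₂ : V₂ → V₂ → X₂ × Y₂ → X₂} {y₁ : Y₁} {y₂ : Y₂}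
  {c : Fin n → HanPast V₁ V₂ X₁ X₂ Y₁ Y₂} {C₁ : Fin M₁ → Fin n → Fin L → V₁}
  {C₂ : Fin M₂ → Fin n → Fin L → V₂} {δ₁ : Fin M₁ → (Fin n → Fin L → Y₁) → Fin M₂}
  {δ₂ : Fin M₂ → (Fin n → Fin L → Y₂) → Fin M₁} {φ₁ : (Fin k → S₁) → Fin M₁}
  {φ₂ : (Fin k → S₂) → Fin M₂} {ψ₁ : Fin M₁ → (Fin k → S₂) → Fin k → R₁}
  {ψ₂ : Fin M₂ → (Fin k → S₁) → Fin k → R₂}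

lemma prob_separateCode (P : PMF (S₁ × S₂)) (s₁ : Fin k → S₁) (s₂ : Fin k → S₂)
    (z₁ : Fin (n * L) → Y₁) (z₂ : Fin (n * L) → Y₂) :
    (separateCode γ₁ γ₂ y₁ y₂ c C₁ C₂ δ₁ δ₂ φ₁ φ₂ ψ₁ ψ₂).prob P W s₁ s₂ z₁ z₂
      = (∏ i, (P (s₁ i, s₂ i)).toReal) * ∏ j, columnProb W γ₁ γ₂ (HanDistribution.mem₁ (c j))
          (HanDistribution.mem₂ (c j)) (C₁ (φ₁ s₁) j) (C₂ (φ₂ s₂) j) (unflatten z₁ j)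
          (unflatten z₂ j) := by
  rw [Code.prob]
  congr 1
  unfold columnProb
  rw [← prod_unflatten fun x : Fin n × Fin L => (W
    (columnInput γ₁ (HanDistribution.mem₁ (c x.1)) (C₁ (φ₁ s₁) x.1) (unflatten z₁ x.1) x.2)
    (columnInput γ₂ (HanDistribution.mem₂ (c x.1)) (C₂ (φ₂ s₂) x.1) (unflatten z₂ x.1) x.2)
    (unflatten z₁ x.1 x.2, unflatten z₂ x.1 x.2)).toReal]
  refine Finset.prod_congr rfl fun t _ => ?_
  have h₁ := blockInput_eq γ₁ y₁ (fun i => HanDistribution.mem₁ (c i)) (C₁ (φ₁ s₁)) t z₁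
  have h₂ := blockInput_eq γ₂ y₂ (fun i => HanDistribution.mem₂ (c i)) (C₂ (φ₂ s₂)) t z₂
  simp only [Code.input₁, Code.input₂, separateCode, h₁, h₂, unflatten, Prod.mk.eta,
    Equiv.apply_symm_apply]

/-- Probability that one of the channel decoders fails. -/
noncomputable def channelError [Fintype S₁] [Fintype S₂] [Fintype Y₁] [Fintype Y₂]
    (P : PMF (S₁ × S₂)) (W : X₁ → X₂ → PMF (Y₁ × Y₂)) (γ₁ : V₁ → V₁ → X₁ × Y₁ → X₁)
    (γ₂ : V₂ → V₂ → X₂ × Y₂ → X₂) (c : Fin n → HanPast V₁ V₂ X₁ X₂ Y₁ Y₂)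
    (C₁ : Fin M₁ → Fin n → Fin L → V₁) (C₂ : Fin M₂ → Fin n → Fin L → V₂)
    (δ₁ : Fin M₁ → (Fin n → Fin L → Y₁) → Fin M₂) (δ₂ : Fin M₂ → (Fin n → Fin L → Y₂) → Fin M₁)
    (φ₁ : (Fin k → S₁) → Fin M₁) (φ₂ : (Fin k → S₂) → Fin M₂) : ℝ :=
  ∑ s : (Fin k → S₁) × (Fin k → S₂), (∏ i, (P (s.1 i, s.2 i)).toReal) * ∑ z₁, ∑ z₂,
    (∏ j, columnProb W γ₁ γ₂ (HanDistribution.mem₁ (c j)) (HanDistribution.mem₂ (c j))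
      (C₁ (φ₁ s.1) j) (C₂ (φ₂ s.2) j) (z₁ j) (z₂ j)) *
    (ind (δ₂ (φ₂ s.2) z₂ ≠ φ₁ s.1) + ind (δ₁ (φ₁ s.1) z₁ ≠ φ₂ s.2))

variable [Fintype S₁] [Fintype S₂] [Fintype Y₁] [Fintype Y₂]

/-- For fixed sources the channel outputs have total probability one. Hence the cost with error-free
messages averages to itself, and the excess averages to `dmax` times the error bound. -/
lemma cost_separateCode_le (P : PMF (S₁ × S₂)) {dmax : ℝ}
    (cost : (Fin k → S₁) → (Fin k → S₂) → (Fin n → Fin L → Y₁) → (Fin n → Fin L → Y₂) → ℝ)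
    (cost₀ : (Fin k → S₁) → (Fin k → S₂) → ℝ)
    (hcost : ∀ s₁ s₂ z₁ z₂, cost s₁ s₂ z₁ z₂ ≤ cost₀ s₁ s₂
      + dmax * (ind (δ₂ (φ₂ s₂) z₂ ≠ φ₁ s₁) + ind (δ₁ (φ₁ s₁) z₁ ≠ φ₂ s₂))) :
    ∑ s₁, ∑ s₂, ∑ z₁ : Fin (n * L) → Y₁, ∑ z₂ : Fin (n * L) → Y₂,
      (separateCode γ₁ γ₂ y₁ y₂ c C₁ C₂ δ₁ δ₂ φ₁ φ₂ ψ₁ ψ₂).prob P W s₁ s₂ z₁ z₂ *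
        cost s₁ s₂ (unflatten z₁) (unflatten z₂)
      ≤ ∑ s₁, ∑ s₂, (∏ i, (P (s₁ i, s₂ i)).toReal) * cost₀ s₁ s₂
        + dmax * channelError P W γ₁ γ₂ c C₁ C₂ δ₁ δ₂ φ₁ φ₂ := by
  rw [channelError, Fintype.sum_prod_type, Finset.mul_sum, ← Finset.sum_add_distrib]
  refine Finset.sum_le_sum fun s₁ _ => ?_
  rw [Finset.mul_sum, ← Finset.sum_add_distrib]
  refine Finset.sum_le_sum fun s₂ _ => ?_
  set Φ : (Fin n → Fin L → Y₁) → (Fin n → Fin L → Y₂) → ℝ := fun z₁ z₂ =>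
    ∏ j, columnProb W γ₁ γ₂ (HanDistribution.mem₁ (c j)) (HanDistribution.mem₂ (c j))
      (C₁ (φ₁ s₁) j) (C₂ (φ₂ s₂) j) (z₁ j) (z₂ j) with hΦ
  have hΦ0 : ∀ z₁ z₂, 0 ≤ Φ z₁ z₂ := fun z₁ z₂ =>
    Finset.prod_nonneg fun j _ => columnProb_nonneg _ _ _ _ _ _ _ _ _
  have hΦ1 : ∑ z₁, ∑ z₂, Φ z₁ z₂ = 1 := 
    HanDistribution.sum_prod_columnProb _ _ _ _ _ _
  have hp0 : 0 ≤ ∏ i, (P (s₁ i, s₂ i)).toReal :=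
    Finset.prod_nonneg fun _ _ => ENNReal.toReal_nonneg
  have hsum : ∑ z₁ : Fin (n * L) → Y₁, ∑ z₂ : Fin (n * L) → Y₂,
      (separateCode γ₁ γ₂ y₁ y₂ c C₁ C₂ δ₁ δ₂ φ₁ φ₂ ψ₁ ψ₂).prob P W s₁ s₂ z₁ z₂ *
        cost s₁ s₂ (unflatten z₁) (unflatten z₂)
      = (∏ i, (P (s₁ i, s₂ i)).toReal) * ∑ z₁, ∑ z₂, Φ z₁ z₂ * cost s₁ s₂ z₁ z₂ := by
    rw [← sum_unflatten, Finset.mul_sum]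
    refine Finset.sum_congr rfl fun z₁ _ => ?_
    rw [← sum_unflatten, Finset.mul_sum]
    refine Finset.sum_congr rfl fun z₂ _ => ?_
    rw [prob_separateCode, mul_assoc]
  rw [hsum]
  calc _ ≤ (∏ i, (P (s₁ i, s₂ i)).toReal) * ∑ z₁, ∑ z₂, Φ z₁ z₂ * (cost₀ s₁ s₂
            + dmax * (ind (δ₂ (φ₂ s₂) z₂ ≠ φ₁ s₁) + ind (δ₁ (φ₁ s₁) z₁ ≠ φ₂ s₂))) :=
        mul_le_mul_of_nonneg_left (Finset.sum_le_sum fun z₁ _ => Finset.sum_le_sum fun z₂ _ =>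
          mul_le_mul_of_nonneg_left (hcost _ _ _ _) (hΦ0 _ _)) hp0
    _ = _ := by
        simp_rw [mul_add (Φ _ _), Finset.sum_add_distrib, ← Finset.sum_mul, hΦ1,
          mul_left_comm (Φ _ _) dmax, ← Finset.mul_sum]
        ring

end SeparateCode

/-- Strictness supplies a test channel and a reconstruction function below the bound, so the infimum
need not be attained. -/
lemma exists_of_mul_wzRate_lt {S S' R : Type*} [Fintype S] [Fintype S'] {P : PMF (S × S')}
    {d : S → R → ℝ≥0} {D a : ℝ} {K : ℕ} (hK : 0 < K)
    (h : (K : EReal) * wzRate P d D < (a : EReal)) :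
    ∃ (q : S → PMF (Fin (Fintype.card S + 1))) (g : Fin (Fintype.card S + 1) → S' → R),
      ∑ ω, (wzLaw P q ω).toReal * (d ω.1 (g ω.2.2 ω.2.1) : ℝ) ≤ D ∧
      condMutualInfo (wzLaw P q) (fun ω => ω.1) (fun ω => ω.2.2) (fun ω => ω.2.1) < a / K := by
  have hK' : (0 : ℝ) < K := by exact_mod_cast hK
  have hlt : wzRate P d D < ((a / K : ℝ) : EReal) := by
    by_contra! hge
    have hK0 : (0 : EReal) ≤ (K : EReal) := by
      rw [← EReal.coe_natCast]
      exact EReal.coe_nonneg.2 hK'.le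
    have hm := mul_le_mul_of_nonneg_left hge hK0
    have he : (K : EReal) * ((a / K : ℝ) : EReal) = (a : EReal) := by
      rw [← EReal.coe_natCast, ← EReal.coe_mul, mul_div_cancel₀ _ hK'.ne']
    rw [he] at hm
    exact absurd h (not_lt.2 hm)
  simp only [wzRate, iInf_lt_iff] at hlt
  obtain ⟨q, g, hD, hI⟩ := hlt
  exact ⟨q, g, hD, EReal.coe_lt_coe_iff.1 hI⟩

lemma limsup_coe_le {f g : ℕ → ℝ} {D D' : ℝ} (hfg : ∀ n, f n ≤ D' + g n)
    (hg : Tendsto g atTop (𝓝 0)) (hD : D' ≤ D) :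
    limsup (fun n => (f n : EReal)) atTop ≤ (D : EReal) := by
  have hlim : Tendsto (fun n => ((D' + g n : ℝ) : EReal)) atTop (𝓝 ((D' + 0 : ℝ) : EReal)) :=
    (continuous_coe_real_ereal.tendsto _).comp (hg.const_add D')
  rw [add_zero] at hlim
  calc limsup (fun n => (f n : EReal)) atTop
      ≤ limsup (fun n => ((D' + g n : ℝ) : EReal)) atTop :=
        limsup_le_limsup (Eventually.of_forall fun n => EReal.coe_le_coe_iff.2 (hfg n))
    _ = (D' : EReal) := hlim.limsup_eq
    _ ≤ D := EReal.coe_le_coe_iff.2 hD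

/-- A message set of rate `r` per source letter fits into `n` columns that carry rate
`(B + 1) * a` each. -/
lemma ceil_exp_sub_one_le {k n B : ℕ} {r a x : ℝ} (hx : (k : ℝ) * x ≤ n) (hr : r = x * ((B + 1) * a))
    (hx0 : 0 < x) :
    (⌈Real.exp (k * r)⌉₊ : ℝ) - 1 ≤ Real.exp (n * ((B + 1) * a)) := by
  rcases le_or_gt 0 a with ha | ha
  · have h1 := (Nat.ceil_lt_add_one (Real.exp_pos (k * r)).le).le
    have h2 : (k : ℝ) * r ≤ n * ((B + 1) * a) := by
      rw [hr, ← mul_assoc]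
      exact mul_le_mul_of_nonneg_right hx (by positivity)
    linarith [Real.exp_le_exp.2 h2]
  · have h2 : (k : ℝ) * r ≤ 0 := by
      rw [hr]
      have : (B + 1 : ℝ) * a ≤ 0 := mul_nonpos_of_nonneg_of_nonpos (by positivity) ha.le
      exact mul_nonpos_of_nonneg_of_nonpos (Nat.cast_nonneg k)
        (mul_nonpos_of_nonneg_of_nonpos hx0.le this)
    -- For a negative rate there is a single message, and nothing has to be transmitted.
    have h3 : ⌈Real.exp (k * r)⌉₊ ≤ 1 := by
      rw [Nat.ceil_le]
      simpa using h2
    have h4 : (⌈Real.exp (k * r)⌉₊ : ℝ) ≤ 1 := by exact_mod_cast h3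
    linarith [Real.exp_pos (n * ((B + 1) * a))]

lemma prod_source_mem_stdSimplex {S₁ S₂ : Type*} [Fintype S₁] [Fintype S₂] (P : PMF (S₁ × S₂))
    (k : ℕ) : (fun s : (Fin k → S₁) × (Fin k → S₂) => ∏ i, (P (s.1 i, s.2 i)).toReal)
      ∈ stdSimplex ℝ _ := by
  refine ⟨fun s => Finset.prod_nonneg fun _ _ => ENNReal.toReal_nonneg, ?_⟩
  rw [Fintype.sum_prod_type, ← sum_pi_prod_type fun x : Fin k → S₁ × S₂ => ∏ i, (P (x i)).toReal]
  exact (pi_mem_stdSimplex (toReal_mem_stdSimplex P)).2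

lemma toReal_map_swap {S₁ S₂ : Type*} (P : PMF (S₁ × S₂)) (s₁ : S₁) (s₂ : S₂) :
    ((P.map Prod.swap) (s₂, s₁)).toReal = (P (s₁, s₂)).toReal := by
  classical
  rw [PMF.map_apply, tsum_eq_single (s₁, s₂)]
  · simp
  · rintro ⟨a, b⟩ hab
    refine if_neg fun h => hab ?_
    rw [← Prod.swap_inj]
    exact h.symm

/-- Each inequality amounts to `B * (i - a) > a`, so a large `B` makes up for the one use per column
that yields no ratio. -/
lemma exists_column_length {a₁ a₂ i₁ i₂ : ℝ} (h₁ : a₁ < i₁) (h₂ : a₂ < i₂) :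
    ∃ B : ℕ, ((B : ℝ) + 1) * a₁ < B * i₁ ∧ ((B : ℝ) + 1) * a₂ < B * i₂ := by
  obtain ⟨B, hB⟩ := exists_nat_gt (max (a₁ / (i₁ - a₁)) (a₂ / (i₂ - a₂)))
  have hB₁ := (le_max_left _ _).trans_lt hB
  have hB₂ := (le_max_right _ _).trans_lt hB
  rw [div_lt_iff₀ (sub_pos.2 h₁)] at hB₁
  rw [div_lt_iff₀ (sub_pos.2 h₂)] at hB₂
  exact ⟨B, by linarith, by linarith⟩

end TwoWayCoding

open TwoWayCoding in
theorem corollary3 {S₁ S₂ R₁ R₂ X₁ X₂ Y₁ Y₂ V₁ V₂ : Type*}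
    [Fintype S₁] [Fintype S₂] [Fintype R₁] [Fintype R₂]
    [Fintype X₁] [Fintype X₂] [Fintype Y₁] [Fintype Y₂] [Fintype V₁] [Fintype V₂]
    (P : PMF (S₁ × S₂)) (W : X₁ → X₂ → PMF (Y₁ × Y₂))
    (d₁ : S₁ → R₁ → ℝ≥0) (d₂ : S₂ → R₂ → ℝ≥0) (D₁ D₂ : ℝ)
    (K N : ℕ) (hK : 0 < K) (hN : 0 < N)
    (H : TwoWayCoding.HanDistribution W V₁ V₂)
    (h₁ : (K : EReal) * TwoWayCoding.wzRate P d₁ D₁ < (((N : ℝ) * H.info₁ : ℝ) : EReal))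
    (h₂ : (K : EReal) * TwoWayCoding.wzRate (P.map Prod.swap) d₂ D₂
      < (((N : ℝ) * H.info₂ : ℝ) : EReal)) :
    TwoWayCoding.Achievable P W d₁ d₂ ((K : ℝ) / (N : ℝ)) D₁ D₂ := by
  have hK' : (0 : ℝ) < K := by exact_mod_cast hK
  have hN' : (0 : ℝ) < N := by exact_mod_cast hN
  obtain ⟨q₁, g₁, hD₁, hI₁⟩ := exists_of_mul_wzRate_lt hK h₁
  obtain ⟨q₂, g₂, hD₂, hI₂⟩ := exists_of_mul_wzRate_lt hK h₂
  obtain ⟨r₁, hr₁, hr₁'⟩ := exists_between hI₁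
  obtain ⟨r₂, hr₂, hr₂'⟩ := exists_between hI₂
  -- Conversion from rate per source letter to rate per channel use, at `K / N` source letters per
  -- use.
  have ha : ∀ {r i : ℝ}, r < N * i / K → r * K / N < i := fun h => by
    rw [div_lt_iff₀ hN', mul_comm _ (N : ℝ)]
    exact (lt_div_iff₀ hK').1 h
  obtain ⟨B, hB₁, hB₂⟩ := exists_column_length (ha hr₁') (ha hr₂')
  obtain ⟨ε₁, hε₁, hwz₁⟩ := wynerZiv P q₁ g₁ d₁ hr₁
  obtain ⟨ε₂, hε₂, hwz₂⟩ := wynerZiv (P.map Prod.swap) q₂ g₂ d₂ hr₂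
  obtain ⟨ε, hε, hch⟩ := H.exists_code B hB₁ hB₂
  -- number of columns for `k` source letters
  set x : ℝ := N / (K * (B + 1)) with hx
  have hx0 : 0 < x := by positivity
  set n : ℕ → ℕ := fun k => ⌈x * k⌉₊ with hn
  have hnk : ∀ k : ℕ, (k : ℝ) * x ≤ n k := fun k => by
    rw [mul_comm]; exact Nat.le_ceil _
  have hntop : Tendsto n atTop atTop :=
    tendsto_nat_ceil_atTop.comp ((tendsto_natCast_atTop_atTop (R := ℝ)).const_mul_atTop hx0)
  have hrx : ∀ r : ℝ, r = x * ((B + 1) * (r * K / N)) := fun r => by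
    rw [hx]; field_simp
  set M : ℝ → ℕ → ℕ := fun r k => ⌈Real.exp (k * r)⌉₊ with hM
  have hM0 : ∀ r k, 0 < M r k := fun r k => Nat.ceil_pos.2 (Real.exp_pos _)
  choose φ₁ ψ₁ hφ₁ using fun k => hwz₁ k (M r₁ k) (Nat.le_ceil _)
  choose φ₂ ψ₂ hφ₂ using fun k => hwz₂ k (M r₂ k) (Nat.le_ceil _)
  choose c C₁ C₂ δ₁ δ₂ herr using fun k => hch (n k) (M r₁ k) (M r₂ k) (hM0 r₁ k) (hM0 r₂ k)
    (ceil_exp_sub_one_le (hnk k) (hrx r₁) hx0) (ceil_exp_sub_one_le (hnk k) (hrx r₂) hx0)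
    ((Fin k → S₁) × (Fin k → S₂)) _ (prod_source_mem_stdSimplex P k)
    (fun s => φ₁ k s.1) (fun s => φ₂ k s.2)
  -- Default outputs for `blockInput` exist because the past has nonempty support.
  obtain ⟨⟨_, _, ⟨_, y₁⟩, _, y₂⟩, _⟩ := H.past.support_nonempty
  have hchlim : ∀ a : ℝ, Tendsto (fun k => a * ε (n k)) atTop (𝓝 0) := fun a => by
    simpa using (hε.comp hntop).const_mul a
  have hind : ∀ (p p' : Prop), 0 ≤ ind p + ind p' := fun p p' =>
    add_nonneg (ind_nonneg _) (ind_nonneg _)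
  refine ⟨fun k => n k * (B + 1), fun k => separateCode H.γ₁ H.γ₂ y₁ y₂ (c k) (C₁ k) (C₂ k)
    (δ₁ k) (δ₂ k) (φ₁ k) (φ₂ k) (ψ₁ k) (ψ₂ k), ?_, ?_, ?_⟩
  · have h1 : Tendsto (fun k : ℕ => (n k : ℝ) / k) atTop (𝓝 x) :=
      (tendsto_nat_ceil_mul_div_atTop hx0.le).comp tendsto_natCast_atTop_atTop
    have h2 := (h1.mul_const ((B : ℝ) + 1)).inv₀ (by positivity)
    -- The choice of `x` makes `n k * (B + 1)` channel uses for `k` letters have exactly the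
    -- limiting rate `K / N`.
    have h3 : (x * ((B : ℝ) + 1))⁻¹ = K / N := by
      rw [hx]; field_simp
    rw [h3] at h2
    refine h2.congr fun k => ?_
    push_cast
    rw [← mul_div_right_comm, inv_div]
  · refine limsup_coe_le (g := fun k => ε₁ k + totalCost d₁ * ε (n k)) (fun k => ?_)
      (by simpa using hε₁.add (hchlim (totalCost d₁))) hD₁
    refine (cost_separateCode_le (W := W) (n := n k) (L := B + 1) P
      (fun s₁ s₂ _ z₂ => (k : ℝ)⁻¹ * ∑ i, (d₁ (s₁ i) (ψ₁ k (δ₂ k (φ₂ k s₂) z₂) s₂ i) : ℝ))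
      (fun s₁ s₂ => (k : ℝ)⁻¹ * ∑ i, (d₁ (s₁ i) (ψ₁ k (φ₁ k s₁) s₂ i) : ℝ))
      (dmax := totalCost d₁) ?_).trans ?_
    · intro s₁ s₂ z₁ z₂
      by_cases he : δ₂ k (φ₂ k s₂) z₂ = φ₁ k s₁
      · rw [he]
        exact le_add_of_nonneg_right (mul_nonneg (totalCost_nonneg _) (hind _ _))
      · rw [ind_true he]
        nlinarith [blockCost_le d₁ s₁ (ψ₁ k (δ₂ k (φ₂ k s₂) z₂) s₂),
          blockCost_nonneg d₁ s₁ (ψ₁ k (φ₁ k s₁) s₂), totalCost_nonneg d₁,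
          ind_nonneg (δ₁ k (φ₁ k s₁) z₁ ≠ φ₂ k s₂)]
    · rw [← add_assoc]
      exact add_le_add (hφ₁ k) (mul_le_mul_of_nonneg_left (herr k) (totalCost_nonneg _))
  · refine limsup_coe_le (g := fun k => ε₂ k + totalCost d₂ * ε (n k)) (fun k => ?_)
      (by simpa using hε₂.add (hchlim (totalCost d₂))) hD₂
    refine (cost_separateCode_le (W := W) (n := n k) (L := B + 1) P
      (fun s₁ s₂ z₁ _ => (k : ℝ)⁻¹ * ∑ i, (d₂ (s₂ i) (ψ₂ k (δ₁ k (φ₁ k s₁) z₁) s₁ i) : ℝ))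
      (fun s₁ s₂ => (k : ℝ)⁻¹ * ∑ i, (d₂ (s₂ i) (ψ₂ k (φ₂ k s₂) s₁ i) : ℝ))
      (dmax := totalCost d₂) ?_).trans ?_
    · intro s₁ s₂ z₁ z₂
      by_cases he : δ₁ k (φ₁ k s₁) z₁ = φ₂ k s₂
      · rw [he]
        exact le_add_of_nonneg_right (mul_nonneg (totalCost_nonneg _) (hind _ _))
      · rw [ind_true he]
        nlinarith [blockCost_le d₂ s₂ (ψ₂ k (δ₁ k (φ₁ k s₁) z₁) s₁),
          blockCost_nonneg d₂ s₂ (ψ₂ k (φ₂ k s₂) s₁), totalCost_nonneg d₂,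
          ind_nonneg (δ₂ k (φ₂ k s₂) z₂ ≠ φ₁ k s₁)]
    · rw [← add_assoc]
      -- The second source was coded under the swapped law; swapping back also exchanges the order
      -- of summation.
      have h := hφ₂ k
      simp_rw [toReal_map_swap] at h
      rw [Finset.sum_comm] at h
      exact add_le_add h (mul_le_mul_of_nonneg_left (herr k) (totalCost_nonneg _))
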